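/- **Setting.** Let $\partial_t \mathbf q+\partial_x F(\mathbf q)+\partial_y G(\mathbf q)=0$ be a system of $\nu$ conservation laws in the plane, with primitive variables $V$ in an open convex set $\Omega_V\subset\mathbb R^\nu$ and conserved variables $\mathbf q=Q(V)$. Here $Q$ is injective and differentiable on $\Omega_V$ with invertible Jacobian $T^{-1}(V)=\partial Q/\partial V$, and $F,G$ are differentiable on $Q(\Omega_V)$. Put $A_V=T\,(\partial F/\partial\mathbf q)\,T^{-1}$, $B_V=T\,(\partial G/\partial\mathbf q)\,T^{-1}$, and assume that $T^{-1},A_V,B_V$ are Lipschitz continuous on compact subsets of $\Omega_V$. Assume the system is hyperbolic: for every unit vector $n$ the matrix $A_n=[A_V,B_V]\cdot n$ has a real eigenbasis, which together with its inverse is bounded uniformly in $n$ and in $V$ on compact subsets of $\Omega_V$. Write $|A_n|=R|\Lambda|R^{-1}$ when $A_n=R\Lambda R^{-1}$, and $A_n^-=(A_n-|A_n|)/2$. A numerical flux $\mathbf F_n(a,b)$ (inner state $a$, outer state $b$, unit normal $n$) is called *admissible* if it is consistent, $\mathbf F_n(a,a)=(F,G)(Q(a))\cdot n$, conservative, $\mathbf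 F_{-n}(b,a)=-\mathbf F_n(a,b)$, and Lipschitz continuous in $(a,b)$ on compact sets of states, uniformly in $n$. A mesh consists of finitely many non-overlapping polygonal cells $\omega_i$, each split into non-degenerate triangles by joining the mean $x_i$ of its vertices to the vertices; faces are either shared by two cells or boundary faces. Let $h_i=\big(|\omega_i|^{-1}\int_{\omega_i}|x-x_i|^2dx\big)^{1/2}$ and $h=\max_i h_i$. A cell is shape regular with parameter $\sigma>0$ if it contains a disc of radius $\sigma h_i$ and its perimeter is at most $h_i/\sigma$. **Scheme.** For a degree $N\ge0$, in every cell and time slab $[t^n,t^{n+1}]$, $\Delta t=t^{n+1}-t^n>0$, the ADER-DG scheme has a numerical solution $v_h^n$ (polynomial of degree $\le N$ in $x$) and a predictor $\tilde v_h$ (polynomial of total degree $\le N$ in $(x,t)$). With $H(\tilde v_h)=A_V\partial_x\tilde v_h+B_V\partial_y\tilde v_h$, the predictor satisfies $$\int_{\omega_i}\theta\,\tilde v_h\Big|_{t^{n+1}}dx-\int_{t^n}^{t^{n+1}}\!\!\int_{\omega_i}\partial_t\theta\,\tilde v_h\,dx\,dt=\int_{\omega_i}\theta(x,t^n)\,v_h^n\,dx-\int_{t^n}^{t^{n+1}}\!\!\int_{\omega_i}\theta\,H(\tilde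 v_h)\,dx\,dt$$ for all space-time polynomials $\theta$ of total degree $\le N$, and the corrector reads $$\int_{\omega_i}\phi\,(v_h^{n+1}-v_h^n)\,dx+\int_{t^n}^{t^{n+1}}\!\!\int_{\partial\omega_i}\phi\,\mathbf D\cdot n\,dS\,dt+\int_{t^n}^{t^{n+1}}\!\!\int_{\omega_i}\phi\,H(\tilde v_h)\,dx\,dt=0$$ for all polynomials $\phi$ of degree $\le N$, where $\mathbf D\cdot n=\int_0^1A_n^-\big(\tilde v_h^-+s(\tilde v_h^+-\tilde v_h^-)\big)(\tilde v_h^+-\tilde v_h^-)\,ds$, $n$ is the outward unit normal, and $\tilde v_h^-,\tilde v_h^+$ are the inner and outer traces of the predictor (on boundary faces, $\tilde v_h^+$ is a continuous prescribed state). All integrals are exact. For a numerical flux $\mathbf F$, let $\Phi_i=\frac1{\Delta t}\int_{t^n}^{t^{n+1}}\int_{\partial\omega_i}\mathbf F_n(\tilde v_h^-,\tilde v_h^+)\,dS\,dt$. The cell conservation defect is $$\Delta_i^n=\frac1{|\omega_i|\,\Delta t}\Big(\int_{\omega_i}Q(v_h^{n+1})\,dx-\int_{\omega_i}Q(v_h^n)\,dx\Big)+\frac{\Phi_i}{|\omega_i|}.$$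 **Hypotheses at cell $i$ and step $n$,** with constants $\sigma,\kappa,C,C_\partial>0$ and a compact set $K\subset\Omega_V$: 1. $\omega_i$ is shape regular with parameter $\sigma$, and $\Delta t\le\kappa h_i$. 2. On $\omega_i$, the values of $v_h^n$, $v_h^{n+1}$ and $\tilde v_h$ lie in $K$, and so do the outer traces $\tilde v_h^+$ on $\partial\omega_i$. 3. For $w=v_h^n$, and for $w=\tilde v_h(\cdot,t)$ with any $t\in[t^n,t^{n+1}]$, there is a disc $B_i$ centred at $x_i$, containing the closed cell, such that $\max\big(\|w(x)-w(x_i)\|,\,h_i\|\nabla w(x)\|\big)\le C\,h_i$ for all mesh points $x\in B_i$ (from within every cell containing $x$). 4. $\|\tilde v_h^+(x,t)-\tilde v_h^-(x,t)\|\le C_\partial h_i$ for all $x\in\partial\omega_i$ and $t\in[t^n,t^{n+1}]$. **Proposition 2.** There is an admissible numerical flux $\mathbf F$, depending only on the system, such that for all $N,K,\sigma,\kappa,C,C_\partial$ the following hold. * There is a constant $C'$, depending only on the system and on these data, such that for every mesh, every solution of the scheme, and every cell $i$ and step $n$ at which the hypotheses hold, $\|\Delta_i^n\|\le C'h_i$.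 In particular $\Delta_i^n=O(h)=o(1)$. * Consequently, for every sequence of meshes with $h\to0$ and solutions of the scheme that satisfy the hypotheses at all cells and all steps with the same constants, the scheme is quasi-conservative with the flux $\mathbf F$. That is, the averages $\bar{\mathbf q}_i^n=|\omega_i|^{-1}\int_{\omega_i}Q(v_h^n)\,dx$ satisfy $|\omega_i|\frac{\bar{\mathbf q}_i^{n+1}-\bar{\mathbf q}_i^n}{\Delta t}+\sum_\ell\mathbf F_{i\ell}=|\omega_i|\Delta_i^n$, where $\mathbf F_{i\ell}$ is the time-averaged integral over the $\ell$-th face of $\omega_i$ of $\mathbf F_n(\tilde v_h^-,\tilde v_h^+)$; the two face fluxes seen from the two sides of a shared face sum to zero; and $\sup_{i,n}\|\Delta_i^n\|\to0$ as $h\to0$. -/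

import Mathlib

open MeasureTheory Set Filter Topology

noncomputable section

namespace QuasiCons

/-! ## Hyperbolic systems in conservative and in primitive variables -/

/-- Points and vectors of the physical plane. -/
abbrev Plane : Type := EuclideanSpace ℝ (Fin 2)

/-- State vectors with `ν` components (conserved as well as primitive variables). -/
abbrev State (ν : ℕ) : Type := EuclideanSpace ℝ (Fin ν)

/-- The Jacobian in primitive variables of one flux component `f`: with `T⁻¹ = ∂Q/∂V` it is
`T (∂f/∂Q) T⁻¹`, evaluated at the primitive state `V`. -/
def primJacobian {ν : ℕ} (Q f : State ν → State ν) (V : State ν) : State ν →L[ℝ] State ν :=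
  (fderiv ℝ Q V).inverse ∘L fderiv ℝ f (Q V) ∘L fderiv ℝ Q V

/-- A hyperbolic system of `ν` conservation laws `∂ₜ q + ∂ₓ F(q) + ∂ᵧ G(q) = 0` in the plane,
together with a set of primitive variables `V`. The maps `Q`, `F = flux 0`, `G = flux 1` only
matter on the admissible primitive states and on the conserved states `Q V` that belong to them. -/
structure HyperbolicSystem (ν : ℕ) where
  /-- the admissible primitive states -/
  states : Set (State ν)
  isOpen_states : IsOpen states
  convex_states : Convex ℝ states
  /-- the conserved variables as a function of the primitive ones -/
  Q : State ν → State ν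
  /-- the two flux components, as functions of the conserved variables -/
  flux : Fin 2 → State ν → State ν
  injOn_Q : InjOn Q states
  differentiableAt_Q : ∀ V ∈ states, DifferentiableAt ℝ Q V
  isInvertible_fderiv_Q : ∀ V ∈ states, (fderiv ℝ Q V).IsInvertible
  differentiableAt_flux : ∀ c, ∀ V ∈ states, DifferentiableAt ℝ (flux c) (Q V)
  /-- `T⁻¹ = ∂Q/∂V` is Lipschitz continuous on compact sets of states -/
  lipschitz_fderiv_Q : ∀ K ⊆ states, IsCompact K → ∃ L : ℝ, ∀ V ∈ K, ∀ W ∈ K,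
    ‖fderiv ℝ Q V - fderiv ℝ Q W‖ ≤ L * ‖V - W‖
  /-- the primitive Jacobians are Lipschitz continuous on compact sets of states -/
  lipschitz_primJacobian : ∀ c, ∀ K ⊆ states, IsCompact K → ∃ L : ℝ, ∀ V ∈ K, ∀ W ∈ K,
    ‖primJacobian Q (flux c) V - primJacobian Q (flux c) W‖ ≤ L * ‖V - W‖
  /-- hyperbolicity: in every direction the Jacobian has a basis of real eigenvectors, whose
  matrix and its inverse are bounded on compact sets of states -/
  hyperbolic : ∀ K ⊆ states, IsCompact K → ∃ κ : ℝ, ∀ V ∈ K, ∀ w : Plane, ‖w‖ = 1 →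
    ∃ (b : Module.Basis (Fin ν) ℝ (State ν)) (μ : Fin ν → ℝ),
      (∀ j, (∑ c, w c • primJacobian Q (flux c) V) (b j) = μ j • b j) ∧
      (∀ j, ‖b j‖ ≤ κ) ∧ ∀ x j, |b.repr x j| ≤ κ * ‖x‖

/-- The primitive Jacobian `[A_V, B_V] · w` in the direction `w`. -/
def HyperbolicSystem.jac {ν : ℕ} (S : HyperbolicSystem ν) (w : Plane) (V : State ν) :
    State ν →L[ℝ] State ν :=
  ∑ c, w c • primJacobian S.Q (S.flux c) V

/-- The physical flux `(F, G) · w` in the direction `w` at the primitive state `V`. -/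
def HyperbolicSystem.normalFlux {ν : ℕ} (S : HyperbolicSystem ν) (w : Plane) (V : State ν) :
    State ν :=
  ∑ c, w c • S.flux c (S.Q V)

open Classical in
/-- The absolute value `R |Λ| R⁻¹` of a map `R Λ R⁻¹` that is diagonalizable over the reals (it does
not depend on the chosen eigenbasis); zero by convention for other maps. -/
def absMap {ν : ℕ} (L : State ν →L[ℝ] State ν) : State ν →L[ℝ] State ν :=
  if h : ∃ p : Module.Basis (Fin ν) ℝ (State ν) × (Fin ν → ℝ), ∀ j, L (p.1 j) = p.2 j • p.1 j then
    LinearMap.toContinuousLinearMap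
      (h.choose.1.constr ℝ fun j => |h.choose.2 j| • h.choose.1 j)
  else 0

/-- The negative part `(L - |L|) / 2`. -/
def negPart {ν : ℕ} (L : State ν →L[ℝ] State ν) : State ν →L[ℝ] State ν :=
  (1 / 2 : ℝ) • (L - absMap L)

/-- The face fluctuation `D · w`: integral of the negative part of the Jacobian in the normal
direction `w` along the segment path from the inner state `a` to the outer state `b`, applied to
the jump `b - a`. -/
def HyperbolicSystem.fluctuation {ν : ℕ} (S : HyperbolicSystem ν) (w : Plane) (a b : State ν) :
    State ν :=
  ∫ s in (0 : ℝ)..1, negPart (S.jac w (a + s • (b - a))) (b - a)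

/-- The nonconservative term `A_V ∂ₓ V + B_V ∂ᵧ V` of a field `f`, at the point `x`. -/
def HyperbolicSystem.nonconsTerm {ν : ℕ} (S : HyperbolicSystem ν) (f : Plane → State ν)
    (x : Plane) : State ν :=
  ∑ c : Fin 2, primJacobian S.Q (S.flux c) (f x) (fderiv ℝ f x (EuclideanSpace.single c 1))

/-- `F w a b` is a numerical flux in the unit normal direction `w` with inner state `a` and outer
state `b`: it is consistent with the physical flux, conservative (the fluxes seen from the two sides
of a face cancel), and locally Lipschitz continuous in the states. -/
structure IsNumericalFlux {ν : ℕ} (S : HyperbolicSystem ν)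
    (F : Plane → State ν → State ν → State ν) : Prop where
  consistent : ∀ w : Plane, ‖w‖ = 1 → ∀ V ∈ S.states, F w V V = S.normalFlux w V
  conservative : ∀ w : Plane, ‖w‖ = 1 → ∀ V ∈ S.states, ∀ W ∈ S.states, F (-w) W V = -F w V W
  lipschitz : ∀ K ⊆ S.states, IsCompact K → ∃ L : ℝ, ∀ w : Plane, ‖w‖ = 1 →
    ∀ V ∈ K, ∀ W ∈ K, ∀ V' ∈ K, ∀ W' ∈ K,
      ‖F w V W - F w V' W'‖ ≤ L * (‖V - V'‖ + ‖W - W'‖)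

/-! ## Polygonal meshes -/

/-- The mean of the vertices. -/
def vertexMean {m : ℕ} (vert : Fin (m + 3) → Plane) : Plane :=
  ((m + 3 : ℕ) : ℝ)⁻¹ • ∑ k, vert k

/-- The triangle spanned by the mean of the vertices and the `k`-th edge. -/
def subTriangle {m : ℕ} (vert : Fin (m + 3) → Plane) (k : Fin (m + 3)) : Set Plane :=
  convexHull ℝ {vertexMean vert, vert k, vert (k + 1)}

/-- A polygonal cell, given by its vertices in counterclockwise order (indices are cyclic). Joining
the mean of the vertices to the vertices splits the cell into non-degenerate positively oriented
triangles that do not overlap. -/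
structure Polygon where
  m : ℕ
  vert : Fin (m + 3) → Plane
  oriented : ∀ k,
    0 < (vert k - vertexMean vert) 0 * (vert (k + 1) - vertexMean vert) 1
      - (vert k - vertexMean vert) 1 * (vert (k + 1) - vertexMean vert) 0
  nonoverlapping : Pairwise fun k l =>
    Disjoint (interior (subTriangle vert k)) (interior (subTriangle vert l))

namespace Polygon

variable (P : Polygon)

/-- The barycenter of the cell (mean of the vertices). -/
def center : Plane := vertexMean P.vert

/-- The closed cell. -/
def carrier : Set Plane := ⋃ k, subTriangle P.vert k

/-- The area of the cell. -/
def area : ℝ := volume.real P.carrier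

/-- The `k`-th face. -/
def face (k : Fin (P.m + 3)) : Set Plane := segment ℝ (P.vert k) (P.vert (k + 1))

/-- The length of the `k`-th face. -/
def faceLength (k : Fin (P.m + 3)) : ℝ := ‖P.vert (k + 1) - P.vert k‖

/-- The perimeter. -/
def perimeter : ℝ := ∑ k, P.faceLength k

/-- The outward unit normal vector of the `k`-th face. -/
def normal (k : Fin (P.m + 3)) : Plane :=
  (P.faceLength k)⁻¹ •
    !₂[(P.vert (k + 1) - P.vert k) 1, -(P.vert (k + 1) - P.vert k) 0]

/-- The integral of `f` over the `k`-th face with respect to arc length. -/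
def faceIntegral {ν : ℕ} (k : Fin (P.m + 3)) (f : Plane → State ν) : State ν :=
  P.faceLength k • ∫ s in (0 : ℝ)..1, f (P.vert k + s • (P.vert (k + 1) - P.vert k))

/-- The characteristic length of the cell (radius of gyration about the barycenter). -/
def size : ℝ := Real.sqrt ((∫ x in P.carrier, ‖x - P.center‖ ^ 2) / P.area)

/-- Shape regularity with parameter `σ`: the cell contains a disc of radius `σ h` and its perimeter
is at most `h / σ`, where `h` is its characteristic length. -/
def ShapeRegular (σ : ℝ) : Prop :=
  (∃ c, Metric.ball c (σ * P.size) ⊆ P.carrier) ∧ P.perimeter ≤ P.size / σ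

end Polygon

/-- A tessellation of a bounded region by finitely many non-overlapping polygonal cells. The `k`-th
face of the cell `i` is either shared with the `l`-th face of a cell `j`
(`nbr i k = some ⟨j, l⟩`), or it is a boundary face (`nbr i k = none`). -/
structure Mesh where
  numCells : ℕ
  cell : Fin numCells → Polygon
  disjoint_cells : Pairwise fun i j =>
    Disjoint (interior (cell i).carrier) (interior (cell j).carrier)
  nbr : (i : Fin numCells) → Fin ((cell i).m + 3) →
    Option ((j : Fin numCells) × Fin ((cell j).m + 3))
  nbr_symm : ∀ i k j l, nbr i k = some ⟨j, l⟩ → nbr j l = some ⟨i, k⟩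
  nbr_vert : ∀ i k j l, nbr i k = some ⟨j, l⟩ →
    (cell j).vert l = (cell i).vert (k + 1) ∧ (cell j).vert (l + 1) = (cell i).vert k

/-- The mesh size: the largest characteristic length of a cell. -/
def Mesh.size (M : Mesh) : ℝ := ⨆ i, (M.cell i).size

/-! ## The path-integral ADER-DG scheme in primitive variables -/

/-- Polynomials of degree at most `N` in space. -/
def IsPoly (N : ℕ) (f : Plane → ℝ) : Prop :=
  ∃ p : MvPolynomial (Fin 2) ℝ, p.totalDegree ≤ N ∧
    ∀ x, f x = MvPolynomial.eval ![x 0, x 1] p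

/-- Polynomials of total degree at most `N` in space and time. -/
def IsPolyST (N : ℕ) (f : Plane → ℝ → ℝ) : Prop :=
  ∃ p : MvPolynomial (Fin 3) ℝ, p.totalDegree ≤ N ∧
    ∀ x t, f x t = MvPolynomial.eval ![x 0, x 1, t] p

/-- The discrete unknowns on the mesh `M`: in each cell `i` and at each time level `t n` the numerical
solution `v n i`, in each space-time slab the predictor `pred n i`, and on the boundary faces the
exterior (ghost) state `ghost n i k`. -/
structure DiscreteData (ν : ℕ) (M : Mesh) where
  numSteps : ℕ
  t : ℕ → ℝ
  v : ℕ → Fin M.numCells → Plane → State ν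
  pred : ℕ → Fin M.numCells → Plane → ℝ → State ν
  ghost : ℕ → (i : Fin M.numCells) → Fin ((M.cell i).m + 3) → Plane → ℝ → State ν

namespace DiscreteData

variable {ν : ℕ} {M : Mesh} (u : DiscreteData ν M)

/-- The length of the `n`-th time step. -/
def dt (n : ℕ) : ℝ := u.t (n + 1) - u.t n

/-- The outer trace of the predictor on the `k`-th face of the cell `i`: the predictor of the
neighbouring cell, or the exterior state on a boundary face. -/
def outer (n : ℕ) (i : Fin M.numCells) (k : Fin ((M.cell i).m + 3)) : Plane → ℝ → State ν :=
  match M.nbr i k with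
  | some p => u.pred n p.1
  | none => u.ghost n i k

/-- The weak form, on one space-time cell, of the primitive system with initial datum `v n i`, after
integration by parts in time. -/
def PredictorEq (S : HyperbolicSystem ν) (N n : ℕ) (i : Fin M.numCells) : Prop :=
  ∀ θ : Plane → ℝ → ℝ, IsPolyST N θ →
    (∫ x in (M.cell i).carrier, θ x (u.t (n + 1)) • u.pred n i x (u.t (n + 1)))
      - (∫ τ in u.t n..u.t (n + 1), ∫ x in (M.cell i).carrier,
          deriv (fun r => θ x r) τ • u.pred n i x τ)
    = (∫ x in (M.cell i).carrier, θ x (u.t n) • u.v n i x)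
      - ∫ τ in u.t n..u.t (n + 1), ∫ x in (M.cell i).carrier,
          θ x τ • S.nonconsTerm (fun y => u.pred n i y τ) x

/-- The one-step path-integral DG update of the numerical solution in one cell. -/
def CorrectorEq (S : HyperbolicSystem ν) (N n : ℕ) (i : Fin M.numCells) : Prop :=
  ∀ φ : Plane → ℝ, IsPoly N φ →
    (∫ x in (M.cell i).carrier, φ x • (u.v (n + 1) i x - u.v n i x))
      + (∫ τ in u.t n..u.t (n + 1), ∑ k, (M.cell i).faceIntegral k fun x =>
          φ x • S.fluctuation ((M.cell i).normal k) (u.pred n i x τ) (u.outer n i k x τ))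
      + (∫ τ in u.t n..u.t (n + 1), ∫ x in (M.cell i).carrier,
          φ x • S.nonconsTerm (fun y => u.pred n i y τ) x)
    = 0

/-- The discrete unknowns are produced by the ADER-DG scheme of polynomial degree `N`. -/
structure IsADERDG (S : HyperbolicSystem ν) (N : ℕ) : Prop where
  t_lt : ∀ n < u.numSteps, u.t n < u.t (n + 1)
  poly_v : ∀ n ≤ u.numSteps, ∀ i j, IsPoly N fun x => u.v n i x j
  poly_pred : ∀ n < u.numSteps, ∀ i j, IsPolyST N fun x τ => u.pred n i x τ j
  continuous_ghost : ∀ n < u.numSteps, ∀ i k, M.nbr i k = none →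
    ContinuousOn (fun z : Plane × ℝ => u.ghost n i k z.1 z.2)
      ((M.cell i).face k ×ˢ Icc (u.t n) (u.t (n + 1)))
  predictor : ∀ n < u.numSteps, ∀ i, u.PredictorEq S N n i
  corrector : ∀ n < u.numSteps, ∀ i, u.CorrectorEq S N n i

/-- During the step `n`, the numerical solution and the predictor in the cell `i`, and the outer traces
on its faces, take their values in the set of states `K`. -/
structure ValuesIn (K : Set (State ν)) (n : ℕ) (i : Fin M.numCells) : Prop where
  v_old : ∀ x ∈ (M.cell i).carrier, u.v n i x ∈ K
  v_new : ∀ x ∈ (M.cell i).carrier, u.v (n + 1) i x ∈ K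
  pred : ∀ τ ∈ Icc (u.t n) (u.t (n + 1)), ∀ x ∈ (M.cell i).carrier, u.pred n i x τ ∈ K
  outer : ∀ k, ∀ τ ∈ Icc (u.t n) (u.t (n + 1)), ∀ x ∈ (M.cell i).face k, u.outer n i k x τ ∈ K

/-- The smoothness bounds on a piecewise polynomial field `f` in a disc `B` about the barycenter of the
cell `i` that contains the closed cell: with `h` the characteristic length of the cell,
`‖f x - f xᵢ‖ ≤ C h` and `h ‖∇f x‖ ≤ C h` for `x` in `B` (from within every cell that meets `B`). -/
def SmoothNear (C : ℝ) (i : Fin M.numCells) (f : Fin M.numCells → Plane → State ν) : Prop :=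
  ∃ r : ℝ, (M.cell i).carrier ⊆ Metric.ball (M.cell i).center r ∧
    ∀ j, ∀ x ∈ (M.cell j).carrier ∩ Metric.ball (M.cell i).center r,
      max ‖f j x - f i (M.cell i).center‖ ((M.cell i).size * ‖fderiv ℝ (f j) x‖)
        ≤ C * (M.cell i).size

/-- The discrete solution is regular near the cell `i` during the step `n`: the numerical solution and
the predictor satisfy the smoothness bounds with the constant `C`, and the jumps of the predictor across
the boundary of the cell are at most `Cb h`. -/
structure LocallyRegular (C Cb : ℝ) (n : ℕ) (i : Fin M.numCells) : Prop where
  smooth_v : SmoothNear C i (u.v n)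
  smooth_pred : ∀ τ ∈ Icc (u.t n) (u.t (n + 1)), SmoothNear C i fun j x => u.pred n j x τ
  jump : ∀ k, ∀ τ ∈ Icc (u.t n) (u.t (n + 1)), ∀ x ∈ (M.cell i).face k,
    ‖u.outer n i k x τ - u.pred n i x τ‖ ≤ Cb * (M.cell i).size

/-- All hypotheses at the cell `i` and the step `n`, with their constants: shape regularity `σ`,
time step at most `κ h`, states in `K`, and regularity of the discrete solution. -/
structure RegularStep (K : Set (State ν)) (σ κ C Cb : ℝ) (n : ℕ) (i : Fin M.numCells) : Prop where
  shape : (M.cell i).ShapeRegular σ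
  timeStep : u.dt n ≤ κ * (M.cell i).size
  values : u.ValuesIn K n i
  regular : u.LocallyRegular C Cb n i

/-! ## Conservation defect and quasi-conservation -/

/-- The cell average of the conserved variables. -/
def consAverage (S : HyperbolicSystem ν) (n : ℕ) (i : Fin M.numCells) : State ν :=
  (M.cell i).area⁻¹ • ∫ x in (M.cell i).carrier, S.Q (u.v n i x)

/-- The time averaged flux through the `k`-th face of the cell `i`, with the numerical flux `F`. -/
def faceFlux (F : Plane → State ν → State ν → State ν) (n : ℕ) (i : Fin M.numCells)
    (k : Fin ((M.cell i).m + 3)) : State ν :=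
  (u.dt n)⁻¹ • ∫ τ in u.t n..u.t (n + 1), (M.cell i).faceIntegral k fun x =>
    F ((M.cell i).normal k) (u.pred n i x τ) (u.outer n i k x τ)

/-- The cell conservation defect: with `δ` the update of the numerical solution,
`(1 / (|ω| Δt)) (∫ Q(v + δ) - ∫ Q(v)) + Φ / |ω|`, where `Φ` is the flux balance. -/
def defect (S : HyperbolicSystem ν) (F : Plane → State ν → State ν → State ν) (n : ℕ)
    (i : Fin M.numCells) : State ν :=
  ((M.cell i).area⁻¹ * (u.dt n)⁻¹) •
      ((∫ x in (M.cell i).carrier, S.Q (u.v (n + 1) i x))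
        - ∫ x in (M.cell i).carrier, S.Q (u.v n i x))
    + (M.cell i).area⁻¹ • ∑ k, u.faceFlux F n i k

end DiscreteData

/-- Quasi-conservation of a sequence of discrete solutions, with the numerical flux `F`: the local
balance of the cell averages of the conserved variables holds up to the defect, the fluxes seen
from the two sides of a shared face cancel, and `sup_{i,n} ‖Δᵢⁿ‖ = o(1)`. -/
structure IsQuasiConservative {ν : ℕ} (S : HyperbolicSystem ν)
    (F : Plane → State ν → State ν → State ν) (M : ℕ → Mesh)
    (u : ∀ r, DiscreteData ν (M r)) : Prop where
  numericalFlux : IsNumericalFlux S F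
  balance : ∀ r, ∀ n < (u r).numSteps, ∀ i,
    ((M r).cell i).area •
          (((u r).dt n)⁻¹ • ((u r).consAverage S (n + 1) i - (u r).consAverage S n i))
        + ∑ k, (u r).faceFlux F n i k
      = ((M r).cell i).area • (u r).defect S F n i
  cancel : ∀ r, ∀ n < (u r).numSteps, ∀ i k j l, (M r).nbr i k = some ⟨j, l⟩ →
    (u r).faceFlux F n i k + (u r).faceFlux F n j l = 0
  vanishing : ∀ ε > 0, ∀ᶠ r in atTop, ∀ n < (u r).numSteps, ∀ i, ‖(u r).defect S F n i‖ ≤ ε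

end QuasiCons

end

/-! The numerical flux is `upwindFlux`: the central flux with dissipation `½ Q'(m) |A_n(m)| (b - a)`
at the mean state `m = (a + b)/2`. It is conservative because reversing `n` changes the sign of
`A_n` and of the jump but not of `|A_n|`. It is locally Lipschitz because `|·|` is Lipschitz on maps
with uniformly bounded eigenbases (`norm_absMap_sub_le`).

For the defect, freeze the state `Z = v_h^n(x_i)` and apply the constant matrix `Q'(Z)` to the
corrector tested with `φ = 1`. This rewrites the defect (`defect_eq`) as the sum of two errors,
divided by `|ω| Δt`.

The first error is the linearization of `Q` over the update `δ = v_h^{n+1} - v_h^n`. Testing the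
corrector with the components of `δ` and using an inverse inequality on shape regular cells gives `δ
= O(Δt)` (`norm_update_le`). Both states are `O(h)` away from `Z`, so this error is `O(|ω| h Δt)`.

The second error compares, at each time, the flux balance with `Q'(Z)` times the fluctuations and
the nonconservative volume term (`norm_balance_sub_le`). To first order the flux minus the inner
physical flux is `Q'(Z) D`. The physical flux at the cell centre drops out because the weighted
normals sum to zero, and the remaining linear part is cancelled by the volume term through the
divergence theorem with coefficients frozen at `Z`. What remains is a product of the distance `e` to
`Z`, a jump or oscillation `O(h)`, and the perimeter; or of `e`, the gradient and the area. This is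
`O(h² e)`, and `|ω|` is comparable to `h²`.

It remains to see that `e` is `O(h)` on average in time. The smoothness hypotheses control the
predictor in space at each time but do not link it to `v_h^n`. That link comes from the predictor
equation with test functions of time alone: `1` controls the final cell mean, and `(t - t^n) p'`,
where `p` is a component of the cell integral, controls its variation in time
(`integral_abs_sub_le`), with a constant free of the degree. -/

namespace QuasiCons

/-! ## The absolute value of a diagonalizable map -/

/-- `b` is a basis of eigenvectors of `L` with eigenvalues `μ`, and `b` and its dual basis are
bounded by `κ`. -/
structure IsEigenbasis {ν : ℕ} (L : State ν →L[ℝ] State ν) (κ : ℝ)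
    (b : Module.Basis (Fin ν) ℝ (State ν)) (μ : Fin ν → ℝ) : Prop where
  map_eq : ∀ j, L (b j) = μ j • b j
  norm_le : ∀ j, ‖b j‖ ≤ κ
  repr_le : ∀ x j, |b.repr x j| ≤ κ * ‖x‖

section absMap

variable {ν : ℕ} {L L₁ L₂ : State ν →L[ℝ] State ν}
  {b b₁ b₂ : Module.Basis (Fin ν) ℝ (State ν)} {μ μ₁ μ₂ : Fin ν → ℝ} {κ : ℝ}

lemma repr_apply_of_eigenbasis (h : ∀ j, L (b j) = μ j • b j) (x : State ν) (j : Fin ν) :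
    b.repr (L x) j = μ j * b.repr x j := by
  conv_lhs => rw [← b.sum_repr x]
  simp only [map_sum, map_smul, h, Finsupp.coe_finsetSum, Finset.sum_apply, Finsupp.smul_apply,
    Module.Basis.repr_self, smul_eq_mul]
  rw [Finset.sum_eq_single j]
  · simp; ring
  · intro k _ hk; simp [hk]
  · simp

/-- Independence of the eigenbasis chosen in `absMap`: in that basis an eigenvector for `m` has
nonzero coordinates only at indices whose eigenvalue is `m`, so scaling each coordinate by the
absolute eigenvalue is scaling by `|m|`. -/
lemma absMap_apply_eigenvector (h : ∀ j, L (b j) = μ j • b j) {x : State ν} {m : ℝ}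
    (hx : L x = m • x) : absMap L x = |m| • x := by
  have h' : ∃ p : Module.Basis (Fin ν) ℝ (State ν) × (Fin ν → ℝ),
    ∀ j, L (p.1 j) = p.2 j • p.1 j := ⟨(b, μ), h⟩
  obtain ⟨c, ξ, hc, hA⟩ : ∃ (c : Module.Basis (Fin ν) ℝ (State ν)) (ξ : Fin ν → ℝ),
      (∀ j, L (c j) = ξ j • c j) ∧ ∀ j, absMap L (c j) = |ξ j| • c j := by
    refine ⟨h'.choose.1, h'.choose.2, h'.choose_spec, fun j => ?_⟩
    rw [absMap, dif_pos h']
    simp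
  apply c.repr.injective
  ext j
  rw [repr_apply_of_eigenbasis hA]
  have h1 := repr_apply_of_eigenbasis hc x j
  rw [hx] at h1
  simp only [map_smul, Finsupp.smul_apply, smul_eq_mul] at h1 ⊢
  by_cases h0 : c.repr x j = 0
  · simp [h0]
  · rw [mul_right_cancel₀ h0 h1]

lemma absMap_neg (h : ∀ j, L (b j) = μ j • b j) : absMap (-L) = absMap L := by
  have h' : ∀ j, (-L) (b j) = (-μ j) • b j := fun j => by simp [h]
  have : (absMap (-L)).toLinearMap = (absMap L).toLinearMap := b.ext fun j => by
    simp [absMap_apply_eigenvector h (h j), absMap_apply_eigenvector h' (h' j)]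
  exact ContinuousLinearMap.coe_injective this

lemma absMap_zero : absMap (0 : State ν →L[ℝ] State ν) = 0 := by
  ext1 x
  have h : ∀ j, (0 : State ν →L[ℝ] State ν) ((EuclideanSpace.basisFun (Fin ν) ℝ).toBasis j)
    = (0 : ℝ) • (EuclideanSpace.basisFun (Fin ν) ℝ).toBasis j := by simp
  simpa using absMap_apply_eigenvector (μ := fun _ => 0) h (x := x) (m := 0) (by simp)

/-- The absolute value is Lipschitz continuous on maps with uniformly bounded eigenbases. -/
lemma norm_absMap_sub_le (hκ : 0 ≤ κ) (h₁ : IsEigenbasis L₁ κ b₁ μ₁)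
    (h₂ : IsEigenbasis L₂ κ b₂ μ₂) :
    ‖absMap L₁ - absMap L₂‖ ≤ (ν : ℝ) ^ 2 * κ ^ 4 * ‖L₁ - L₂‖ := by
  have hA₁ : ∀ j, absMap L₁ (b₁ j) = |μ₁ j| • b₁ j :=
    fun j => absMap_apply_eigenvector h₁.map_eq (h₁.map_eq j)
  have hA₂ : ∀ j, absMap L₂ (b₂ j) = |μ₂ j| • b₂ j :=
    fun j => absMap_apply_eigenvector h₂.map_eq (h₂.map_eq j)
  have key : ∀ k, ‖(absMap L₁ - absMap L₂) (b₂ k)‖ ≤ ν * (κ ^ 3 * ‖L₁ - L₂‖) := by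
    intro k
    rw [← b₁.sum_repr ((absMap L₁ - absMap L₂) (b₂ k))]
    refine (norm_sum_le _ _).trans ?_
    have : ∀ j ∈ Finset.univ, ‖b₁.repr ((absMap L₁ - absMap L₂) (b₂ k)) j • b₁ j‖
        ≤ κ ^ 3 * ‖L₁ - L₂‖ := by
      intro j _
      -- In the mixed bases (input `b₂`, output `b₁`) the entries of both differences are the same
      -- number times `|μ₁ j| - |μ₂ k|`, respectively `μ₁ j - μ₂ k`. The reverse triangle inequality
      -- thus bounds each entry by that of `L₁ - L₂`, and no spectral gap is needed.
      have e1 : b₁.repr ((absMap L₁ - absMap L₂) (b₂ k)) j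
          = (|μ₁ j| - |μ₂ k|) * b₁.repr (b₂ k) j := by
        simp only [_root_.sub_apply, map_sub, Finsupp.sub_apply,
          repr_apply_of_eigenbasis hA₁, hA₂ k, map_smul, Finsupp.smul_apply, smul_eq_mul]
        ring
      have e2 : b₁.repr ((L₁ - L₂) (b₂ k)) j = (μ₁ j - μ₂ k) * b₁.repr (b₂ k) j := by
        simp only [_root_.sub_apply, map_sub, Finsupp.sub_apply,
          repr_apply_of_eigenbasis h₁.map_eq, h₂.map_eq k, map_smul, Finsupp.smul_apply,
          smul_eq_mul]
        ring
      have e3 : |b₁.repr ((absMap L₁ - absMap L₂) (b₂ k)) j| ≤ κ ^ 2 * ‖L₁ - L₂‖ := by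
        rw [e1, abs_mul]
        calc _ ≤ |μ₁ j - μ₂ k| * |b₁.repr (b₂ k) j| := by
              exact mul_le_mul_of_nonneg_right (abs_abs_sub_abs_le (μ₁ j) (μ₂ k)) (abs_nonneg _)
          _ = |b₁.repr ((L₁ - L₂) (b₂ k)) j| := by rw [e2, abs_mul]
          _ ≤ κ * ‖(L₁ - L₂) (b₂ k)‖ := h₁.repr_le _ _
          _ ≤ κ * (‖L₁ - L₂‖ * κ) := by
              gcongr; exact (ContinuousLinearMap.le_opNorm _ _).trans (by gcongr; exact h₂.norm_le k)
          _ = _ := by ring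
      rw [norm_smul, Real.norm_eq_abs]
      calc _ ≤ (κ ^ 2 * ‖L₁ - L₂‖) * κ := by gcongr; exact h₁.norm_le j
        _ = _ := by ring
    refine (Finset.sum_le_sum this).trans ?_
    simp
  refine ContinuousLinearMap.opNorm_le_bound _ (by positivity) fun x => ?_
  conv_lhs => rw [← b₂.sum_repr x, map_sum]
  refine (norm_sum_le _ _).trans ?_
  have : ∀ k ∈ Finset.univ, ‖(absMap L₁ - absMap L₂) (b₂.repr x k • b₂ k)‖
      ≤ (κ * ‖x‖) * (ν * (κ ^ 3 * ‖L₁ - L₂‖)) := by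
    intro k _
    rw [map_smul, norm_smul, Real.norm_eq_abs]
    gcongr
    · exact h₂.repr_le x k
    · exact key k
  refine (Finset.sum_le_sum this).trans (le_of_eq ?_)
  simp
  ring

/-- Comparison with the zero map, for which every basis is an eigenbasis. -/
lemma norm_absMap_le (hκ : 0 ≤ κ) (h : IsEigenbasis L κ b μ) :
    ‖absMap L‖ ≤ (ν : ℝ) ^ 2 * κ ^ 4 * ‖L‖ := by
  have h0 : IsEigenbasis (0 : State ν →L[ℝ] State ν) κ b (fun _ => 0) :=
    ⟨by simp, h.norm_le, h.repr_le⟩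
  simpa [absMap_zero] using norm_absMap_sub_le hκ h h0

end absMap

/-! ## Bounds for a hyperbolic system on a convex compact set of states -/

namespace HyperbolicSystem

variable {ν : ℕ} (S : HyperbolicSystem ν)

/-- The derivative of the flux component `c` with respect to the primitive variables. -/
noncomputable def fluxDeriv (c : Fin 2) (V : State ν) : State ν →L[ℝ] State ν :=
  fderiv ℝ S.Q V ∘L primJacobian S.Q (S.flux c) V

/-- The chain rule gives `f'(Q V) Q'(V)`, and since `Q'(V)` is invertible this equals `Q'(V)` times
the primitive Jacobian. The second form is the one whose factors are Lipschitz by hypothesis. -/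
lemma hasFDerivAt_flux (c : Fin 2) {V : State ν} (hV : V ∈ S.states) :
    HasFDerivAt (fun W => S.flux c (S.Q W)) (S.fluxDeriv c V) V := by
  have h := (S.differentiableAt_flux c V hV).hasFDerivAt.comp V
    (S.differentiableAt_Q V hV).hasFDerivAt
  have e : S.fluxDeriv c V = fderiv ℝ (S.flux c) (S.Q V) ∘L fderiv ℝ S.Q V := by
    obtain ⟨e, he⟩ := S.isInvertible_fderiv_Q V hV
    unfold fluxDeriv primJacobian
    rw [← he, ContinuousLinearMap.inverse_equiv]
    ext1 x
    simp
  rw [e]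
  exact h

/-- The numbers that bound the coefficients of the system on the set of states `K`. -/
structure BoundedOn (K : Set (State ν)) (L : ℝ) : Prop where
  one_le : 1 ≤ L
  convex : Convex ℝ K
  compact : IsCompact K
  subset : K ⊆ S.states
  norm_fderiv_Q : ∀ V ∈ K, ‖fderiv ℝ S.Q V‖ ≤ L
  lip_fderiv_Q : ∀ V ∈ K, ∀ W ∈ K, ‖fderiv ℝ S.Q V - fderiv ℝ S.Q W‖ ≤ L * ‖V - W‖
  norm_primJacobian : ∀ c, ∀ V ∈ K, ‖primJacobian S.Q (S.flux c) V‖ ≤ L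
  lip_primJacobian : ∀ c, ∀ V ∈ K, ∀ W ∈ K,
    ‖primJacobian S.Q (S.flux c) V - primJacobian S.Q (S.flux c) W‖ ≤ L * ‖V - W‖
  norm_absMap : ∀ w : Plane, ‖w‖ = 1 → ∀ V ∈ K, ‖absMap (S.jac w V)‖ ≤ L
  lip_absMap : ∀ w : Plane, ‖w‖ = 1 → ∀ V ∈ K, ∀ W ∈ K,
    ‖absMap (S.jac w V) - absMap (S.jac w W)‖ ≤ L * ‖V - W‖

lemma abs_apply_le_one {w : Plane} (hw : ‖w‖ = 1) (c : Fin 2) : |w c| ≤ 1 := by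
  have := PiLp.norm_apply_le w c
  rwa [hw, Real.norm_eq_abs] at this

/-- The factor 2 counts the coordinate directions; each component of a unit vector is at most 1 in
absolute value. -/
lemma norm_sum_smul_le {E : Type*} [SeminormedAddCommGroup E] [NormedSpace ℝ E]
    {w : Plane} (hw : ‖w‖ = 1) (g : Fin 2 → E)
    {M : ℝ} (hg : ∀ c, ‖g c‖ ≤ M) : ‖∑ c, w c • g c‖ ≤ 2 * M := by
  refine (norm_sum_le _ _).trans ?_
  have : ∀ c ∈ Finset.univ, ‖w c • g c‖ ≤ M := fun c _ => by
    rw [norm_smul, Real.norm_eq_abs]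
    calc _ ≤ 1 * ‖g c‖ := by gcongr; exact abs_apply_le_one hw c
      _ ≤ M := by rw [one_mul]; exact hg c
  refine (Finset.sum_le_sum this).trans ?_
  simp

variable {S}

lemma exists_eigenbasis {K : Set (State ν)} (hK : K ⊆ S.states) (hc : IsCompact K) :
    ∃ κ, 0 ≤ κ ∧ ∀ V ∈ K, ∀ w : Plane, ‖w‖ = 1 →
      ∃ b μ, IsEigenbasis (S.jac w V) κ b μ := by
  obtain ⟨κ, h⟩ := S.hyperbolic K hK hc
  refine ⟨max κ 0, le_max_right _ _, fun V hV w hw => ?_⟩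
  obtain ⟨b, μ, h1, h2, h3⟩ := h V hV w hw
  exact ⟨b, μ, h1, fun j => (h2 j).trans (le_max_left _ _), fun x j => (h3 x j).trans
    (by gcongr; exact le_max_left _ _)⟩

/-- A map that is Lipschitz continuous on a compact set is bounded on it. -/
lemma exists_bound_of_lipschitz {E F : Type*} [NormedAddCommGroup E] [NormedAddCommGroup F]
    {K : Set E} (hK : IsCompact K) (f : E → F) {L : ℝ}
    (h : ∀ V ∈ K, ∀ W ∈ K, ‖f V - f W‖ ≤ L * ‖V - W‖) : ∃ M, ∀ V ∈ K, ‖f V‖ ≤ M := by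
  have hf : ContinuousOn f K := by
    have : LipschitzOnWith (Real.toNNReal L) f K := LipschitzOnWith.of_dist_le_mul
      fun x hx y hy => by
        rw [dist_eq_norm, dist_eq_norm]
        exact (h x hx y hy).trans (by gcongr; exact Real.le_coe_toNNReal L)
    exact this.continuousOn
  exact hK.exists_bound_of_continuousOn hf

theorem exists_boundedOn {K : Set (State ν)} (hK : K ⊆ S.states) (hc : IsCompact K)
    (hconv : Convex ℝ K) : ∃ L, S.BoundedOn K L := by
  obtain ⟨L1, h1⟩ := S.lipschitz_fderiv_Q K hK hc
  obtain ⟨M1, k1⟩ := exists_bound_of_lipschitz hc _ h1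
  choose L2 h2 using fun c => S.lipschitz_primJacobian c K hK hc
  choose M2 k2 using fun c => exists_bound_of_lipschitz hc _ (h2 c)
  obtain ⟨κ, hκ, hb⟩ := exists_eigenbasis hK hc
  have l2 : ∀ c, L2 c ≤ |L2 0| + |L2 1| := by
    intro c
    have := abs_nonneg (L2 0); have := abs_nonneg (L2 1)
    fin_cases c
    · have := le_abs_self (L2 0); simp; linarith
    · have := le_abs_self (L2 1); simp; linarith
  have m2 : ∀ c, M2 c ≤ |M2 0| + |M2 1| := by
    intro c
    have := abs_nonneg (M2 0); have := abs_nonneg (M2 1)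
    fin_cases c
    · have := le_abs_self (M2 0); simp; linarith
    · have := le_abs_self (M2 1); simp; linarith
  set L2' := |L2 0| + |L2 1|
  set M2' := |M2 0| + |M2 1|
  have hL2' : 0 ≤ L2' := by positivity
  have hM2' : 0 ≤ M2' := by positivity
  have hJ : ∀ w : Plane, ‖w‖ = 1 → ∀ V ∈ K, ‖S.jac w V‖ ≤ 2 * M2' := fun w hw V hV =>
    norm_sum_smul_le hw _ fun c => (k2 c V hV).trans (m2 c)
  have hJL : ∀ w : Plane, ‖w‖ = 1 → ∀ V ∈ K, ∀ W ∈ K,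
      ‖S.jac w V - S.jac w W‖ ≤ 2 * (L2' * ‖V - W‖) := fun w hw V hV W hW => by
    have e : S.jac w V - S.jac w W = ∑ c, w c • (primJacobian S.Q (S.flux c) V
        - primJacobian S.Q (S.flux c) W) := by
      simp only [jac, smul_sub, Finset.sum_sub_distrib]
    rw [e]
    exact norm_sum_smul_le hw _ fun c => (h2 c V hV W hW).trans
      (by gcongr; exact l2 c)
  -- `A` is the Lipschitz constant of the absolute value in `norm_absMap_sub_le`; `2 * M2'` and `2 *
  -- L2'` are a bound and a Lipschitz constant for the directional Jacobian. `T` dominates all the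
  -- constants at once.
  set A := (ν : ℝ) ^ 2 * κ ^ 4
  have hA : 0 ≤ A := by positivity
  set T := 1 + |L1| + |M1| + L2' + M2' + A * (2 * M2') + A * (2 * L2')
  have hA1 : 0 ≤ A * (2 * M2') := by positivity
  have hA2 : 0 ≤ A * (2 * L2') := by positivity
  have a1 := abs_nonneg L1
  have a2 := abs_nonneg M1
  have a3 := le_abs_self L1
  have a4 := le_abs_self M1
  refine ⟨T, ⟨by linarith, hconv, hc, hK, fun V hV => (k1 V hV).trans (by linarith),
    fun V hV W hW => (h1 V hV W hW).trans ?_, fun c V hV => (k2 c V hV).trans ?_,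
    fun c V hV W hW => (h2 c V hV W hW).trans ?_, fun w hw V hV => ?_,
    fun w hw V hV W hW => ?_⟩⟩
  · gcongr; linarith
  · have := m2 c; linarith
  · gcongr; have := l2 c; linarith
  · obtain ⟨b, μ, h⟩ := hb V hV w hw
    refine (norm_absMap_le hκ h).trans ?_
    calc _ ≤ A * (2 * M2') := by gcongr; exact hJ w hw V hV
      _ ≤ T := by linarith
  · obtain ⟨b, μ, h⟩ := hb V hV w hw
    obtain ⟨b', μ', h'⟩ := hb W hW w hw
    refine (norm_absMap_sub_le hκ h h').trans ?_
    calc _ ≤ A * (2 * (L2' * ‖V - W‖)) := by gcongr; exact hJL w hw V hV W hW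
      _ = A * (2 * L2') * ‖V - W‖ := by ring
      _ ≤ T * ‖V - W‖ := by gcongr; linarith

/-! ## The numerical flux -/

section flux

variable {ν : ℕ} {S : HyperbolicSystem ν} {K : Set (State ν)} {L : ℝ}

/-- Linearization error on a convex set of a map whose derivative is Lipschitz continuous. -/
lemma norm_sub_sub_fderiv_le {E F : Type*} [NormedAddCommGroup E] [NormedSpace ℝ E]
    [NormedAddCommGroup F] [NormedSpace ℝ F] {f : E → F} {f' : E → E →L[ℝ] F} {K : Set E} {l : ℝ}
    (hl : 0 ≤ l) (hK : Convex ℝ K) (hf : ∀ V ∈ K, HasFDerivAt f (f' V) V)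
    (hf' : ∀ V ∈ K, ∀ W ∈ K, ‖f' V - f' W‖ ≤ l * ‖V - W‖) {V W Z : E} (hV : V ∈ K) (hW : W ∈ K)
    (hZ : Z ∈ K) : ‖f V - f W - f' Z (V - W)‖ ≤ l * (‖V - Z‖ + ‖W - Z‖) * ‖V - W‖ := by
  have hs : segment ℝ W V ⊆ K := hK.segment_subset hW hV
  refine (convex_segment W V).norm_image_sub_le_of_norm_hasFDerivWithin_le'
    (f' := f') (fun x hx => (hf x (hs hx)).hasFDerivWithinAt) (fun x hx => ?_)
    (left_mem_segment ℝ W V) (right_mem_segment ℝ W V)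
  refine (hf' x (hs hx) Z hZ).trans ?_
  gcongr
  -- This ball is convex and contains both endpoints, so the derivative along the whole segment
  -- differs little from its value at `Z`.
  have h1 : segment ℝ W V ⊆ Metric.closedBall Z (‖V - Z‖ + ‖W - Z‖) := by
    refine (convex_closedBall _ _).segment_subset ?_ ?_
    · rw [mem_closedBall_iff_norm]; linarith [norm_nonneg (V - Z)]
    · rw [mem_closedBall_iff_norm]; linarith [norm_nonneg (W - Z)]
  have := h1 hx
  rwa [mem_closedBall_iff_norm] at this

lemma norm_comp_sub_comp_le {E : Type*} [NormedAddCommGroup E] [NormedSpace ℝ E]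
    {A A' B B' : E →L[ℝ] E} {L d : ℝ} (hL : 0 ≤ L) (hd : 0 ≤ d) (hA : ‖A‖ ≤ L) (hB' : ‖B'‖ ≤ L)
    (hAA : ‖A - A'‖ ≤ L * d) (hBB : ‖B - B'‖ ≤ L * d) :
    ‖A ∘L B - A' ∘L B'‖ ≤ 2 * L ^ 2 * d := by
  have e : A ∘L B - A' ∘L B' = A ∘L (B - B') + (A - A') ∘L B' := by
    ext1 x; simp
  rw [e]
  calc _ ≤ ‖A‖ * ‖B - B'‖ + ‖A - A'‖ * ‖B'‖ :=
        (norm_add_le _ _).trans (add_le_add (ContinuousLinearMap.opNorm_comp_le _ _)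
          (ContinuousLinearMap.opNorm_comp_le _ _))
    _ ≤ L * (L * d) + L * d * L := by gcongr
    _ = _ := by ring

lemma norm_half_add_sub_le {E : Type*} [NormedAddCommGroup E] [NormedSpace ℝ E] (a b a' b' : E) :
    ‖(1 / 2 : ℝ) • (a + b) - (1 / 2 : ℝ) • (a' + b')‖ ≤ ‖a - a'‖ + ‖b - b'‖ := by
  have e : (1 / 2 : ℝ) • (a + b) - (1 / 2 : ℝ) • (a' + b')
      = (1 / 2 : ℝ) • ((a - a') + (b - b')) := by module
  rw [e, norm_smul, Real.norm_eq_abs, abs_of_pos (by norm_num)]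
  have := norm_add_le (a - a') (b - b')
  linarith [norm_nonneg (a - a'), norm_nonneg (b - b')]

lemma norm_lineMap_sub_le {E : Type*} [NormedAddCommGroup E] [NormedSpace ℝ E] (a b a' b' : E)
    {s : ℝ} (hs : s ∈ Icc (0 : ℝ) 1) :
    ‖(a + s • (b - a)) - (a' + s • (b' - a'))‖ ≤ ‖a - a'‖ + ‖b - b'‖ := by
  have e : (a + s • (b - a)) - (a' + s • (b' - a')) = (1 - s) • (a - a') + s • (b - b') := by
    module
  rw [e]
  refine (norm_add_le _ _).trans ?_
  rw [norm_smul, norm_smul, Real.norm_eq_abs, Real.norm_eq_abs, abs_of_nonneg hs.1,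
    abs_of_nonneg (by linarith [hs.2])]
  nlinarith [norm_nonneg (a - a'), norm_nonneg (b - b'), hs.1, hs.2]

lemma add_smul_sub_mem {E : Type*} [AddCommGroup E] [Module ℝ E] {K : Set E} (hK : Convex ℝ K)
    {a b : E} (ha : a ∈ K) (hb : b ∈ K) {s : ℝ} (hs : s ∈ Icc (0 : ℝ) 1) :
    a + s • (b - a) ∈ K := by
  refine hK.segment_subset ha hb ?_
  rw [segment_eq_image']
  exact ⟨s, hs, rfl⟩

lemma half_add_mem {E : Type*} [AddCommGroup E] [Module ℝ E] {K : Set E} (hK : Convex ℝ K)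
    {a b : E} (ha : a ∈ K) (hb : b ∈ K) : (1 / 2 : ℝ) • (a + b) ∈ K := by
  rw [smul_add]
  exact hK ha hb (by norm_num) (by norm_num) (by norm_num)

variable (S) in
/-- The central flux with the upwind dissipation of the arithmetic mean state. -/
noncomputable def upwindFlux (w : Plane) (a b : State ν) : State ν :=
  (1 / 2 : ℝ) • (S.normalFlux w a + S.normalFlux w b)
    - (1 / 2 : ℝ) • (fderiv ℝ S.Q ((1 / 2 : ℝ) • (a + b)) ∘L
        absMap (S.jac w ((1 / 2 : ℝ) • (a + b)))) (b - a)

namespace BoundedOn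

variable (B : S.BoundedOn K L)
include B

lemma pos : 0 < L := lt_of_lt_of_le one_pos B.one_le

/-- The fluxes are only assumed differentiable; the Lipschitz modulus of the derivative in primitive
variables is inherited from its two factors `Q'` and the primitive Jacobian. -/
lemma lip_fluxDeriv (c : Fin 2) {V W : State ν} (hV : V ∈ K) (hW : W ∈ K) :
    ‖S.fluxDeriv c V - S.fluxDeriv c W‖ ≤ 2 * L ^ 2 * ‖V - W‖ :=
  norm_comp_sub_comp_le B.pos.le (norm_nonneg _) (B.norm_fderiv_Q V hV) (B.norm_primJacobian c W hW)
    (B.lip_fderiv_Q V hV W hW) (B.lip_primJacobian c V hV W hW)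

lemma norm_fluxDeriv (c : Fin 2) {V : State ν} (hV : V ∈ K) : ‖S.fluxDeriv c V‖ ≤ L ^ 2 := by
  refine (ContinuousLinearMap.opNorm_comp_le _ _).trans ?_
  rw [pow_two]
  exact mul_le_mul (B.norm_fderiv_Q V hV) (B.norm_primJacobian c V hV) (norm_nonneg _) B.pos.le

lemma linearize_Q {V W Z : State ν} (hV : V ∈ K) (hW : W ∈ K) (hZ : Z ∈ K) :
    ‖S.Q V - S.Q W - fderiv ℝ S.Q Z (V - W)‖ ≤ L * (‖V - Z‖ + ‖W - Z‖) * ‖V - W‖ :=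
  norm_sub_sub_fderiv_le B.pos.le B.convex
    (fun V hV => (S.differentiableAt_Q V (B.subset hV)).hasFDerivAt) B.lip_fderiv_Q hV hW hZ

lemma linearize_flux (c : Fin 2) {V W Z : State ν} (hV : V ∈ K) (hW : W ∈ K) (hZ : Z ∈ K) :
    ‖S.flux c (S.Q V) - S.flux c (S.Q W) - S.fluxDeriv c Z (V - W)‖
      ≤ 2 * L ^ 2 * (‖V - Z‖ + ‖W - Z‖) * ‖V - W‖ :=
  norm_sub_sub_fderiv_le (f := fun V => S.flux c (S.Q V)) (by positivity) B.convex
    (fun V hV => S.hasFDerivAt_flux c (B.subset hV))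
    (fun V hV W hW => B.lip_fluxDeriv c hV hW) hV hW hZ

lemma lip_flux (c : Fin 2) {V W : State ν} (hV : V ∈ K) (hW : W ∈ K) :
    ‖S.flux c (S.Q V) - S.flux c (S.Q W)‖ ≤ L ^ 2 * ‖V - W‖ :=
  B.convex.norm_image_sub_le_of_norm_hasFDerivWithin_le (f := fun V => S.flux c (S.Q V))
    (fun _ hV => (S.hasFDerivAt_flux c (B.subset hV)).hasFDerivWithinAt)
    (fun _ hV => B.norm_fluxDeriv c hV) hW hV

lemma lip_normalFlux {w : Plane} (hw : ‖w‖ = 1) {V W : State ν} (hV : V ∈ K) (hW : W ∈ K) :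
    ‖S.normalFlux w V - S.normalFlux w W‖ ≤ 2 * (L ^ 2 * ‖V - W‖) := by
  have e : S.normalFlux w V - S.normalFlux w W
      = ∑ c, w c • (S.flux c (S.Q V) - S.flux c (S.Q W)) := by
    simp only [normalFlux, smul_sub, Finset.sum_sub_distrib]
  rw [e]
  exact norm_sum_smul_le hw _ fun c => B.lip_flux c hV hW

lemma linearize_normalFlux {w : Plane} (hw : ‖w‖ = 1) {V W Z : State ν} (hV : V ∈ K) (hW : W ∈ K)
    (hZ : Z ∈ K) :
    ‖S.normalFlux w V - S.normalFlux w W - fderiv ℝ S.Q Z (S.jac w Z (V - W))‖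
      ≤ 2 * (2 * L ^ 2 * (‖V - Z‖ + ‖W - Z‖) * ‖V - W‖) := by
  have e : S.normalFlux w V - S.normalFlux w W - fderiv ℝ S.Q Z (S.jac w Z (V - W))
      = ∑ c, w c • (S.flux c (S.Q V) - S.flux c (S.Q W) - S.fluxDeriv c Z (V - W)) := by
    simp [normalFlux, smul_sub, jac, fluxDeriv]
    abel
  rw [e]
  exact norm_sum_smul_le hw _ fun c => B.linearize_flux c hV hW hZ

lemma lip_jac {w : Plane} (hw : ‖w‖ = 1) {V W : State ν} (hV : V ∈ K) (hW : W ∈ K) :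
    ‖S.jac w V - S.jac w W‖ ≤ 2 * (L * ‖V - W‖) := by
  have e : S.jac w V - S.jac w W = ∑ c, w c • (primJacobian S.Q (S.flux c) V
      - primJacobian S.Q (S.flux c) W) := by
    simp only [jac, smul_sub, Finset.sum_sub_distrib]
  rw [e]
  exact norm_sum_smul_le hw _ fun c => B.lip_primJacobian c V hV W hW

lemma lip_negPart {w : Plane} (hw : ‖w‖ = 1) {V W : State ν} (hV : V ∈ K) (hW : W ∈ K) :
    ‖negPart (S.jac w V) - negPart (S.jac w W)‖ ≤ 2 * L * ‖V - W‖ := by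
  have e : negPart (S.jac w V) - negPart (S.jac w W) = (1 / 2 : ℝ) • ((S.jac w V - S.jac w W)
      - (absMap (S.jac w V) - absMap (S.jac w W))) := by
    unfold negPart; module
  rw [e, norm_smul, Real.norm_eq_abs, abs_of_pos (by norm_num)]
  have h1 := norm_sub_le (S.jac w V - S.jac w W) (absMap (S.jac w V) - absMap (S.jac w W))
  have h2 := B.lip_jac hw hV hW
  have h3 := B.lip_absMap w hw V hV W hW
  have := mul_nonneg B.pos.le (norm_nonneg (V - W))
  linarith

lemma norm_negPart {w : Plane} (hw : ‖w‖ = 1) {V : State ν} (hV : V ∈ K) :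
    ‖negPart (S.jac w V)‖ ≤ 2 * L := by
  unfold negPart
  rw [norm_smul, Real.norm_eq_abs, abs_of_pos (by norm_num)]
  have h1 := norm_sub_le (S.jac w V) (absMap (S.jac w V))
  have h2 : ‖S.jac w V‖ ≤ 2 * L :=
    norm_sum_smul_le hw _ fun c => B.norm_primJacobian c V hV
  have h3 := B.norm_absMap w hw V hV
  linarith [B.pos]

lemma continuousOn_negPart {w : Plane} (hw : ‖w‖ = 1) :
    ContinuousOn (fun V => negPart (S.jac w V)) K := by
  have : LipschitzOnWith (Real.toNNReal (2 * L)) (fun V => negPart (S.jac w V)) K :=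
    LipschitzOnWith.of_dist_le_mul fun x hx y hy => by
      rw [dist_eq_norm, dist_eq_norm]
      exact (B.lip_negPart hw hx hy).trans (by gcongr; exact Real.le_coe_toNNReal _)
  exact this.continuousOn

lemma intervalIntegrable_fluctuation {w : Plane} (hw : ‖w‖ = 1) {a b : State ν} (ha : a ∈ K)
    (hb : b ∈ K) :
    IntervalIntegrable (fun s : ℝ => negPart (S.jac w (a + s • (b - a))) (b - a)) volume 0 1 := by
  refine ContinuousOn.intervalIntegrable ?_
  rw [uIcc_of_le zero_le_one]
  have h : ContinuousOn (fun s : ℝ => negPart (S.jac w (a + s • (b - a)))) (Icc 0 1) :=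
    (B.continuousOn_negPart hw).comp (f := fun s : ℝ => a + s • (b - a))
      (by fun_prop) (fun s hs => add_smul_sub_mem B.convex ha hb hs)
  exact h.clm_apply continuousOn_const

/-- Every state on the path from `a` to `b` lies within `‖a - Z‖ + ‖b - Z‖` of `Z`, so freezing the
matrix at `Z` costs that distance times the jump. -/
lemma linearize_fluctuation {w : Plane} (hw : ‖w‖ = 1) {a b Z : State ν} (ha : a ∈ K) (hb : b ∈ K)
    (hZ : Z ∈ K) : ‖S.fluctuation w a b - negPart (S.jac w Z) (b - a)‖
      ≤ 2 * L * (‖a - Z‖ + ‖b - Z‖) * ‖b - a‖ := by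
  have e : S.fluctuation w a b - negPart (S.jac w Z) (b - a) = ∫ s in (0 : ℝ)..1,
      (negPart (S.jac w (a + s • (b - a))) (b - a) - negPart (S.jac w Z) (b - a)) := by
    rw [intervalIntegral.integral_sub (B.intervalIntegrable_fluctuation hw ha hb) (by simp)]
    simp [fluctuation]
  rw [e]
  refine (intervalIntegral.norm_integral_le_of_norm_le_const
    (C := 2 * L * (‖a - Z‖ + ‖b - Z‖) * ‖b - a‖) fun s hs => ?_).trans (by simp)
  rw [uIoc_of_le zero_le_one] at hs
  have hs' : s ∈ Icc (0 : ℝ) 1 := ⟨hs.1.le, hs.2⟩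
  rw [← _root_.sub_apply]
  refine (ContinuousLinearMap.le_opNorm _ _).trans ?_
  gcongr
  refine (B.lip_negPart hw (add_smul_sub_mem B.convex ha hb hs') hZ).trans ?_
  have := B.pos
  gcongr
  simpa using norm_lineMap_sub_le a b Z Z hs'

lemma norm_fluctuation_le {w : Plane} (hw : ‖w‖ = 1) {a b : State ν} (ha : a ∈ K) (hb : b ∈ K) :
    ‖S.fluctuation w a b‖ ≤ 2 * L * ‖b - a‖ := by
  refine (intervalIntegral.norm_integral_le_of_norm_le_const
    (C := 2 * L * ‖b - a‖) fun s hs => ?_).trans (by simp)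
  rw [uIoc_of_le zero_le_one] at hs
  refine (ContinuousLinearMap.le_opNorm _ _).trans ?_
  gcongr
  exact B.norm_negPart hw (add_smul_sub_mem B.convex ha hb ⟨hs.1.le, hs.2⟩)

lemma exists_norm_sub_le : ∃ R, 0 ≤ R ∧ ∀ a ∈ K, ∀ b ∈ K, ‖b - a‖ ≤ R :=
  ⟨Metric.diam K, Metric.diam_nonneg, fun a ha b hb => by
    rw [← dist_eq_norm]
    exact Metric.dist_le_diam_of_mem B.compact.isBounded hb ha⟩

/-- Serves to make the face integrands continuous, hence integrable. The diameter `R` of `K` bounds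
the jump that multiplies the variation of the matrix. -/
lemma lip_fluctuation : ∃ M, 0 ≤ M ∧ ∀ w : Plane, ‖w‖ = 1 → ∀ a ∈ K, ∀ b ∈ K, ∀ a' ∈ K, ∀ b' ∈ K,
    ‖S.fluctuation w a b - S.fluctuation w a' b'‖ ≤ M * (‖a - a'‖ + ‖b - b'‖) := by
  obtain ⟨R, hR, h⟩ := B.exists_norm_sub_le
  have hL := B.pos
  refine ⟨2 * L * R + 2 * L, by positivity, fun w hw a ha b hb a' ha' b' hb' => ?_⟩
  unfold fluctuation
  rw [← intervalIntegral.integral_sub (B.intervalIntegrable_fluctuation hw ha hb)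
    (B.intervalIntegrable_fluctuation hw ha' hb')]
  refine (intervalIntegral.norm_integral_le_of_norm_le_const
    (C := (2 * L * R + 2 * L) * (‖a - a'‖ + ‖b - b'‖)) fun s hs => ?_).trans (by simp)
  rw [uIoc_of_le zero_le_one] at hs
  have hs' : s ∈ Icc (0 : ℝ) 1 := ⟨hs.1.le, hs.2⟩
  set X := negPart (S.jac w (a + s • (b - a)))
  set Y := negPart (S.jac w (a' + s • (b' - a')))
  have e : X (b - a) - Y (b' - a') = (X - Y) (b - a) + Y ((b - b') - (a - a')) := by
    simp only [_root_.sub_apply, map_sub]; abel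
  rw [e]
  have h1 : ‖X - Y‖ ≤ 2 * L * (‖a - a'‖ + ‖b - b'‖) := by
    refine (B.lip_negPart hw (add_smul_sub_mem B.convex ha hb hs')
      (add_smul_sub_mem B.convex ha' hb' hs')).trans ?_
    gcongr
    exact norm_lineMap_sub_le a b a' b' hs'
  have h2 : ‖Y‖ ≤ 2 * L := B.norm_negPart hw (add_smul_sub_mem B.convex ha' hb' hs')
  have h3 : ‖(b - b') - (a - a')‖ ≤ ‖a - a'‖ + ‖b - b'‖ := by
    rw [add_comm]; exact norm_sub_le _ _
  calc _ ≤ ‖X - Y‖ * ‖b - a‖ + ‖Y‖ * ‖(b - b') - (a - a')‖ := (norm_add_le _ _).trans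
        (add_le_add (ContinuousLinearMap.le_opNorm _ _) (ContinuousLinearMap.le_opNorm _ _))
    _ ≤ 2 * L * (‖a - a'‖ + ‖b - b'‖) * R + 2 * L * (‖a - a'‖ + ‖b - b'‖) := by
        gcongr; exact h a ha b hb
    _ = _ := by ring

lemma lip_dissipation {w : Plane} (hw : ‖w‖ = 1) {V W : State ν} (hV : V ∈ K) (hW : W ∈ K) :
    ‖fderiv ℝ S.Q V ∘L absMap (S.jac w V) - fderiv ℝ S.Q W ∘L absMap (S.jac w W)‖
      ≤ 2 * L ^ 2 * ‖V - W‖ :=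
  norm_comp_sub_comp_le B.pos.le (norm_nonneg _) (B.norm_fderiv_Q V hV) (B.norm_absMap w hw W hW)
    (B.lip_fderiv_Q V hV W hW) (B.lip_absMap w hw V hV W hW)

lemma norm_dissipation {w : Plane} (hw : ‖w‖ = 1) {V : State ν} (hV : V ∈ K) :
    ‖fderiv ℝ S.Q V ∘L absMap (S.jac w V)‖ ≤ L ^ 2 := by
  refine (ContinuousLinearMap.opNorm_comp_le _ _).trans ?_
  rw [pow_two]
  exact mul_le_mul (B.norm_fderiv_Q V hV) (B.norm_absMap w hw V hV) (norm_nonneg _) B.pos.le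

lemma lip_upwindFlux : ∃ M, 0 ≤ M ∧ ∀ w : Plane, ‖w‖ = 1 → ∀ a ∈ K, ∀ b ∈ K, ∀ a' ∈ K, ∀ b' ∈ K,
    ‖S.upwindFlux w a b - S.upwindFlux w a' b'‖ ≤ M * (‖a - a'‖ + ‖b - b'‖) := by
  obtain ⟨R, hR, h⟩ := B.exists_norm_sub_le
  have hL := B.pos
  refine ⟨2 * L ^ 2 + 2 * L ^ 2 * R, by positivity, fun w hw a ha b hb a' ha' b' hb' => ?_⟩
  have hm := half_add_mem B.convex ha hb
  have hm' := half_add_mem B.convex ha' hb'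
  unfold upwindFlux
  set X := fderiv ℝ S.Q ((1 / 2 : ℝ) • (a + b)) ∘L absMap (S.jac w ((1 / 2 : ℝ) • (a + b)))
  set Y := fderiv ℝ S.Q ((1 / 2 : ℝ) • (a' + b')) ∘L absMap (S.jac w ((1 / 2 : ℝ) • (a' + b')))
  have e : (1 / 2 : ℝ) • (S.normalFlux w a + S.normalFlux w b) - (1 / 2 : ℝ) • X (b - a)
      - ((1 / 2 : ℝ) • (S.normalFlux w a' + S.normalFlux w b') - (1 / 2 : ℝ) • Y (b' - a'))
      = (1 / 2 : ℝ) • ((S.normalFlux w a - S.normalFlux w a') + (S.normalFlux w b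
        - S.normalFlux w b') - ((X - Y) (b - a) + Y ((b - b') - (a - a')))) := by
    simp only [_root_.sub_apply, map_sub]; module
  rw [e, norm_smul, Real.norm_eq_abs, abs_of_pos (by norm_num)]
  set d := ‖a - a'‖ + ‖b - b'‖
  have hd : 0 ≤ d := by positivity
  have h1 : ‖X - Y‖ ≤ 2 * L ^ 2 * d := by
    refine (B.lip_dissipation hw hm hm').trans ?_
    gcongr
    exact norm_half_add_sub_le a b a' b'
  have h2 : ‖Y‖ ≤ L ^ 2 := B.norm_dissipation hw hm'
  have h3 : ‖(b - b') - (a - a')‖ ≤ d := by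
    exact (norm_sub_le _ _).trans (add_comm _ _).le
  have h4 := B.lip_normalFlux hw ha ha'
  have h5 := B.lip_normalFlux hw hb hb'
  have h6 : ‖(X - Y) (b - a) + Y ((b - b') - (a - a'))‖ ≤ 2 * L ^ 2 * d * R + L ^ 2 * d := by
    calc _ ≤ ‖X - Y‖ * ‖b - a‖ + ‖Y‖ * ‖(b - b') - (a - a')‖ := (norm_add_le _ _).trans
          (add_le_add (ContinuousLinearMap.le_opNorm _ _) (ContinuousLinearMap.le_opNorm _ _))
      _ ≤ _ := by gcongr; exact h a ha b hb
  have h7 := norm_sub_le ((S.normalFlux w a - S.normalFlux w a') + (S.normalFlux w b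
        - S.normalFlux w b')) ((X - Y) (b - a) + Y ((b - b') - (a - a')))
  have h8 := norm_add_le (S.normalFlux w a - S.normalFlux w a') (S.normalFlux w b
        - S.normalFlux w b')
  have h9 : 2 * (L ^ 2 * ‖a - a'‖) + 2 * (L ^ 2 * ‖b - b'‖) = 2 * L ^ 2 * d := by ring
  have h10 : 0 ≤ L ^ 2 * d := by positivity
  have h11 : 0 ≤ L ^ 2 * d * R := by positivity
  nlinarith

/-- Up to terms of second order, the numerical flux minus the inner physical flux is the
fluctuation, transformed to conserved variables. -/
lemma norm_upwindFlux_sub_le {w : Plane} (hw : ‖w‖ = 1) {a b Z : State ν} (ha : a ∈ K) (hb : b ∈ K)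
    (hZ : Z ∈ K) :
    ‖S.upwindFlux w a b - S.normalFlux w a - fderiv ℝ S.Q Z (S.fluctuation w a b)‖
      ≤ 5 * L ^ 2 * (‖a - Z‖ + ‖b - Z‖) * ‖b - a‖ := by
  have hL := B.pos
  have hm := half_add_mem B.convex ha hb
  unfold upwindFlux
  set X := fderiv ℝ S.Q ((1 / 2 : ℝ) • (a + b)) ∘L absMap (S.jac w ((1 / 2 : ℝ) • (a + b)))
  -- The terms frozen at `Z` cancel because `½ Q'(Z) (J - |J|)` is `Q'(Z)` times the negative part
  -- of `J`. The three remainders contribute `2 + 1 + 2 = 5` times `L ^ 2 * ε`.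
  have e : (1 / 2 : ℝ) • (S.normalFlux w a + S.normalFlux w b) - (1 / 2 : ℝ) • X (b - a)
      - S.normalFlux w a - fderiv ℝ S.Q Z (S.fluctuation w a b)
      = (1 / 2 : ℝ) • (S.normalFlux w b - S.normalFlux w a
          - fderiv ℝ S.Q Z (S.jac w Z (b - a)))
        - (1 / 2 : ℝ) • ((X - fderiv ℝ S.Q Z ∘L absMap (S.jac w Z)) (b - a))
        - fderiv ℝ S.Q Z (S.fluctuation w a b - negPart (S.jac w Z) (b - a)) := by
    simp only [negPart, _root_.sub_apply, map_sub, ContinuousLinearMap.comp_apply, map_smul,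
      _root_.smul_apply]
    module
  rw [e]
  set ε := (‖a - Z‖ + ‖b - Z‖) * ‖b - a‖ with hε
  have h1 := B.linearize_normalFlux hw hb ha hZ
  have h2 : ‖(X - fderiv ℝ S.Q Z ∘L absMap (S.jac w Z)) (b - a)‖ ≤ 2 * L ^ 2 * ε := by
    refine (ContinuousLinearMap.le_opNorm _ _).trans ?_
    rw [hε, ← mul_assoc]
    gcongr
    refine (B.lip_dissipation hw hm hZ).trans ?_
    gcongr
    have := norm_half_add_sub_le a b Z Z
    rwa [show (1 / 2 : ℝ) • (Z + Z) = Z by module] at this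
  have h3 : ‖fderiv ℝ S.Q Z (S.fluctuation w a b - negPart (S.jac w Z) (b - a))‖
      ≤ L * (2 * L * ε) := by
    refine (ContinuousLinearMap.le_opNorm _ _).trans ?_
    gcongr
    · exact B.norm_fderiv_Q Z hZ
    · refine (B.linearize_fluctuation hw ha hb hZ).trans (by rw [hε, mul_assoc])
  refine (norm_sub_le _ _).trans ((add_le_add (norm_sub_le _ _) le_rfl).trans ?_)
  rw [norm_smul, norm_smul, Real.norm_eq_abs, abs_of_pos (by norm_num)]
  have h4 : 5 * L ^ 2 * (‖a - Z‖ + ‖b - Z‖) * ‖b - a‖ = 5 * L ^ 2 * ε := by rw [hε]; ring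
  have h5 : 2 * (2 * L ^ 2 * (‖b - Z‖ + ‖a - Z‖) * ‖b - a‖) = 4 * L ^ 2 * ε := by rw [hε]; ring
  rw [h4]
  rw [h5] at h1
  linarith

lemma norm_nonconsTerm_le {f : Plane → State ν} {x : Plane} (hx : f x ∈ K) :
    ‖S.nonconsTerm f x‖ ≤ 2 * L * ‖fderiv ℝ f x‖ := by
  unfold nonconsTerm
  refine (norm_sum_le _ _).trans ?_
  have : ∀ c ∈ Finset.univ, ‖primJacobian S.Q (S.flux c) (f x)
      (fderiv ℝ f x (EuclideanSpace.single c 1))‖ ≤ L * ‖fderiv ℝ f x‖ := fun c _ => by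
    refine (ContinuousLinearMap.le_opNorm _ _).trans ?_
    have := B.pos
    gcongr
    · exact B.norm_primJacobian c _ hx
    · refine (ContinuousLinearMap.le_opNorm _ _).trans ?_
      simp
  refine (Finset.sum_le_sum this).trans (le_of_eq ?_)
  simp; ring

end BoundedOn

/-! ### Convex enlargement of the set of states, and admissibility of the flux. -/

/-- A compact subset of an open convex set is contained in a compact convex subset. -/
lemma exists_compact_convex_superset {E : Type*} [NormedAddCommGroup E] [NormedSpace ℝ E]
    [FiniteDimensional ℝ E] {K U : Set E} (hK : IsCompact K) (hU : IsOpen U) (hconv : Convex ℝ U)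
    (hKU : K ⊆ U) : ∃ K', K ⊆ K' ∧ K' ⊆ U ∧ IsCompact K' ∧ Convex ℝ K' := by
  classical
  -- Each point has a polytope neighbourhood inside `U`. Finitely many of them cover `K`, and the
  -- convex hull of all their vertices is compact and stays in the convex set `U`.
  have h : ∀ x ∈ K, ∃ u : Finset E, x ∈ interior (convexHull ℝ (u : Set E)) ∧
      convexHull ℝ (u : Set E) ⊆ U := fun x hx => by
    obtain ⟨u, h1, h2⟩ := (convex_singleton x).exists_subset_interior_convexHull_finset_of_isCompact
      isCompact_singleton (hU.mem_nhdsSet.2 (singleton_subset_iff.2 (hKU hx)))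
    exact ⟨u, h1 rfl, h2⟩
  choose! u hu huU using h
  obtain ⟨t, htK, ht⟩ := hK.elim_nhds_subcover (fun x => interior (convexHull ℝ (u x : Set E)))
    fun x hx => isOpen_interior.mem_nhds (hu x hx)
  refine ⟨convexHull ℝ (t.biUnion u : Finset E), fun x hx => ?_, convexHull_min ?_ hconv,
    (t.biUnion u).finite_toSet.isCompact_convexHull ℝ, convex_convexHull ℝ _⟩
  · obtain ⟨y, hy, hxy⟩ := mem_iUnion₂.1 (ht hx)
    refine convexHull_mono ?_ (interior_subset hxy)
    exact Finset.coe_subset.2 (Finset.subset_biUnion_of_mem u hy)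
  · intro x hx
    obtain ⟨y, hy, hxy⟩ := Finset.mem_biUnion.1 (Finset.mem_coe.1 hx)
    exact huU y (htK y hy) (subset_convexHull ℝ _ hxy)

/-- Every compact set of states is contained in a convex set with bounds. -/
lemma exists_boundedOn_superset {K : Set (State ν)} (hK : K ⊆ S.states) (hc : IsCompact K) :
    ∃ K' L, K ⊆ K' ∧ S.BoundedOn K' L := by
  obtain ⟨K', h1, h2, h3, h4⟩ :=
    exists_compact_convex_superset hc S.isOpen_states S.convex_states hK
  obtain ⟨L, hL⟩ := exists_boundedOn h2 h3 h4
  exact ⟨K', L, h1, hL⟩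

/-- Convexity of the state space makes the mean of two states admissible. Hyperbolicity at that
single state supplies the eigenbasis that `absMap_neg` needs for the symmetry under `w ↦ -w`. -/
theorem isNumericalFlux_upwindFlux (S : HyperbolicSystem ν) : IsNumericalFlux S S.upwindFlux where
  consistent w hw V hV := by
    simp only [upwindFlux, sub_self, map_zero, smul_zero, sub_zero]
    module
  conservative w hw V hV W hW := by
    have hm := half_add_mem S.convex_states hV hW
    obtain ⟨b, μ, h, -⟩ := S.hyperbolic {(1 / 2 : ℝ) • (V + W)} (by simpa using hm)
      isCompact_singleton |>.choose_spec _ rfl w hw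
    have hj : ∀ U, S.jac (-w) U = -S.jac w U := fun U => by
      ext1 x
      simp [jac, add_comm]
    have hf : ∀ U, S.normalFlux (-w) U = -S.normalFlux w U := fun U => by simp [normalFlux, add_comm]
    simp only [upwindFlux]
    rw [add_comm W V, hj, absMap_neg (L := S.jac w _) h, hf, hf, ← neg_sub W V, map_neg]
    module
  lipschitz K hK hc := by
    obtain ⟨K', L, hKK, B⟩ := exists_boundedOn_superset hK hc
    obtain ⟨M, -, hM⟩ := B.lip_upwindFlux
    exact ⟨M, fun w hw V hV W hW V' hV' W' hW' =>
      hM w hw V (hKK hV) W (hKK hW) V' (hKK hV') W' (hKK hW')⟩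

end flux
end HyperbolicSystem
/-! ## The divergence theorem on polygonal cells -/

section triangle

variable {E : Type*} [NormedAddCommGroup E] [NormedSpace ℝ E]

/-- The reference triangle. -/
def refTriangle : Set (ℝ × ℝ) := {z | 0 ≤ z.1 ∧ 0 ≤ z.2 ∧ z.1 + z.2 ≤ 1}

lemma isCompact_refTriangle : IsCompact refTriangle := by
  refine (isCompact_Icc (a := ((0, 0) : ℝ × ℝ)) (b := (1, 1))).of_isClosed_subset ?_ ?_
  · exact (isClosed_le continuous_const continuous_fst).inter
      ((isClosed_le continuous_const continuous_snd).inter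
        (isClosed_le (continuous_fst.add continuous_snd) continuous_const))
  · rintro ⟨s, r⟩ ⟨h1, h2, h3⟩
    simp only at h1 h2 h3
    exact ⟨⟨h1, h2⟩, ⟨by simp; linarith, by simp; linarith⟩⟩

lemma integral_refTriangle {G : ℝ × ℝ → E} (hG : Continuous G) :
    ∫ z in refTriangle, G z = ∫ s in (0 : ℝ)..1, ∫ r in (0 : ℝ)..(1 - s), G (s, r) := by
  have hm := isCompact_refTriangle.measurableSet
  have hi : Integrable (refTriangle.indicator G) :=
    (hG.continuousOn.integrableOn_compact isCompact_refTriangle).integrable_indicator hm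
  rw [← integral_indicator hm, Measure.volume_eq_prod, integral_prod _ hi,
    intervalIntegral.integral_of_le zero_le_one, ← integral_Icc_eq_integral_Ioc,
    ← integral_indicator measurableSet_Icc]
  congr 1
  ext s
  by_cases hs : s ∈ Icc (0 : ℝ) 1
  · rw [indicator_of_mem hs, intervalIntegral.integral_of_le (by linarith [hs.2]),
      ← integral_Icc_eq_integral_Ioc, ← integral_indicator measurableSet_Icc]
    congr 1
    ext r
    by_cases hr : r ∈ Icc (0 : ℝ) (1 - s)
    · rw [indicator_of_mem hr, indicator_of_mem]
      exact ⟨hs.1, hr.1, by simp only; linarith [hr.2]⟩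
    · rw [indicator_of_notMem hr, indicator_of_notMem]
      rintro ⟨h1, h2, h3⟩
      exact hr ⟨h2, by simp only at h3; linarith⟩
  · rw [indicator_of_notMem hs]
    have : ∀ r, refTriangle.indicator G (s, r) = 0 := fun r => by
      rw [indicator_of_notMem]
      rintro ⟨h1, h2, h3⟩
      simp only at h1 h2 h3
      exact hs ⟨h1, by linarith⟩
    simp [this]

lemma integral_refTriangle_swap {G : ℝ × ℝ → E} (hG : Continuous G) :
    ∫ z in refTriangle, G z = ∫ r in (0 : ℝ)..1, ∫ s in (0 : ℝ)..(1 - r), G (s, r) := by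
  have hs := integral_refTriangle (G := fun z => G z.swap) (by fun_prop)
  simp only [Prod.swap_prod_mk] at hs
  rw [← hs]
  have h := (Measure.measurePreserving_swap (μ := (volume : Measure ℝ))
    (ν := (volume : Measure ℝ))).setIntegral_preimage_emb
    MeasurableEquiv.prodComm.measurableEmbedding G refTriangle
  rw [← Measure.volume_eq_prod] at h
  rw [← h]
  congr 2
  ext ⟨s, r⟩
  simp only [refTriangle, mem_preimage, mem_ofPred_eq, Prod.swap_prod_mk]
  constructor
  · rintro ⟨h1, h2, h3⟩; exact ⟨h2, h1, by linarith⟩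
  · rintro ⟨h1, h2, h3⟩; exact ⟨h2, h1, by linarith⟩

/-- The signed area of the parallelogram spanned by two vectors. -/
def cross (α β : Plane) : ℝ := α 0 * β 1 - α 1 * β 0

/-- The parametrization of a triangle by the reference triangle. -/
def triangleMap (c α β : Plane) (z : ℝ × ℝ) : Plane := c + (z.1 • α + z.2 • β)

lemma convexHull_eq_image_triangleMap (c a b : Plane) :
    convexHull ℝ {c, a, b} = triangleMap c (a - c) (b - c) '' refTriangle := by
  apply Subset.antisymm
  · refine convexHull_min ?_ ?_
    · rintro x (rfl | rfl | rfl)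
      · exact ⟨(0, 0), by simp [refTriangle], by simp [triangleMap]⟩
      · exact ⟨(1, 0), by simp [refTriangle], by simp [triangleMap]⟩
      · exact ⟨(0, 1), by simp [refTriangle], by simp [triangleMap]⟩
    · rintro _ ⟨z, ⟨h1, h2, h3⟩, rfl⟩ _ ⟨z', ⟨h1', h2', h3'⟩, rfl⟩ p q hp hq hpq
      refine ⟨p • z + q • z', ⟨?_, ?_, ?_⟩, ?_⟩
      · simp; positivity
      · simp; positivity
      · simp; nlinarith
      · obtain rfl : q = 1 - p := by linarith
        simp only [triangleMap, Prod.fst_add, Prod.snd_add, Prod.smul_fst, Prod.smul_snd, smul_eq_mul]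
        module
  · rintro _ ⟨⟨s, r⟩, ⟨h1, h2, h3⟩, rfl⟩
    simp only at h1 h2 h3
    have hc : c ∈ convexHull ℝ {c, a, b} := subset_convexHull ℝ _ (by simp)
    have ha : a ∈ convexHull ℝ {c, a, b} := subset_convexHull ℝ _ (by simp)
    have hb : b ∈ convexHull ℝ {c, a, b} := subset_convexHull ℝ _ (by simp)
    have := (convex_convexHull ℝ {c, a, b}).sum_mem (t := Finset.univ) (w := ![1 - s - r, s, r])
      (z := ![c, a, b])
      (by intro i _; fin_cases i <;> simp <;> linarith) (by simp [Fin.sum_univ_three]; ring)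
      (by intro i _; fin_cases i <;> simp [hc, ha, hb])
    convert this using 1
    simp only [triangleMap, Fin.sum_univ_three, Matrix.cons_val_zero, Matrix.cons_val_one,
      Matrix.cons_val]
    module

/-- The measurable identification of `ℝ × ℝ` with the plane. -/
noncomputable def planeEquiv : ℝ × ℝ ≃ᵐ Plane :=
  MeasurableEquiv.finTwoArrow.symm.trans (MeasurableEquiv.toLp 2 (Fin 2 → ℝ))

lemma planeEquiv_apply (z : ℝ × ℝ) : planeEquiv z = !₂[z.1, z.2] := rfl

lemma measurePreserving_planeEquiv : MeasurePreserving planeEquiv volume volume :=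
  ((volume_preserving_finTwoArrow ℝ).symm _).trans (PiLp.volume_preserving_toLp (Fin 2))

/-- The linear map that sends the standard basis to `α, β`. -/
noncomputable def frameMap (α β : Plane) : Plane →L[ℝ] Plane :=
  LinearMap.toContinuousLinearMap
    { toFun := fun x => x 0 • α + x 1 • β
      map_add' := fun x y => by simp only [PiLp.add_apply]; module
      map_smul' := fun m x => by
        simp only [PiLp.smul_apply, smul_eq_mul, RingHom.id_apply]; module }

lemma frameMap_apply (α β x : Plane) : frameMap α β x = x 0 • α + x 1 • β := rfl

lemma det_frameMap (α β : Plane) : (frameMap α β).det = cross α β := by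
  rw [ContinuousLinearMap.det, ← LinearMap.det_toMatrix (EuclideanSpace.basisFun (Fin 2) ℝ).toBasis,
    Matrix.det_fin_two]
  simp [LinearMap.toMatrix_apply, frameMap_apply, cross]
  ring

/-- Affine change of variables: `cross α β` is the Jacobian determinant, and its sign makes the
absolute value superfluous. -/
lemma setIntegral_triangle {c α β : Plane} (h : 0 < cross α β) (f : Plane → E) :
    ∫ x in triangleMap c α β '' refTriangle, f x
      = cross α β • ∫ z in refTriangle, f (triangleMap c α β z) := by
  have e1 : triangleMap c α β = (fun x => c + frameMap α β x) ∘ planeEquiv := by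
    ext1 z; simp [triangleMap, frameMap_apply, planeEquiv_apply]
  rw [e1, image_comp]
  have hinj : Function.Injective (frameMap α β) := by
    have hker : LinearMap.ker (frameMap α β : Plane →ₗ[ℝ] Plane) = ⊥ := by
      by_contra hne
      have := LinearMap.det_eq_zero_iff_ker_ne_bot.2 hne
      rw [← ContinuousLinearMap.det, det_frameMap] at this
      exact h.ne' this
    exact LinearMap.ker_eq_bot.1 hker
  have hm : MeasurableSet (planeEquiv '' refTriangle) :=
    planeEquiv.measurableSet_image.2 isCompact_refTriangle.measurableSet
  rw [integral_image_eq_integral_abs_det_fderiv_smul volume hm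
    (f' := fun _ => frameMap α β)
    (fun x _ => ((frameMap α β).hasFDerivAt.const_add c).hasFDerivWithinAt)
    (fun x _ y _ hxy => hinj (add_left_cancel hxy)), det_frameMap, abs_of_pos h,
    integral_smul]
  congr 1
  rw [← measurePreserving_planeEquiv.setIntegral_preimage_emb planeEquiv.measurableEmbedding,
    planeEquiv.injective.preimage_image]
  rfl

/-- The mean of `f` along the segment from `p` to `q`. -/
noncomputable def segInt (f : Plane → E) (p q : Plane) : E := ∫ s in (0 : ℝ)..1, f (p + s • (q - p))

/-- The line element rotated by a quarter turn: length times outward normal for a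
counterclockwise edge. -/
def rot (d : Plane) : Plane := !₂[d 1, -d 0]

lemma segInt_swap (f : Plane → E) (p q : Plane) : segInt f q p = segInt f p q := by
  unfold segInt
  have h := intervalIntegral.integral_comp_sub_left (a := 0) (b := 1)
    (fun s : ℝ => f (p + s • (q - p))) 1
  rw [sub_self, sub_zero] at h
  rw [← h]
  congr 1
  ext s
  congr 1
  module

/-- The flux of `f` in the coordinate direction `i` through the edge from `p` to `q`. -/
noncomputable def edgeFlux (i : Fin 2) (f : Plane → E) (p q : Plane) : E :=
  rot (q - p) i • segInt f p q

lemma edgeFlux_swap (i : Fin 2) (f : Plane → E) (p q : Plane) :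
    edgeFlux i f q p = -edgeFlux i f p q := by
  unfold edgeFlux
  rw [segInt_swap, ← neg_smul]
  congr 1
  fin_cases i <;> simp [rot]

variable [CompleteSpace E]

/-- Fubini with the `α` direction innermost: the fundamental theorem of calculus along each line
parallel to `α` leaves the values on the edge opposite to `c` minus those on the edge from `c` to `c
+ β`. -/
lemma integral_fst_deriv_refTriangle {c α β : Plane} {f : Plane → E} (hf : ContDiff ℝ 1 f) :
    ∫ z in refTriangle, fderiv ℝ f (triangleMap c α β z) α
      = segInt f (c + α) (c + β) - segInt f c (c + β) := by
  have hcont : Continuous (fun z => fderiv ℝ f (triangleMap c α β z) α) := by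
    have h1 := hf.continuous_fderiv one_ne_zero
    have h2 : Continuous (triangleMap c α β) := by unfold triangleMap; fun_prop
    exact (h1.comp h2).clm_apply continuous_const
  have hfc := hf.continuous
  rw [integral_refTriangle_swap hcont]
  have h : ∀ r : ℝ, ∫ s in (0 : ℝ)..(1 - r), fderiv ℝ f (triangleMap c α β (s, r)) α
      = f ((c + α) + r • ((c + β) - (c + α))) - f (c + r • ((c + β) - c)) := by
    intro r
    rw [intervalIntegral.integral_eq_sub_of_hasDerivAt
      (f := fun s => f (triangleMap c α β (s, r)))]
    · congr 2 <;> simp only [triangleMap] <;> module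
    · intro s _
      have h1 : HasDerivAt (fun s : ℝ => triangleMap c α β (s, r)) α s := by
        unfold triangleMap
        have := (((hasDerivAt_id s).smul_const α).add_const (r • β)).const_add c
        simpa using this
      exact ((hf.differentiable one_ne_zero _).hasFDerivAt).comp_hasDerivAt s h1
    · exact (hcont.comp (by fun_prop : Continuous fun s : ℝ => (s, r))).intervalIntegrable _ _
  simp_rw [h]
  rw [intervalIntegral.integral_sub]
  · rfl
  · exact Continuous.intervalIntegrable (by fun_prop) _ _
  · exact Continuous.intervalIntegrable (by fun_prop) _ _

lemma integral_snd_deriv_refTriangle {c α β : Plane} {f : Plane → E} (hf : ContDiff ℝ 1 f) :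
    ∫ z in refTriangle, fderiv ℝ f (triangleMap c α β z) β
      = segInt f (c + α) (c + β) - segInt f c (c + α) := by
  rw [segInt_swap f (c + β) (c + α), ← integral_fst_deriv_refTriangle (α := β) (β := α) hf]
  have hcont : Continuous (fun z => fderiv ℝ f (triangleMap c α β z) β) := by
    have h1 := hf.continuous_fderiv one_ne_zero
    have h2 : Continuous (triangleMap c α β) := by unfold triangleMap; fun_prop
    exact (h1.comp h2).clm_apply continuous_const
  have hcont' : Continuous (fun z => fderiv ℝ f (triangleMap c β α z) β) := by
    have h1 := hf.continuous_fderiv one_ne_zero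
    have h2 : Continuous (triangleMap c β α) := by unfold triangleMap; fun_prop
    exact (h1.comp h2).clm_apply continuous_const
  rw [integral_refTriangle hcont, integral_refTriangle_swap hcont']
  simp only [triangleMap, add_comm]

/-- The divergence theorem on a positively oriented triangle. -/
lemma setIntegral_fderiv_triangle {a b c : Plane} (h : 0 < cross (a - c) (b - c)) {f : Plane → E}
    (hf : ContDiff ℝ 1 f) (i : Fin 2) :
    ∫ x in convexHull ℝ {c, a, b}, fderiv ℝ f x (EuclideanSpace.single i 1)
      = edgeFlux i f c a + edgeFlux i f a b + edgeFlux i f b c := by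
  rw [convexHull_eq_image_triangleMap, setIntegral_triangle h, ← integral_smul]
  set α := a - c with hα
  set β := b - c with hβ
  have ha : c + α = a := by simp [hα]
  have hb : c + β = b := by simp [hβ]
  -- Cramer's rule: a coordinate vector in terms of the two edge directions, along which the
  -- derivatives can be integrated.
  have e : cross α β • (EuclideanSpace.single i 1 : Plane) = rot β i • α - rot α i • β := by
    ext j
    fin_cases i <;> fin_cases j <;> simp [cross, rot] <;> ring
  have e2 : ∀ z, cross α β • fderiv ℝ f (triangleMap c α β z) (EuclideanSpace.single i 1)
      = rot β i • fderiv ℝ f (triangleMap c α β z) α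
        - rot α i • fderiv ℝ f (triangleMap c α β z) β := fun z => by
    rw [← map_smul, e, map_sub, map_smul, map_smul]
  have hcont : ∀ γ, IntegrableOn (fun z => fderiv ℝ f (triangleMap c α β z) γ) refTriangle := by
    intro γ
    have h1 := hf.continuous_fderiv one_ne_zero
    have h2 : Continuous (triangleMap c α β) := by unfold triangleMap; fun_prop
    exact ((h1.comp h2).clm_apply continuous_const).continuousOn.integrableOn_compact
      isCompact_refTriangle
  have hsmul : ∀ (m : ℝ) (γ : Plane), Integrable
      (fun z => m • fderiv ℝ f (triangleMap c α β z) γ) (volume.restrict refTriangle) :=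
    fun m γ => (hcont γ).integrable.smul m
  simp_rw [e2]
  rw [integral_sub (hsmul _ _) (hsmul _ _), integral_smul, integral_smul,
    integral_fst_deriv_refTriangle hf, integral_snd_deriv_refTriangle hf, ha, hb]
  unfold edgeFlux
  rw [segInt_swap f c b]
  have e3 : rot (b - a) i = rot β i - rot α i := by
    fin_cases i <;> simp [rot, hα, hβ]
  have e4 : rot (c - b) i = -rot β i := by
    fin_cases i <;> simp [rot, hβ]
  rw [e3, e4]
  module

end triangle

/-! ### Polygonal cells: faces, normals and the divergence theorem. -/

namespace Polygon

variable (P : Polygon)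

lemma cross_pos (k : Fin (P.m + 3)) :
    0 < cross (P.vert k - P.center) (P.vert (k + 1) - P.center) := P.oriented k

lemma isCompact_subTriangle (k : Fin (P.m + 3)) : IsCompact (subTriangle P.vert k) :=
  (Set.toFinite _).isCompact_convexHull ℝ

lemma isCompact_carrier : IsCompact P.carrier := isCompact_iUnion P.isCompact_subTriangle

lemma center_mem : P.center ∈ P.carrier :=
  mem_iUnion.2 ⟨0, subset_convexHull ℝ _ (by simp [center])⟩

lemma face_subset (k : Fin (P.m + 3)) : P.face k ⊆ P.carrier := by
  refine Subset.trans ?_ (subset_iUnion _ k)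
  exact (convex_convexHull ℝ _).segment_subset (subset_convexHull ℝ _ (by simp))
    (subset_convexHull ℝ _ (by simp))

lemma add_smul_sub_mem_face (k : Fin (P.m + 3)) {s : ℝ} (hs : s ∈ Icc (0 : ℝ) 1) :
    P.vert k + s • (P.vert (k + 1) - P.vert k) ∈ P.face k := by
  rw [face, segment_eq_image']
  exact ⟨s, hs, rfl⟩

lemma vert_ne (k : Fin (P.m + 3)) : P.vert (k + 1) ≠ P.vert k := by
  intro h
  have := P.cross_pos k
  rw [h, cross, mul_comm, sub_self] at this
  exact this.false

lemma faceLength_pos (k : Fin (P.m + 3)) : 0 < P.faceLength k :=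
  norm_pos_iff.2 (sub_ne_zero.2 (P.vert_ne k))

lemma perimeter_pos : 0 < P.perimeter :=
  Finset.sum_pos (fun k _ => P.faceLength_pos k) Finset.univ_nonempty

lemma normal_apply (k : Fin (P.m + 3)) (i : Fin 2) :
    P.faceLength k * P.normal k i = rot (P.vert (k + 1) - P.vert k) i := by
  have := (P.faceLength_pos k).ne'
  simp only [normal, PiLp.smul_apply, smul_eq_mul]
  rw [mul_inv_cancel_left₀ this]
  rfl

lemma norm_normal (k : Fin (P.m + 3)) : ‖P.normal k‖ = 1 := by
  have h := (P.faceLength_pos k)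
  rw [normal, norm_smul, norm_inv, Real.norm_eq_abs, abs_of_pos h]
  rw [inv_mul_eq_one₀ h.ne', faceLength, EuclideanSpace.norm_eq, EuclideanSpace.norm_eq]
  congr 1
  simp [Fin.sum_univ_two]
  ring

variable {P} in
lemma integrableOn_of_continuousOn {E : Type*} [NormedAddCommGroup E] {f : Plane → E}
    (hf : ContinuousOn f P.carrier) : IntegrableOn f P.carrier :=
  hf.integrableOn_compact P.isCompact_carrier

section divergence

variable {P} {E : Type*} [NormedAddCommGroup E] [NormedSpace ℝ E]

/-- Triangles with disjoint interiors meet only in their frontiers, and the frontier of a convex set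
is a null set. -/
lemma setIntegral_carrier {f : Plane → E} (hf : ContinuousOn f P.carrier) :
    ∫ x in P.carrier, f x = ∑ k, ∫ x in subTriangle P.vert k, f x := by
  have hd : Pairwise (Function.onFun (AEDisjoint volume) fun k => subTriangle P.vert k) := by
    intro k l hkl
    have hk := (convex_convexHull ℝ _ : Convex ℝ (subTriangle P.vert k)).addHaar_frontier volume
    have hl := (convex_convexHull ℝ _ : Convex ℝ (subTriangle P.vert l)).addHaar_frontier volume
    refine measure_mono_null ?_ (measure_union_null hk hl)
    intro x hx
    have hdis := P.nonoverlapping hkl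
    by_cases h1 : x ∈ interior (subTriangle P.vert k)
    · by_cases h2 : x ∈ interior (subTriangle P.vert l)
      · exact absurd h2 (disjoint_left.1 hdis h1)
      · exact Or.inr ⟨subset_closure hx.2, h2⟩
    · exact Or.inl ⟨subset_closure hx.1, h1⟩
  have h := hasSum_integral_iUnion_ae (f := f)
    (fun k => (P.isCompact_subTriangle k).measurableSet.nullMeasurableSet) hd
    (hf.integrableOn_compact P.isCompact_carrier)
  exact (h.unique (hasSum_fintype _))

/-- The divergence theorem on a polygonal cell, for one partial derivative. -/
theorem setIntegral_fderiv [CompleteSpace E] {f : Plane → E} (hf : ContDiff ℝ 1 f) (i : Fin 2) :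
    ∫ x in P.carrier, fderiv ℝ f x (EuclideanSpace.single i 1)
      = ∑ k, (P.faceLength k * P.normal k i) • segInt f (P.vert k) (P.vert (k + 1)) := by
  have hcont : Continuous fun x => fderiv ℝ f x (EuclideanSpace.single i 1) :=
    (hf.continuous_fderiv one_ne_zero).clm_apply continuous_const
  rw [setIntegral_carrier hcont.continuousOn]
  have h : ∀ k, ∫ x in subTriangle P.vert k, fderiv ℝ f x (EuclideanSpace.single i 1)
      = edgeFlux i f (P.vert k) (P.vert (k + 1))
        + (edgeFlux i f P.center (P.vert k) - edgeFlux i f P.center (P.vert (k + 1))) := by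
    intro k
    rw [subTriangle, ← center, setIntegral_fderiv_triangle (P.cross_pos k) hf i,
      edgeFlux_swap i f P.center (P.vert (k + 1))]
    abel
  simp_rw [h, Finset.sum_add_distrib, Finset.sum_sub_distrib]
  -- Each spoke from the centre belongs to two consecutive triangles, which traverse it in opposite
  -- directions; the cyclic shift of indices cancels these contributions.
  have hshift : ∑ k, edgeFlux i f P.center (P.vert (k + 1)) = ∑ k, edgeFlux i f P.center (P.vert k) :=
    Equiv.sum_comp (Equiv.addRight (1 : Fin (P.m + 3))) fun k => edgeFlux i f P.center (P.vert k)
  rw [hshift, sub_self, add_zero]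
  simp_rw [normal_apply]
  rfl

/-- The outward normals of a polygonal cell, weighted by the lengths of the faces, sum to zero. -/
lemma sum_normal_eq_zero (i : Fin 2) : ∑ k, P.faceLength k * P.normal k i = 0 := by
  have := setIntegral_fderiv (P := P) (f := fun _ => (1 : ℝ)) contDiff_const i
  simpa [segInt] using this.symm

lemma volume_carrier_lt_top : volume P.carrier < ⊤ := P.isCompact_carrier.measure_lt_top

lemma norm_setIntegral_carrier_le {f : Plane → E} {M : ℝ} (h : ∀ x ∈ P.carrier, ‖f x‖ ≤ M) :
    ‖∫ x in P.carrier, f x‖ ≤ P.area * M := by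
  rw [mul_comm]
  exact norm_setIntegral_le_of_norm_le_const volume_carrier_lt_top h

end divergence

lemma faceIntegral_eq {ν : ℕ} (k : Fin (P.m + 3)) (f : Plane → State ν) :
    P.faceIntegral k f = P.faceLength k • segInt f (P.vert k) (P.vert (k + 1)) := rfl

lemma continuousOn_comp_face {ν : ℕ} {k : Fin (P.m + 3)} {f : Plane → State ν}
    (hf : ContinuousOn f (P.face k)) :
    ContinuousOn (fun s : ℝ => f (P.vert k + s • (P.vert (k + 1) - P.vert k))) (Icc 0 1) :=
  hf.comp (by fun_prop) fun _ hs => P.add_smul_sub_mem_face k hs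

lemma faceIntegral_sub {ν : ℕ} {k : Fin (P.m + 3)} {f g : Plane → State ν}
    (hf : ContinuousOn f (P.face k)) (hg : ContinuousOn g (P.face k)) :
    P.faceIntegral k (fun x => f x - g x) = P.faceIntegral k f - P.faceIntegral k g := by
  unfold faceIntegral
  rw [intervalIntegral.integral_sub, smul_sub]
  · exact ContinuousOn.intervalIntegrable (by
      rw [uIcc_of_le zero_le_one]; exact P.continuousOn_comp_face hf)
  · exact ContinuousOn.intervalIntegrable (by
      rw [uIcc_of_le zero_le_one]; exact P.continuousOn_comp_face hg)

lemma faceIntegral_clm {ν : ℕ} {k : Fin (P.m + 3)} {f : Plane → State ν}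
    (A : State ν →L[ℝ] State ν) (hf : ContinuousOn f (P.face k)) :
    P.faceIntegral k (fun x => A (f x)) = A (P.faceIntegral k f) := by
  unfold faceIntegral
  rw [map_smul, A.intervalIntegral_comp_comm]
  exact ContinuousOn.intervalIntegrable (by
      rw [uIcc_of_le zero_le_one]; exact P.continuousOn_comp_face hf)

lemma norm_faceIntegral_le {ν : ℕ} {k : Fin (P.m + 3)} {f : Plane → State ν} {M : ℝ}
    (h : ∀ x ∈ P.face k, ‖f x‖ ≤ M) : ‖P.faceIntegral k f‖ ≤ P.faceLength k * M := by
  unfold faceIntegral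
  have hl := P.faceLength_pos k
  rw [norm_smul, Real.norm_eq_abs, abs_of_pos hl]
  gcongr
  refine (intervalIntegral.norm_integral_le_of_norm_le_const fun s hs => ?_).trans
    (by simp : M * |1 - 0| ≤ M)
  rw [uIoc_of_le zero_le_one] at hs
  exact h _ (P.add_smul_sub_mem_face k ⟨hs.1.le, hs.2⟩)

/-! ### Size of a cell -/

/-- Triangle inequality along the boundary from vertex `0` to vertex `k`; the sum over the faces
walked so far is kept in the induction. -/
lemma norm_vert_sub_le (k : Fin (P.m + 3)) : ‖P.vert k - P.vert 0‖ ≤ P.perimeter := by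
  have h : ∀ n (hn : n < P.m + 3), ‖P.vert ⟨n, hn⟩ - P.vert 0‖
      ≤ ∑ j ∈ Finset.univ.filter (fun j : Fin (P.m + 3) => j.1 < n), P.faceLength j := by
    intro n
    induction n with
    | zero => intro hn; simp
    | succ n ih =>
      intro hn
      have hn' : n < P.m + 3 := by omega
      have e : (⟨n + 1, hn⟩ : Fin (P.m + 3)) = ⟨n, hn'⟩ + 1 := by
        ext
        rw [Fin.val_add_one_of_lt' (by simpa using hn)]
      have e2 : Finset.univ.filter (fun j : Fin (P.m + 3) => j.1 < n + 1)
          = insert ⟨n, hn'⟩ (Finset.univ.filter (fun j : Fin (P.m + 3) => j.1 < n)) := by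
        ext j
        simp [Fin.ext_iff]
        omega
      rw [e2, Finset.sum_insert (by simp), e]
      calc _ ≤ ‖P.vert (⟨n, hn'⟩ + 1) - P.vert ⟨n, hn'⟩‖ + ‖P.vert ⟨n, hn'⟩ - P.vert 0‖ :=
            norm_sub_le_norm_sub_add_norm_sub _ _ _
        _ ≤ _ := add_le_add le_rfl (ih hn')
  refine (h k.1 k.2).trans ?_
  exact Finset.sum_le_sum_of_subset_of_nonneg (Finset.filter_subset _ _)
    fun j _ _ => (P.faceLength_pos j).le

lemma carrier_subset_closedBall_vert : P.carrier ⊆ Metric.closedBall (P.vert 0) P.perimeter := by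
  have hv : ∀ k, P.vert k ∈ Metric.closedBall (P.vert 0) P.perimeter := fun k => by
    rw [mem_closedBall_iff_norm]; exact P.norm_vert_sub_le k
  have hc : vertexMean P.vert ∈ Metric.closedBall (P.vert 0) P.perimeter := by
    have := (convex_closedBall (P.vert 0) P.perimeter).sum_mem (t := Finset.univ)
      (w := fun _ : Fin (P.m + 3) => ((P.m + 3 : ℕ) : ℝ)⁻¹) (z := P.vert)
      (fun _ _ => by positivity) (by simp; field_simp) (fun k _ => hv k)
    rwa [← Finset.smul_sum] at this
  refine iUnion_subset fun k => convexHull_min ?_ (convex_closedBall _ _)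
  rintro x (rfl | rfl | rfl)
  · exact hc
  · exact hv k
  · exact hv _

lemma carrier_subset_closedBall {c : Plane} (hc : c ∈ P.carrier) :
    P.carrier ⊆ Metric.closedBall c (2 * P.perimeter) := by
  intro x hx
  have h1 := P.carrier_subset_closedBall_vert hx
  have h2 := P.carrier_subset_closedBall_vert hc
  rw [Metric.mem_closedBall] at h1 h2 ⊢
  linarith [dist_triangle_right x c (P.vert 0)]

lemma volume_ball_real (c : Plane) {r : ℝ} (hr : 0 ≤ r) :
    volume.real (Metric.ball c r) = r ^ 2 * Real.pi := by
  rw [measureReal_def, EuclideanSpace.volume_ball_fin_two, ENNReal.toReal_mul, ENNReal.toReal_pow,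
    ENNReal.toReal_ofReal hr, ENNReal.toReal_ofReal Real.pi_pos.le]

section shapeRegular

variable {P} {σ : ℝ}

/-- The perimeter bound forces this: the perimeter of a cell is positive. -/
lemma ShapeRegular.size_pos (h : P.ShapeRegular σ) (hσ : 0 < σ) : 0 < P.size := by
  have := P.perimeter_pos.trans_le h.2
  exact (div_pos_iff_of_pos_right hσ).1 this

lemma ShapeRegular.le_area (h : P.ShapeRegular σ) (hσ : 0 < σ) :
    (σ * P.size) ^ 2 ≤ P.area := by
  obtain ⟨c, hc⟩ := h.1
  have hs := h.size_pos hσ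
  have h1 : volume.real (Metric.ball c (σ * P.size)) ≤ P.area :=
    measureReal_mono hc volume_carrier_lt_top.ne
  rw [volume_ball_real c (by positivity)] at h1
  have := Real.pi_gt_three
  nlinarith [sq_nonneg (σ * P.size)]

lemma ShapeRegular.area_pos (h : P.ShapeRegular σ) (hσ : 0 < σ) : 0 < P.area := by
  have := h.size_pos hσ
  exact lt_of_lt_of_le (by positivity) (h.le_area hσ)

/-- The cell lies within twice its perimeter of its centre, hence in an open disc of radius `3 h /
σ`; with `π ≤ 4` this gives `9 * 4 = 36`. -/
lemma ShapeRegular.area_le (h : P.ShapeRegular σ) (hσ : 0 < σ) :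
    P.area ≤ 36 / σ ^ 2 * P.size ^ 2 := by
  have hs := h.size_pos hσ
  have h1 : P.carrier ⊆ Metric.ball P.center (3 * (P.size / σ)) :=
    (P.carrier_subset_closedBall P.center_mem).trans
      (Metric.closedBall_subset_ball (by have := h.2; have := P.perimeter_pos; linarith))
  have h2 : P.area ≤ volume.real (Metric.ball P.center (3 * (P.size / σ))) :=
    measureReal_mono h1 (Metric.isBounded_ball.measure_lt_top).ne
  rw [volume_ball_real _ (by positivity)] at h2
  have := Real.pi_le_four
  calc _ ≤ _ := h2
    _ ≤ (3 * (P.size / σ)) ^ 2 * 4 := by gcongr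
    _ = _ := by field_simp; ring

end shapeRegular

end Polygon
/-! ## Polynomials in space and time -/

section poly

variable {N : ℕ}

lemma contDiff_mvPolynomial_eval {E : Type*} [NormedAddCommGroup E] [NormedSpace ℝ E] {m : ℕ}
    {n : WithTop ℕ∞} (p : MvPolynomial (Fin m) ℝ) {g : E → Fin m → ℝ}
    (hg : ∀ i, ContDiff ℝ n fun z => g z i) : ContDiff ℝ n fun z => MvPolynomial.eval (g z) p := by
  simp only [MvPolynomial.eval_eq']
  exact ContDiff.sum fun d _ => contDiff_const.mul (contDiff_prod fun i _ => (hg i).pow _)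

lemma contDiff_plane_apply {n : WithTop ℕ∞} (i : Fin 2) : ContDiff ℝ n fun x : Plane => x i :=
  (EuclideanSpace.proj i : Plane →L[ℝ] ℝ).contDiff

lemma IsPoly.contDiff {f : Plane → ℝ} (hf : IsPoly N f) {n : WithTop ℕ∞} : ContDiff ℝ n f := by
  obtain ⟨p, -, hp⟩ := hf
  rw [show f = fun x : Plane => MvPolynomial.eval ![x 0, x 1] p from funext hp]
  refine contDiff_mvPolynomial_eval p fun i => ?_
  fin_cases i
  · exact contDiff_plane_apply 0
  · exact contDiff_plane_apply 1

lemma IsPolyST.contDiff {f : Plane → ℝ → ℝ} (hf : IsPolyST N f) {n : WithTop ℕ∞} :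
    ContDiff ℝ n fun z : Plane × ℝ => f z.1 z.2 := by
  obtain ⟨p, -, hp⟩ := hf
  rw [show (fun z : Plane × ℝ => f z.1 z.2)
    = fun z => MvPolynomial.eval ![z.1 0, z.1 1, z.2] p from funext fun z => hp _ _]
  refine contDiff_mvPolynomial_eval p fun i => ?_
  fin_cases i
  · exact (contDiff_plane_apply 0).comp contDiff_fst
  · exact (contDiff_plane_apply 1).comp contDiff_fst
  · exact contDiff_snd

lemma IsPoly.sub {f g : Plane → ℝ} (hf : IsPoly N f) (hg : IsPoly N g) :
    IsPoly N fun x => f x - g x := by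
  obtain ⟨p, hp, hp'⟩ := hf
  obtain ⟨q, hq, hq'⟩ := hg
  exact ⟨p - q, (MvPolynomial.totalDegree_sub p q).trans (max_le hp hq),
    fun x => by simp [hp', hq']⟩

lemma isPoly_one : IsPoly N fun _ => 1 := ⟨1, by simp, by simp⟩

/-- Substituting polynomials of degree at most one does not raise the total degree. This allows
every cell to be rescaled to unit size. -/
lemma IsPoly.comp_affine {f : Plane → ℝ} (hf : IsPoly N f) (c : Plane) (h : ℝ) :
    IsPoly N fun y => f (c + h • y) := by
  obtain ⟨p, hp, hp'⟩ := hf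
  let l : Fin 2 → MvPolynomial (Fin 2) ℝ := fun i => MvPolynomial.C (c i) + MvPolynomial.C h * .X i
  have hl : ∀ i, (l i).totalDegree ≤ 1 := fun i => by
    refine (MvPolynomial.totalDegree_add _ _).trans (max_le (by simp) ?_)
    refine (MvPolynomial.totalDegree_mul _ _).trans ?_
    simp
  refine ⟨MvPolynomial.aeval l p, ?_, fun x => ?_⟩
  · rw [MvPolynomial.aeval_def, MvPolynomial.eval₂_eq']
    refine MvPolynomial.totalDegree_finsetSum_le fun d hd => ?_
    refine (MvPolynomial.totalDegree_mul _ _).trans ?_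
    have h1 : (∏ i, l i ^ d i).totalDegree ≤ ∑ i, d i := by
      refine (MvPolynomial.totalDegree_finsetProd _ _).trans (Finset.sum_le_sum fun i _ => ?_)
      refine (MvPolynomial.totalDegree_pow _ _).trans ?_
      exact (Nat.mul_le_mul_left _ (hl i)).trans (mul_one _).le
    have h2 : ∑ i, d i ≤ p.totalDegree := by
      have := MvPolynomial.le_totalDegree hd
      rwa [Finsupp.sum_fintype _ _ (by simp)] at this
    simpa using h1.trans (h2.trans hp)
  · simp only [hp']
    rw [← MvPolynomial.coe_aeval_eq_eval, ← MvPolynomial.coe_aeval_eq_eval]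
    simp only [RingHom.coe_coe]
    rw [MvPolynomial.comp_aeval_apply]
    congr 2
    ext i
    fin_cases i <;> simp [l]

/-! ### The inverse inequality. -/

/-- On the polynomials of bounded degree, the supremum on one disc is controlled by the `L²` norm on
another disc. -/
lemma exists_sq_le_mul_setIntegral (N : ℕ) {ρ : ℝ} (hρ : 0 < ρ) (R : ℝ) :
    ∃ C, 0 < C ∧ ∀ f, IsPoly N f → ∀ x ∈ Metric.closedBall (0 : Plane) R,
      f x ^ 2 ≤ C * ∫ y in Metric.closedBall (0 : Plane) ρ, f y ^ 2 := by
  let W := MvPolynomial.restrictTotalDegree (Fin 2) ℝ N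
  let b := Module.finBasis ℝ W
  let ev : MvPolynomial (Fin 2) ℝ → Plane → ℝ := fun p x => MvPolynomial.eval ![x 0, x 1] p
  have hev : ∀ p, p ∈ W → IsPoly N (ev p) := fun p hp =>
    ⟨p, (MvPolynomial.mem_restrictTotalDegree _ _ _).1 hp, fun x => rfl⟩
  let φ : (Fin (Module.finrank ℝ W) → ℝ) → Plane → ℝ := fun c x => ∑ i, c i * ev (b i) x
  have hb : ∀ i, Continuous (ev (b i)) := fun i => ((hev _ (b i).2).contDiff (n := 0)).continuous
  have hφ : Continuous (fun z : (Fin (Module.finrank ℝ W) → ℝ) × Plane => φ z.1 z.2) := by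
    refine continuous_finsetSum _ fun i _ => ?_
    have := hb i
    fun_prop
  have hφe : ∀ c, φ c = ev ((∑ i, c i • b i : W) : MvPolynomial (Fin 2) ℝ) := fun c => by
    ext x
    simp [φ, ev, MvPolynomial.smul_eval]
  let I : (Fin (Module.finrank ℝ W) → ℝ) → ℝ := fun c =>
    ∫ y in Metric.closedBall (0 : Plane) ρ, φ c y ^ 2
  have hI : Continuous I :=
    continuous_parametric_integral_of_continuous (f := fun c y => φ c y ^ 2)
      (hφ.fun_pow 2) (isCompact_closedBall _ _)
  -- Equivalence of norms in finite dimension: a polynomial whose square has zero integral over the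
  -- disc vanishes on the open disc, hence identically. Compactness of the unit sphere of
  -- coefficients makes the lower bound uniform, and homogeneity extends it to all coefficients.
  have hpos : ∀ c ∈ Metric.sphere (0 : Fin (Module.finrank ℝ W) → ℝ) 1, 0 < I c := by
    intro c hc
    have hc0 : c ≠ 0 := by rintro rfl; simp at hc
    have hcont : Continuous (fun y => φ c y ^ 2) := (by fun_prop : Continuous (φ c)).pow 2
    refine lt_of_le_of_ne (integral_nonneg fun y => sq_nonneg _) fun h0 => hc0 ?_
    have hae : (fun y => φ c y ^ 2) =ᵐ[volume.restrict (Metric.ball (0 : Plane) ρ)] 0 := by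
      have := (setIntegral_eq_zero_iff_of_nonneg_ae (Eventually.of_forall fun y => sq_nonneg (φ c y))
        (hcont.continuousOn.integrableOn_compact (isCompact_closedBall _ _))).1 h0.symm
      exact ae_restrict_of_ae_restrict_of_subset Metric.ball_subset_closedBall this
    have hzero : EqOn (fun y => φ c y ^ 2) 0 (Metric.ball (0 : Plane) ρ) :=
      Measure.eqOn_open_of_ae_eq hae Metric.isOpen_ball hcont.continuousOn continuousOn_const
    have hp : ((∑ i, c i • b i : W) : MvPolynomial (Fin 2) ℝ) = 0 := by
      -- A product of infinite sets determines a polynomial; the square of side `ρ / 2` at the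
      -- origin fits into the disc of radius `ρ`.
      refine MvPolynomial.funext_set (fun _ => Ioo (0 : ℝ) (ρ / 2))
        (fun _ => Ioo_infinite (by positivity)) fun x hx => ?_
      have hx0 := hx 0 (mem_univ _)
      have hx1 := hx 1 (mem_univ _)
      have hmem : (!₂[x 0, x 1] : Plane) ∈ Metric.ball (0 : Plane) ρ := by
        rw [mem_ball_zero_iff, EuclideanSpace.norm_eq, Real.sqrt_lt' hρ]
        simp only [Fin.sum_univ_two, Real.norm_eq_abs, sq_abs]
        simp
        nlinarith [hx0.1, hx0.2, hx1.1, hx1.2]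
      have := hzero hmem
      simp only [Pi.zero_apply, sq_eq_zero_iff, hφe, ev] at this
      rw [map_zero, show x = ![x 0, x 1] by ext i; fin_cases i <;> rfl]
      exact this
    have hs : ∑ i, c i • b i = 0 := Subtype.ext hp
    ext i
    exact Fintype.linearIndependent_iff.1 b.linearIndependent c hs i
  obtain ⟨δ, hδ, hδI⟩ := (isCompact_sphere _ _).exists_forall_le' hI.continuousOn hpos
  have hIc : ∀ c, δ * ‖c‖ ^ 2 ≤ I c := by
    intro c
    by_cases hc : c = 0
    · subst hc; simp [I, φ]
    have hn : 0 < ‖c‖ := norm_pos_iff.2 hc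
    have h1 := hδI (‖c‖⁻¹ • c) (by simp [norm_smul, hn.ne'])
    have h2 : I (‖c‖⁻¹ • c) = (‖c‖⁻¹) ^ 2 * I c := by
      simp only [I]
      rw [← integral_const_mul]
      congr 1
      ext y
      simp only [φ, Pi.smul_apply, smul_eq_mul, mul_assoc, ← Finset.mul_sum]
      ring
    rw [h2, inv_pow, inv_mul_eq_div, le_div_iff₀ (by positivity)] at h1
    exact h1
  choose M hM using fun i => (isCompact_closedBall (0 : Plane) R).exists_bound_of_continuousOn
    (hb i).continuousOn
  set T := 1 + ∑ i, |M i| with hT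
  have hTpos : 0 < T := by positivity
  refine ⟨T ^ 2 / δ, by positivity, fun f hf x hx => ?_⟩
  obtain ⟨p, hp, hpf⟩ := hf
  have hpW : p ∈ W := (MvPolynomial.mem_restrictTotalDegree _ _ _).2 hp
  let c : Fin (Module.finrank ℝ W) → ℝ := fun i => b.repr ⟨p, hpW⟩ i
  have hfc : f = φ c := by
    rw [hφe, b.sum_repr]
    exact funext hpf
  have hle : |φ c x| ≤ ‖c‖ * T := by
    refine (Finset.abs_sum_le_sum_abs _ _).trans ?_
    have : ∀ i ∈ Finset.univ, |c i * ev (b i) x| ≤ ‖c‖ * |M i| := fun i _ => by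
      rw [abs_mul]
      exact mul_le_mul (norm_le_pi_norm c i) ((hM i x hx).trans (le_abs_self _)) (abs_nonneg _)
        (norm_nonneg _)
    refine (Finset.sum_le_sum this).trans ?_
    rw [← Finset.mul_sum]
    gcongr
    linarith
  rw [hfc]
  calc φ c x ^ 2 = |φ c x| ^ 2 := (sq_abs _).symm
    _ ≤ (‖c‖ * T) ^ 2 := by gcongr
    _ = T ^ 2 / δ * (δ * ‖c‖ ^ 2) := by field_simp
    _ ≤ T ^ 2 / δ * I c := by gcongr; exact hIc c

/-- Inverse inequality on shape regular cells. -/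
theorem exists_inverse_inequality (N : ℕ) {σ : ℝ} (hσ : 0 < σ) :
    ∃ C, 0 < C ∧ ∀ P : Polygon, P.ShapeRegular σ → ∀ f, IsPoly N f → ∀ x ∈ P.carrier,
      P.size ^ 2 * f x ^ 2 ≤ C * ∫ y in P.carrier, f y ^ 2 := by
  obtain ⟨C, hC, h⟩ := exists_sq_le_mul_setIntegral N (half_pos hσ) (2 / σ)
  refine ⟨C, hC, fun P hP f hf x hx => ?_⟩
  obtain ⟨c, hc⟩ := hP.1
  have hs := hP.size_pos hσ
  have hcc : c ∈ P.carrier := hc (Metric.mem_ball_self (by positivity))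
  -- Rescaling about the centre of the inscribed disc: the disc of radius `σ / 2` is mapped into the
  -- cell, and the cell is contained in the image of the disc of radius `2 / σ`. The reference
  -- discs, and so the constant, do not depend on the cell.
  set g : Plane → Plane := fun y => c + P.size • y with hg
  have hxb := P.carrier_subset_closedBall hcc hx
  rw [mem_closedBall_iff_norm] at hxb
  have hy : P.size⁻¹ • (x - c) ∈ Metric.closedBall (0 : Plane) (2 / σ) := by
    rw [mem_closedBall_zero_iff, norm_smul, norm_inv, Real.norm_eq_abs, abs_of_pos hs,
      inv_mul_le_iff₀ hs]
    calc _ ≤ _ := hxb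
      _ ≤ 2 * (P.size / σ) := by gcongr; exact hP.2
      _ = _ := by ring
  have hgx : g (P.size⁻¹ • (x - c)) = x := by simp [hg, smul_smul, hs.ne']
  have hdet : (P.size • ContinuousLinearMap.id ℝ Plane).det = P.size ^ 2 := by
    rw [ContinuousLinearMap.det]
    simp [LinearMap.det_smul]
  have key := h (fun y => f (g y)) (hf.comp_affine c P.size) _ hy
  rw [hgx] at key
  have himg : ∫ y in g '' Metric.closedBall 0 (σ / 2), f y ^ 2
      = P.size ^ 2 * ∫ y in Metric.closedBall (0 : Plane) (σ / 2), f (g y) ^ 2 := by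
    rw [integral_image_eq_integral_abs_det_fderiv_smul volume measurableSet_closedBall (f := g)
      (f' := fun _ => P.size • ContinuousLinearMap.id ℝ Plane)
      (fun y _ => (((hasFDerivAt_id y).const_smul P.size).const_add c).hasFDerivWithinAt)
      (fun y _ z _ hyz => by simpa [hg, hs.ne'] using hyz), hdet, abs_of_pos (by positivity)]
    simp only [smul_eq_mul]
    rw [integral_const_mul]
  have hsub : g '' Metric.closedBall 0 (σ / 2) ⊆ P.carrier := by
    rintro _ ⟨y, hy, rfl⟩
    refine hc ?_
    rw [mem_closedBall_zero_iff] at hy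
    rw [mem_ball_iff_norm]
    simp only [hg, add_sub_cancel_left, norm_smul, Real.norm_eq_abs, abs_of_pos hs]
    nlinarith
  have hmono : ∫ y in g '' Metric.closedBall 0 (σ / 2), f y ^ 2 ≤ ∫ y in P.carrier, f y ^ 2 := by
    refine setIntegral_mono_set (Polygon.integrableOn_of_continuousOn ?_)
      (Eventually.of_forall fun y => sq_nonneg _) hsub.eventuallyLE
    exact (((hf.contDiff (n := 0)).continuous).pow 2).continuousOn
  calc P.size ^ 2 * f x ^ 2
      ≤ P.size ^ 2 * (C * ∫ y in Metric.closedBall (0 : Plane) (σ / 2), f (g y) ^ 2) := by gcongr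
    _ = C * ∫ y in g '' Metric.closedBall 0 (σ / 2), f y ^ 2 := by rw [himg]; ring
    _ ≤ _ := by gcongr

/-! ### Polynomials in time and the weak evolution equation. -/

/-- The integral over a cell of a space-time polynomial is a polynomial in time. -/
lemma IsPolyST.exists_polynomial_integral {f : Plane → ℝ → ℝ} (hf : IsPolyST N f) (P : Polygon) :
    ∃ p : Polynomial ℝ, p.natDegree ≤ N ∧ ∀ t, ∫ x in P.carrier, f x t = p.eval t := by
  obtain ⟨q, hq, hqf⟩ := hf
  refine ⟨∑ d ∈ q.support, Polynomial.monomial (d 2)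
    (q.coeff d * ∫ x in P.carrier, (x 0) ^ d 0 * (x 1) ^ d 1), ?_, fun t => ?_⟩
  · refine Polynomial.natDegree_sum_le_of_forall_le _ _ fun d hd => ?_
    refine (Polynomial.natDegree_monomial_le _).trans (le_trans ?_ hq)
    have := MvPolynomial.le_totalDegree hd
    rw [Finsupp.sum_fintype _ _ (by simp), Fin.sum_univ_three] at this
    omega
  · simp only [hqf, MvPolynomial.eval_eq', Fin.prod_univ_three]
    rw [integral_finsetSum, Polynomial.eval_finsetSum]
    · refine Finset.sum_congr rfl fun d _ => ?_
      rw [Polynomial.eval_monomial, ← integral_const_mul, ← integral_mul_const]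
      congr 1
      ext x
      simp
      ring
    · intro d _
      refine Polygon.integrableOn_of_continuousOn (Continuous.continuousOn ?_)
      simp
      fun_prop

lemma isPolyST_time {p : Polynomial ℝ} (hp : p.natDegree ≤ N) :
    IsPolyST N fun _ t => p.eval t := by
  refine ⟨Polynomial.aeval (MvPolynomial.X 2) p, ?_, fun x t => ?_⟩
  · rw [Polynomial.aeval_eq_sum_range]
    refine MvPolynomial.totalDegree_finsetSum_le fun i hi => ?_
    refine (MvPolynomial.totalDegree_smul_le _ _).trans ?_
    rw [MvPolynomial.totalDegree_X_pow]
    have := Finset.mem_range.1 hi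
    omega
  · rw [← MvPolynomial.coe_aeval_eq_eval]
    simp only [RingHom.coe_coe]
    rw [← Polynomial.aeval_algHom_apply]
    simp

/-- Makes `(t - a) p'` an admissible test function: differentiation loses the degree that the linear
factor restores. -/
lemma natDegree_sub_C_mul_derivative_le {p : Polynomial ℝ} (hp : p.natDegree ≤ N) (a : ℝ) :
    ((Polynomial.X - Polynomial.C a) * p.derivative).natDegree ≤ N := by
  by_cases h : p.natDegree = 0
  · rw [Polynomial.derivative_of_natDegree_zero h]; simp
  · have h1 := Polynomial.natDegree_derivative_lt h
    refine Polynomial.natDegree_mul_le.trans ?_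
    rw [Polynomial.natDegree_X_sub_C]
    omega

/-- A polynomial that satisfies the weak evolution equation with right-hand side `g`, tested with
`(t - t₀) p'`, is close to its final value in the mean. -/
lemma integral_abs_sub_le {p : Polynomial ℝ} {a b M : ℝ} (hab : a < b) (hM : 0 < M) {g : ℝ → ℝ}
    (hg : IntervalIntegrable g volume a b) (hgM : ∀ τ ∈ Icc a b, |g τ| ≤ M)
    (h : ∫ τ in a..b, (τ - a) * p.derivative.eval τ * p.derivative.eval τ
      = -∫ τ in a..b, (τ - a) * p.derivative.eval τ * g τ) :
    ∫ τ in a..b, |p.eval τ - p.eval b| ≤ 2 * M * (b - a) ^ 2 := by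
  have hd : 0 < b - a := sub_pos.2 hab
  have hcp : Continuous fun τ => p.eval τ := p.continuous
  have hcp' : Continuous fun τ => p.derivative.eval τ := p.derivative.continuous
  have hint : ∫ τ in a..b, (τ - a) = (b - a) ^ 2 / 2 := by
    rw [intervalIntegral.integral_sub (by simp) (by simp)]
    simp; ring
  set I := ∫ τ in a..b, (τ - a) * p.derivative.eval τ * p.derivative.eval τ with hI
  have hi1 : IntervalIntegrable (fun τ => (τ - a) * p.derivative.eval τ * p.derivative.eval τ)
      volume a b := Continuous.intervalIntegrable (by fun_prop) _ _
  have hi2 : IntervalIntegrable (fun τ => (τ - a) * p.derivative.eval τ * g τ) volume a b :=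
    hg.continuousOn_mul (Continuous.continuousOn (by fun_prop))
  have hi3 : IntervalIntegrable (fun τ : ℝ => τ - a) volume a b :=
    Continuous.intervalIntegrable (by fun_prop) _ _
  -- Young's inequality with weight `τ - a`; half of `I` is absorbed on the left.
  have hI1 : I ≤ M ^ 2 * (b - a) ^ 2 / 2 := by
    have : -∫ τ in a..b, (τ - a) * p.derivative.eval τ * g τ ≤ I / 2 + M ^ 2 / 2 * ((b - a) ^ 2 / 2) := by
      rw [hI, ← hint, ← intervalIntegral.integral_neg, ← intervalIntegral.integral_div,
        ← intervalIntegral.integral_const_mul, ← intervalIntegral.integral_add (hi1.div_const _)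
        (hi3.const_mul _)]
      refine intervalIntegral.integral_mono_on hab.le hi2.neg
        ((hi1.div_const _).add (hi3.const_mul _)) fun τ hτ => ?_
      have h1 : 0 ≤ τ - a := sub_nonneg.2 hτ.1
      have h2 := hgM τ hτ
      have h3 : g τ ^ 2 ≤ M ^ 2 := sq_le_sq' (abs_le.1 h2).1 (abs_le.1 h2).2
      nlinarith [mul_nonneg h1 (sq_nonneg (p.derivative.eval τ + g τ)), mul_nonneg h1 (sub_nonneg.2 h3)]
    rw [← h] at this
    linarith
  set E := ∫ τ in a..b, (p.eval τ - p.eval b) ^ 2 with hE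
  have hj1 : IntervalIntegrable (fun τ => (p.eval τ - p.eval b) ^ 2) volume a b :=
    Continuous.intervalIntegrable (by fun_prop) _ _
  -- A Hardy type argument: `(τ - a) (p - p(b))²` vanishes at both ends, so `E` equals minus the
  -- mixed term. Young's inequality and `(τ - a)² ≤ (b - a) (τ - a)` then give `E ≤ 4 (b - a) I`,
  -- without any inverse inequality in time.
  have hftc : ∫ τ in a..b, ((p.eval τ - p.eval b) ^ 2
      + (τ - a) * (2 * (p.eval τ - p.eval b) * p.derivative.eval τ)) = 0 := by
    rw [intervalIntegral.integral_eq_sub_of_hasDerivAt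
      (f := fun τ => (τ - a) * (p.eval τ - p.eval b) ^ 2)]
    · simp
    · intro τ _
      have h1 := ((p.hasDerivAt τ).sub_const (p.eval b)).pow 2
      convert! ((hasDerivAt_id τ).sub_const a).mul h1 using 1
      simp
    · exact Continuous.intervalIntegrable (by fun_prop) _ _
  have hE1 : E ≤ E / 2 + 2 * (b - a) * I := by
    have hk : IntervalIntegrable (fun τ => (τ - a) * (2 * (p.eval τ - p.eval b)
        * p.derivative.eval τ)) volume a b := Continuous.intervalIntegrable (by fun_prop) _ _
    rw [intervalIntegral.integral_add hj1 hk] at hftc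
    have e1 : E = ∫ τ in a..b, -((τ - a) * (2 * (p.eval τ - p.eval b) * p.derivative.eval τ)) := by
      rw [intervalIntegral.integral_neg]; linarith
    have e2 : E / 2 + 2 * (b - a) * I = ∫ τ in a..b, ((p.eval τ - p.eval b) ^ 2 / 2
        + 2 * (b - a) * ((τ - a) * p.derivative.eval τ * p.derivative.eval τ)) := by
      rw [hE, hI, ← intervalIntegral.integral_div, ← intervalIntegral.integral_const_mul,
        ← intervalIntegral.integral_add (hj1.div_const _) (hi1.const_mul _)]
    rw [e2]
    refine e1.le.trans ?_
    refine intervalIntegral.integral_mono_on hab.le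
      (Continuous.intervalIntegrable (by fun_prop) _ _)
      ((hj1.div_const _).add (hi1.const_mul _)) fun τ hτ => ?_
    have h1 : 0 ≤ τ - a := sub_nonneg.2 hτ.1
    have h2 : 0 ≤ (b - a) - (τ - a) := by linarith [hτ.2]
    nlinarith [sq_nonneg ((p.eval τ - p.eval b) + 2 * ((τ - a) * p.derivative.eval τ)),
      mul_nonneg (mul_nonneg h1 h2) (sq_nonneg (p.derivative.eval τ))]
  have hE2 : E ≤ 2 * M ^ 2 * (b - a) ^ 3 := by
    have := mul_le_mul_of_nonneg_left hI1 hd.le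
    nlinarith
  -- From the square integral to the absolute value: with `c = M (b - a)`, the expected size of the
  -- deviation, `y ≤ y² / (2 c) + c / 2`.
  have hfin : ∫ τ in a..b, |p.eval τ - p.eval b|
      ≤ (2 * M * (b - a))⁻¹ * E + (b - a) * (M * (b - a) / 2) := by
    have e : (b - a) * (M * (b - a) / 2) = ∫ τ in a..b, M * (b - a) / 2 := by
      rw [intervalIntegral.integral_const, smul_eq_mul]
    rw [e, hE, ← intervalIntegral.integral_const_mul,
      ← intervalIntegral.integral_add (hj1.const_mul _) (by simp)]
    refine intervalIntegral.integral_mono_on hab.le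
      (Continuous.intervalIntegrable (by fun_prop) _ _)
      ((hj1.const_mul _).add (by simp)) fun τ hτ => ?_
    rw [← sq_abs]
    set y := |p.eval τ - p.eval b|
    have hMd : 0 < M * (b - a) := by positivity
    rw [show (2 * M * (b - a))⁻¹ * y ^ 2 + M * (b - a) / 2
      = (y ^ 2 + (M * (b - a)) ^ 2) / (2 * (M * (b - a))) by field_simp,
      le_div_iff₀ (by positivity)]
    nlinarith [sq_nonneg (y - M * (b - a))]
  refine hfin.trans ?_
  have : (2 * M * (b - a))⁻¹ * E ≤ (2 * M * (b - a))⁻¹ * (2 * M ^ 2 * (b - a) ^ 3) := by gcongr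
  have e : (2 * M * (b - a))⁻¹ * (2 * M ^ 2 * (b - a) ^ 3) = M * (b - a) ^ 2 := by field_simp
  rw [e] at this
  nlinarith [mul_pos hM (pow_pos hd 2)]

end poly
/-! ## The flux balance of a cell at a fixed time -/

namespace Polygon

lemma faceIntegral_const {ν : ℕ} (P : Polygon) (k : Fin (P.m + 3)) (c : State ν) :
    P.faceIntegral k (fun _ => c) = P.faceLength k • c := by
  simp [faceIntegral]

end Polygon

lemma continuousOn_of_lip_pair {ν : ℕ} {K : Set (State ν)}
    {F : State ν → State ν → State ν} {M : ℝ}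
    (h : ∀ a ∈ K, ∀ b ∈ K, ∀ a' ∈ K, ∀ b' ∈ K, ‖F a b - F a' b'‖ ≤ M * (‖a - a'‖ + ‖b - b'‖))
    {X : Type*} [TopologicalSpace X] {s : Set X} {a b : X → State ν}
    (ha : ContinuousOn a s) (hb : ContinuousOn b s) (haK : MapsTo a s K) (hbK : MapsTo b s K) :
    ContinuousOn (fun x => F (a x) (b x)) s := by
  have : LipschitzOnWith (Real.toNNReal (M * 2)) (fun z : State ν × State ν => F z.1 z.2)
      (K ×ˢ K) := LipschitzOnWith.of_dist_le_mul fun x hx y hy => by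
    rw [dist_eq_norm, dist_eq_norm]
    refine (h _ hx.1 _ hx.2 _ hy.1 _ hy.2).trans ?_
    have h1 : ‖x.1 - y.1‖ ≤ ‖x - y‖ := norm_fst_le (x - y)
    have h2 : ‖x.2 - y.2‖ ≤ ‖x - y‖ := norm_snd_le (x - y)
    by_cases hM : 0 ≤ M
    · rw [Real.coe_toNNReal _ (by positivity)]
      nlinarith
    · rw [Real.toNNReal_of_nonpos (by linarith)]
      push Not at hM
      have := norm_nonneg (x.1 - y.1)
      have := norm_nonneg (x.2 - y.2)
      simp only [NNReal.coe_zero, zero_mul]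
      nlinarith
  exact this.continuousOn.comp (f := fun x => (a x, b x)) (ha.prodMk hb)
    fun x hx => ⟨haK hx, hbK hx⟩

namespace HyperbolicSystem.BoundedOn

variable {ν : ℕ} {S : HyperbolicSystem ν} {K : Set (State ν)} {L : ℝ} (B : S.BoundedOn K L)
include B

lemma continuousOn_upwindFlux {X : Type*} [TopologicalSpace X] {s : Set X} {a b : X → State ν}
    {w : Plane} (hw : ‖w‖ = 1) (ha : ContinuousOn a s) (hb : ContinuousOn b s) (haK : MapsTo a s K)
    (hbK : MapsTo b s K) : ContinuousOn (fun x => S.upwindFlux w (a x) (b x)) s := by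
  obtain ⟨M, -, hM⟩ := B.lip_upwindFlux
  exact continuousOn_of_lip_pair (hM w hw) ha hb haK hbK

lemma continuousOn_fluctuation {X : Type*} [TopologicalSpace X] {s : Set X} {a b : X → State ν}
    {w : Plane} (hw : ‖w‖ = 1) (ha : ContinuousOn a s) (hb : ContinuousOn b s) (haK : MapsTo a s K)
    (hbK : MapsTo b s K) : ContinuousOn (fun x => S.fluctuation w (a x) (b x)) s := by
  obtain ⟨M, -, hM⟩ := B.lip_fluctuation
  exact continuousOn_of_lip_pair (hM w hw) ha hb haK hbK

lemma continuousOn_primJacobian (c : Fin 2) :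
    ContinuousOn (fun V => primJacobian S.Q (S.flux c) V) K := by
  have : LipschitzOnWith (Real.toNNReal L) (fun V => primJacobian S.Q (S.flux c) V) K :=
    LipschitzOnWith.of_dist_le_mul fun x hx y hy => by
      rw [dist_eq_norm, dist_eq_norm]
      exact (B.lip_primJacobian c x hx y hy).trans (by gcongr; exact Real.le_coe_toNNReal _)
  exact this.continuousOn

lemma continuousOn_Q : ContinuousOn S.Q K := fun V hV =>
  (S.differentiableAt_Q V (B.subset hV)).continuousAt.continuousWithinAt

variable {P : Polygon} {f : Plane → State ν} {g : Fin (P.m + 3) → Plane → State ν} {Z : State ν}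
  {e J G : ℝ}

/-- Here `a`, `b` are the traces at a face point, `c` is the state at the cell centre and `Z` the
frozen state. Two linearizations are chained, from the numerical flux to the physical flux at `a`,
then from `a` to `c`; the constant is `5 * 2 + 4 * 2 = 18`. -/
lemma norm_pointwise_remainder_le {w : Plane} (hw : ‖w‖ = 1) {a b c Z : State ν} (ha : a ∈ K)
    (hb : b ∈ K) (hc : c ∈ K) (hZ : Z ∈ K) (hae : ‖a - Z‖ ≤ e) (hbe : ‖b - Z‖ ≤ e)
    (hce : ‖c - Z‖ ≤ e) (hbJ : ‖b - a‖ ≤ J) (haJ : ‖a - c‖ ≤ J) :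
    ‖S.upwindFlux w a b - fderiv ℝ S.Q Z (S.fluctuation w a b) - S.normalFlux w c
      - (fderiv ℝ S.Q Z ∘L S.jac w Z) (a - c)‖ ≤ 18 * L ^ 2 * e * J := by
  have h1 := B.norm_upwindFlux_sub_le hw ha hb hZ
  have h2 := B.linearize_normalFlux hw ha hc hZ
  have hL := B.pos
  have he : 0 ≤ e := (norm_nonneg _).trans hae
  have h3 : 5 * L ^ 2 * (‖a - Z‖ + ‖b - Z‖) * ‖b - a‖ ≤ 5 * L ^ 2 * (e + e) * J := by gcongr
  have h4 : 2 * (2 * L ^ 2 * (‖a - Z‖ + ‖c - Z‖) * ‖a - c‖)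
      ≤ 2 * (2 * L ^ 2 * (e + e) * J) := by gcongr
  have e2 : S.upwindFlux w a b - fderiv ℝ S.Q Z (S.fluctuation w a b) - S.normalFlux w c
      - (fderiv ℝ S.Q Z ∘L S.jac w Z) (a - c)
      = (S.upwindFlux w a b - S.normalFlux w a - fderiv ℝ S.Q Z (S.fluctuation w a b))
        + (S.normalFlux w a - S.normalFlux w c - fderiv ℝ S.Q Z (S.jac w Z (a - c))) := by
    rw [ContinuousLinearMap.comp_apply]; abel
  rw [e2]
  refine (norm_add_le _ _).trans ((add_le_add (h1.trans h3) (h2.trans h4)).trans (le_of_eq ?_))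
  ring

/-- The pointwise remainder integrated over one face, split into the terms that are treated
separately when summed over the boundary. -/
lemma norm_face_remainder_le (hf : ContDiff ℝ 1 f) (k : Fin (P.m + 3))
    (hg : ContinuousOn (g k) (P.face k)) (hZ : Z ∈ K) (hfK : ∀ x ∈ P.carrier, f x ∈ K)
    (hfe : ∀ x ∈ P.carrier, ‖f x - Z‖ ≤ e) (hfJ : ∀ x ∈ P.carrier, ‖f x - f P.center‖ ≤ J)
    (hgK : ∀ x ∈ P.face k, g k x ∈ K) (hge : ∀ x ∈ P.face k, ‖g k x - Z‖ ≤ e)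
    (hgJ : ∀ x ∈ P.face k, ‖g k x - f x‖ ≤ J) :
    ‖P.faceIntegral k (fun x => S.upwindFlux (P.normal k) (f x) (g k x))
        - fderiv ℝ S.Q Z (P.faceIntegral k fun x => S.fluctuation (P.normal k) (f x) (g k x))
        - P.faceLength k • S.normalFlux (P.normal k) (f P.center)
        - fderiv ℝ S.Q Z (S.jac (P.normal k) Z
            (P.faceIntegral k f - P.faceLength k • f P.center))‖
      ≤ P.faceLength k * (18 * L ^ 2 * e * J) := by
  set w := P.normal k with hw
  have hw1 : ‖w‖ = 1 := P.norm_normal k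
  have hcf : ContinuousOn f (P.face k) := hf.continuous.continuousOn
  have hm : MapsTo f (P.face k) K := fun x hx => hfK x (P.face_subset k hx)
  have hc1 : ContinuousOn (fun x => S.upwindFlux w (f x) (g k x)) (P.face k) :=
    B.continuousOn_upwindFlux hw1 hcf hg hm hgK
  have hc2 : ContinuousOn (fun x => S.fluctuation w (f x) (g k x)) (P.face k) :=
    B.continuousOn_fluctuation hw1 hcf hg hm hgK
  have hc3 : ContinuousOn (fun x => fderiv ℝ S.Q Z (S.fluctuation w (f x) (g k x))) (P.face k) :=
    (fderiv ℝ S.Q Z).continuous.comp_continuousOn hc2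
  have hc4 : ContinuousOn (fun x => (fderiv ℝ S.Q Z ∘L S.jac w Z) (f x - f P.center))
      (P.face k) :=
    (fderiv ℝ S.Q Z ∘L S.jac w Z).continuous.comp_continuousOn (hcf.sub continuousOn_const)
  have e1 : P.faceIntegral k (fun x => S.upwindFlux w (f x) (g k x)
      - fderiv ℝ S.Q Z (S.fluctuation w (f x) (g k x)) - S.normalFlux w (f P.center)
      - (fderiv ℝ S.Q Z ∘L S.jac w Z) (f x - f P.center))
      = P.faceIntegral k (fun x => S.upwindFlux w (f x) (g k x))
        - fderiv ℝ S.Q Z (P.faceIntegral k fun x => S.fluctuation w (f x) (g k x))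
        - P.faceLength k • S.normalFlux w (f P.center)
        - fderiv ℝ S.Q Z (S.jac w Z (P.faceIntegral k f - P.faceLength k • f P.center)) := by
    rw [P.faceIntegral_sub ((hc1.fun_sub hc3).fun_sub continuousOn_const) hc4,
      P.faceIntegral_sub (hc1.fun_sub hc3) continuousOn_const, P.faceIntegral_sub hc1 hc3,
      P.faceIntegral_clm _ hc2,
      P.faceIntegral_clm (f := fun x => f x - f P.center) _ (hcf.sub continuousOn_const),
      P.faceIntegral_sub hcf continuousOn_const, P.faceIntegral_const, P.faceIntegral_const,
      ContinuousLinearMap.comp_apply]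
  rw [← e1]
  exact P.norm_faceIntegral_le fun x hx => B.norm_pointwise_remainder_le hw1 (hfK x (P.face_subset k hx))
    (hgK x hx) (hfK _ P.center_mem) hZ (hfe x (P.face_subset k hx)) (hge x hx) (hfe _ P.center_mem)
    (hgJ x hx) (hfJ x (P.face_subset k hx))

lemma continuousOn_nonconsTerm (hf : ContDiff ℝ 1 f) (hfK : ∀ x ∈ P.carrier, f x ∈ K) :
    ContinuousOn (S.nonconsTerm f) P.carrier := by
  refine continuousOn_finsetSum _ fun c _ => ?_
  refine ((B.continuousOn_primJacobian c).comp hf.continuous.continuousOn hfK).clm_apply ?_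
  exact ((hf.continuous_fderiv one_ne_zero).clm_apply continuous_const).continuousOn

/-- Freezing the primitive Jacobians at `Z` costs their Lipschitz constant times `e`, multiplied by
the gradient bound; afterwards the volume term has constant coefficients. -/
lemma norm_volume_remainder_le (hf : ContDiff ℝ 1 f) (hZ : Z ∈ K) (hfK : ∀ x ∈ P.carrier, f x ∈ K)
    (hfe : ∀ x ∈ P.carrier, ‖f x - Z‖ ≤ e) (hfG : ∀ x ∈ P.carrier, ‖fderiv ℝ f x‖ ≤ G) :
    ‖fderiv ℝ S.Q Z (∫ x in P.carrier, S.nonconsTerm f x)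
        - ∑ c, S.fluxDeriv c Z (∫ x in P.carrier, fderiv ℝ f x (EuclideanSpace.single c 1))‖
      ≤ P.area * (2 * L ^ 2 * e * G) := by
  have hd : ∀ c, ContinuousOn (fun x => fderiv ℝ f x (EuclideanSpace.single c 1)) P.carrier :=
    fun c => ((hf.continuous_fderiv one_ne_zero).clm_apply continuous_const).continuousOn
  have i1 := Polygon.integrableOn_of_continuousOn (B.continuousOn_nonconsTerm hf hfK)
  have i2 := fun c => Polygon.integrableOn_of_continuousOn (hd c)
  have e1 : fderiv ℝ S.Q Z (∫ x in P.carrier, S.nonconsTerm f x)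
        - ∑ c, S.fluxDeriv c Z (∫ x in P.carrier, fderiv ℝ f x (EuclideanSpace.single c 1))
      = ∫ x in P.carrier, fderiv ℝ S.Q Z (∑ c, (primJacobian S.Q (S.flux c) (f x)
          - primJacobian S.Q (S.flux c) Z) (fderiv ℝ f x (EuclideanSpace.single c 1))) := by
    rw [← ContinuousLinearMap.integral_comp_comm _ i1]
    simp_rw [← fun c => ContinuousLinearMap.integral_comp_comm (S.fluxDeriv c Z) (i2 c)]
    rw [← integral_finsetSum _ fun c _ => (S.fluxDeriv c Z).integrable_comp (i2 c),
      ← integral_sub ((fderiv ℝ S.Q Z).integrable_comp i1)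
        (integrable_finsetSum _ fun c _ => (S.fluxDeriv c Z).integrable_comp (i2 c))]
    congr 1
    ext1 x
    simp only [nonconsTerm, fluxDeriv, _root_.sub_apply, Finset.sum_sub_distrib, map_sub, map_sum,
      ContinuousLinearMap.comp_apply]
  rw [e1]
  refine P.norm_setIntegral_carrier_le fun x hx => ?_
  have hL := B.pos
  have hs : ∀ c ∈ Finset.univ, ‖(primJacobian S.Q (S.flux c) (f x)
      - primJacobian S.Q (S.flux c) Z) (fderiv ℝ f x (EuclideanSpace.single c 1))‖
      ≤ L * e * G := fun c _ => by
    have h1 : ‖fderiv ℝ f x (EuclideanSpace.single c 1)‖ ≤ G := by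
      refine (ContinuousLinearMap.le_opNorm _ _).trans ?_
      simpa using hfG x hx
    have h2 := (B.lip_primJacobian c _ (hfK x hx) Z hZ).trans
      (mul_le_mul_of_nonneg_left (hfe x hx) hL.le)
    exact (ContinuousLinearMap.le_opNorm _ _).trans
      (mul_le_mul h2 h1 (norm_nonneg _) ((norm_nonneg _).trans h2))
  have h3 := (norm_sum_le _ _).trans (Finset.sum_le_sum hs)
  have h4 : ∑ _c : Fin 2, L * e * G = 2 * (L * e * G) := by simp
  rw [h4] at h3
  calc _ ≤ L * (2 * (L * e * G)) := (ContinuousLinearMap.le_opNorm _ _).trans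
        (mul_le_mul (B.norm_fderiv_Q Z hZ) h3 (norm_nonneg _) hL.le)
    _ = _ := by ring

/-- At a fixed time, the flux balance of a cell is close to the balance of the scheme, transformed
to conserved variables at the frozen state `Z`. -/
theorem norm_balance_sub_le (hf : ContDiff ℝ 1 f)
    (hg : ∀ k, ContinuousOn (g k) (P.face k)) (hZ : Z ∈ K) (hfK : ∀ x ∈ P.carrier, f x ∈ K)
    (hfe : ∀ x ∈ P.carrier, ‖f x - Z‖ ≤ e) (hfJ : ∀ x ∈ P.carrier, ‖f x - f P.center‖ ≤ J)
    (hfG : ∀ x ∈ P.carrier, ‖fderiv ℝ f x‖ ≤ G)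
    (hgK : ∀ k, ∀ x ∈ P.face k, g k x ∈ K) (hge : ∀ k, ∀ x ∈ P.face k, ‖g k x - Z‖ ≤ e)
    (hgJ : ∀ k, ∀ x ∈ P.face k, ‖g k x - f x‖ ≤ J) :
    ‖(∑ k, P.faceIntegral k fun x => S.upwindFlux (P.normal k) (f x) (g k x))
        - fderiv ℝ S.Q Z (∑ k, P.faceIntegral k fun x =>
            S.fluctuation (P.normal k) (f x) (g k x))
        - fderiv ℝ S.Q Z (∫ x in P.carrier, S.nonconsTerm f x)‖
      ≤ 18 * L ^ 2 * e * (P.perimeter * J + P.area * G) := by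
  have hface := fun k => B.norm_face_remainder_le hf k (hg k) hZ hfK hfe hfJ (hgK k) (hge k) (hgJ k)
  have hvol := B.norm_volume_remainder_le hf hZ hfK hfe hfG
  have hsum := (norm_sum_le _ _).trans (Finset.sum_le_sum fun k (_ : k ∈ Finset.univ) => hface k)
  rw [← Finset.sum_mul] at hsum
  -- A constant field has no net flux through a closed boundary. This removes the physical flux at
  -- the centre and, in `z2`, the constant `f P.center`.
  have z1 : ∀ v : Fin 2 → State ν, ∑ k, P.faceLength k • ∑ c, P.normal k c • v c = 0 := by
    intro v
    simp_rw [Finset.smul_sum, smul_smul]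
    rw [Finset.sum_comm]
    simp_rw [← Finset.sum_smul, P.sum_normal_eq_zero]
    simp
  -- The divergence theorem with frozen coefficients: the first-order boundary terms are exactly the
  -- frozen volume term.
  have z2 : ∑ k, fderiv ℝ S.Q Z (S.jac (P.normal k) Z (P.faceIntegral k f - P.faceLength k •
      f P.center)) = ∑ c, S.fluxDeriv c Z
        (∫ x in P.carrier, fderiv ℝ f x (EuclideanSpace.single c 1)) := by
    have hj : ∀ k (v : State ν), fderiv ℝ S.Q Z (S.jac (P.normal k) Z v)
        = ∑ c, P.normal k c • S.fluxDeriv c Z v := fun k v => by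
      simp [jac, fluxDeriv]
    have h0 : ∑ k, fderiv ℝ S.Q Z (S.jac (P.normal k) Z (P.faceLength k • f P.center)) = 0 := by
      simp_rw [map_smul, hj]
      exact z1 _
    simp_rw [map_sub, Finset.sum_sub_distrib]
    rw [h0, sub_zero]
    simp_rw [hj, Polygon.setIntegral_fderiv hf, map_sum, map_smul, P.faceIntegral_eq]
    rw [Finset.sum_comm]
    refine Finset.sum_congr rfl fun c _ => Finset.sum_congr rfl fun k _ => ?_
    rw [map_smul, smul_smul, mul_comm]
  have key : (∑ k, P.faceIntegral k fun x => S.upwindFlux (P.normal k) (f x) (g k x))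
        - fderiv ℝ S.Q Z (∑ k, P.faceIntegral k fun x =>
            S.fluctuation (P.normal k) (f x) (g k x))
        - fderiv ℝ S.Q Z (∫ x in P.carrier, S.nonconsTerm f x)
      = (∑ k, (P.faceIntegral k (fun x => S.upwindFlux (P.normal k) (f x) (g k x))
        - fderiv ℝ S.Q Z (P.faceIntegral k fun x => S.fluctuation (P.normal k) (f x) (g k x))
        - P.faceLength k • S.normalFlux (P.normal k) (f P.center)
        - fderiv ℝ S.Q Z (S.jac (P.normal k) Z
            (P.faceIntegral k f - P.faceLength k • f P.center))))
        - (fderiv ℝ S.Q Z (∫ x in P.carrier, S.nonconsTerm f x)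
        - ∑ c, S.fluxDeriv c Z (∫ x in P.carrier, fderiv ℝ f x (EuclideanSpace.single c 1))) := by
    rw [← z2]
    simp only [Finset.sum_sub_distrib, normalFlux, z1, map_sum]
    abel
  rw [key]
  refine (norm_sub_le _ _).trans ((add_le_add hsum hvol).trans ?_)
  rw [← Polygon.perimeter]
  -- The volume constant 2 is enlarged to 18 to share one prefactor; this needs the sign of the
  -- volume bound.
  have hA : 0 ≤ P.area * (2 * L ^ 2 * e * G) := (norm_nonneg _).trans hvol
  nlinarith

end HyperbolicSystem.BoundedOn

/-! ## Integrability in time -/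

namespace Polygon

variable (P : Polygon) {ν : ℕ} {a b : ℝ}

lemma intervalIntegrable_setIntegral (hab : a ≤ b) {Φ : Plane → ℝ → State ν}
    (h : ContinuousOn (fun z : Plane × ℝ => Φ z.1 z.2) (P.carrier ×ˢ Icc a b)) :
    IntervalIntegrable (fun τ => ∫ x in P.carrier, Φ x τ) volume a b := by
  rw [intervalIntegrable_iff_integrableOn_Icc_of_le hab]
  have := h.integrableOn_compact (μ := (volume : Measure Plane).prod (volume : Measure ℝ))
    (P.isCompact_carrier.prod isCompact_Icc)
  rw [IntegrableOn, ← Measure.prod_restrict] at this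
  exact this.integral_prod_right

lemma intervalIntegrable_faceIntegral (hab : a ≤ b) {k : Fin (P.m + 3)} {Φ : Plane → ℝ → State ν}
    (h : ContinuousOn (fun z : Plane × ℝ => Φ z.1 z.2) (P.face k ×ˢ Icc a b)) :
    IntervalIntegrable (fun τ => P.faceIntegral k fun x => Φ x τ) volume a b := by
  suffices hs : IntervalIntegrable (fun τ => ∫ s in (0 : ℝ)..1,
      Φ (P.vert k + s • (P.vert (k + 1) - P.vert k)) τ) volume a b from hs.smul (P.faceLength k)
  rw [intervalIntegrable_iff_integrableOn_Icc_of_le hab]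
  have h' : ContinuousOn (fun z : ℝ × ℝ =>
      Φ (P.vert k + z.1 • (P.vert (k + 1) - P.vert k)) z.2) (Icc 0 1 ×ˢ Icc a b) :=
    h.comp (f := fun z : ℝ × ℝ => (P.vert k + z.1 • (P.vert (k + 1) - P.vert k), z.2))
      (Continuous.continuousOn (by fun_prop))
      fun z hz => ⟨P.add_smul_sub_mem_face k hz.1, hz.2⟩
  have := h'.integrableOn_compact (μ := (volume : Measure ℝ).prod (volume : Measure ℝ))
    (isCompact_Icc.prod isCompact_Icc)
  rw [IntegrableOn, ← Measure.prod_restrict] at this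
  have h2 := this.integral_prod_right
  rw [IntegrableOn]
  simpa only [intervalIntegral.integral_of_le zero_le_one, ← integral_Icc_eq_integral_Ioc] using h2

end Polygon
lemma norm_le_sum_abs {ν : ℕ} (x : State ν) : ‖x‖ ≤ ∑ j, |x j| := by
  have h := (EuclideanSpace.basisFun (Fin ν) ℝ).sum_repr x
  calc ‖x‖ = ‖∑ j, (EuclideanSpace.basisFun (Fin ν) ℝ).repr x j
        • EuclideanSpace.basisFun (Fin ν) ℝ j‖ := by rw [h]
    _ ≤ _ := (norm_sum_le _ _).trans (le_of_eq (by simp [norm_smul]))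

lemma abs_apply_le_norm {ν : ℕ} (x : State ν) (j : Fin ν) : |x j| ≤ ‖x‖ := PiLp.norm_apply_le x j

lemma setIntegral_apply {ν : ℕ} {f : Plane → State ν} {s : Set Plane} (hf : IntegrableOn f s)
    (j : Fin ν) : (∫ x in s, f x) j = ∫ x in s, f x j :=
  ((EuclideanSpace.proj j : State ν →L[ℝ] ℝ).integral_comp_comm hf).symm

lemma intervalIntegral_apply {ν : ℕ} {f : ℝ → State ν} {a b : ℝ}
    (hf : IntervalIntegrable f volume a b) (j : Fin ν) :
    (∫ t in a..b, f t) j = ∫ t in a..b, f t j :=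
  ((EuclideanSpace.proj j : State ν →L[ℝ] ℝ).intervalIntegral_comp_comm hf).symm

/-! ### Estimates for one regular step of the scheme. -/

namespace DiscreteData

/-- A regular step of the scheme, with states in a convex compact set on which the coefficients of
the system are bounded. -/
structure BoundedStep {ν : ℕ} {M : Mesh} (u : DiscreteData ν M) (S : HyperbolicSystem ν) (N : ℕ)
    (K : Set (State ν)) (L σ κ C Cb : ℝ) (n : ℕ) (i : Fin M.numCells) : Prop where
  bounded : S.BoundedOn K L
  scheme : u.IsADERDG S N
  lt : n < u.numSteps
  step : u.RegularStep K σ κ C Cb n i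
  σ_pos : 0 < σ
  κ_pos : 0 < κ
  C_pos : 0 < C
  Cb_pos : 0 < Cb

namespace BoundedStep

variable {ν N n : ℕ} {S : HyperbolicSystem ν} {M : Mesh} {u : DiscreteData ν M}
  {K : Set (State ν)} {L σ κ C Cb : ℝ} {i : Fin M.numCells}
  (h : u.BoundedStep S N K L σ κ C Cb n i)
include h

lemma t_lt : u.t n < u.t (n + 1) := h.scheme.t_lt n h.lt

lemma dt_pos : 0 < u.dt n := sub_pos.2 h.t_lt

lemma size_pos : 0 < (M.cell i).size := h.step.shape.size_pos h.σ_pos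

lemma area_pos : 0 < (M.cell i).area := h.step.shape.area_pos h.σ_pos

lemma contDiff_pred_joint (j : Fin M.numCells) {m : WithTop ℕ∞} :
    ContDiff ℝ m fun z : Plane × ℝ => u.pred n j z.1 z.2 :=
  contDiff_euclidean.2 fun c => (h.scheme.poly_pred n h.lt j c).contDiff

lemma contDiff_pred (j : Fin M.numCells) (τ : ℝ) {m : WithTop ℕ∞} :
    ContDiff ℝ m fun x => u.pred n j x τ :=
  (h.contDiff_pred_joint j).comp (contDiff_id.prodMk contDiff_const)

lemma contDiff_v {m : WithTop ℕ∞} {n' : ℕ} (hn : n' ≤ u.numSteps) : ContDiff ℝ m (u.v n' i) :=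
  contDiff_euclidean.2 fun c => (h.scheme.poly_v n' hn i c).contDiff

lemma continuous_v : Continuous (u.v n i) := (h.contDiff_v (m := 0) h.lt.le).continuous

lemma continuous_v_succ : Continuous (u.v (n + 1) i) :=
  (h.contDiff_v (m := 0) (n' := n + 1) h.lt).continuous

lemma continuous_pred_joint (j : Fin M.numCells) :
    Continuous fun z : Plane × ℝ => u.pred n j z.1 z.2 :=
  (h.contDiff_pred_joint j (m := 0)).continuous

lemma continuousOn_outer (k : Fin ((M.cell i).m + 3)) :
    ContinuousOn (fun z : Plane × ℝ => u.outer n i k z.1 z.2)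
      ((M.cell i).face k ×ˢ Icc (u.t n) (u.t (n + 1))) := by
  have hg := h.scheme.continuous_ghost n h.lt i k
  unfold outer
  cases hk : M.nbr i k with
  | none => exact hg hk
  | some p => exact (h.continuous_pred_joint p.1).continuousOn

lemma continuousOn_nonconsTerm :
    ContinuousOn (fun z : Plane × ℝ => S.nonconsTerm (fun y => u.pred n i y z.2) z.1)
      ((M.cell i).carrier ×ˢ Icc (u.t n) (u.t (n + 1))) := by
  refine continuousOn_finsetSum _ fun c _ => ?_
  refine ((h.bounded.continuousOn_primJacobian c).comp (h.continuous_pred_joint i).continuousOn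
    fun z hz => h.step.values.pred z.2 hz.2 z.1 hz.1).clm_apply ?_
  have h1 : ContDiff ℝ 0 fun z : Plane × ℝ => fderiv ℝ (fun y => u.pred n i y z.2) z.1 := by
    refine ContDiff.fderiv (m := 1) (f := fun (z : Plane × ℝ) y => u.pred n i y z.2) ?_ contDiff_fst
      (by simp)
    exact (h.contDiff_pred_joint i).comp
      (contDiff_snd.prodMk (contDiff_snd.comp contDiff_fst))
  exact (h1.continuous.clm_apply continuous_const).continuousOn

lemma norm_fderiv_pred_le {τ : ℝ} (hτ : τ ∈ Icc (u.t n) (u.t (n + 1))) {x : Plane}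
    (hx : x ∈ (M.cell i).carrier) : ‖fderiv ℝ (fun y => u.pred n i y τ) x‖ ≤ C := by
  obtain ⟨r, hr, hs⟩ := h.step.regular.smooth_pred τ hτ
  have := (le_max_right _ _).trans (hs i x ⟨hx, hr hx⟩)
  rw [mul_comm] at this
  exact le_of_mul_le_mul_right this h.size_pos

lemma norm_pred_sub_center_le {τ : ℝ} (hτ : τ ∈ Icc (u.t n) (u.t (n + 1))) {x : Plane}
    (hx : x ∈ (M.cell i).carrier) :
    ‖u.pred n i x τ - u.pred n i (M.cell i).center τ‖ ≤ C * (M.cell i).size := by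
  obtain ⟨r, hr, hs⟩ := h.step.regular.smooth_pred τ hτ
  exact (le_max_left _ _).trans (hs i x ⟨hx, hr hx⟩)

lemma norm_v_sub_center_le {x : Plane} (hx : x ∈ (M.cell i).carrier) :
    ‖u.v n i x - u.v n i (M.cell i).center‖ ≤ C * (M.cell i).size := by
  obtain ⟨r, hr, hs⟩ := h.step.regular.smooth_v
  exact (le_max_left _ _).trans (hs i x ⟨hx, hr hx⟩)

lemma norm_nonconsTerm_le {τ : ℝ} (hτ : τ ∈ Icc (u.t n) (u.t (n + 1))) {x : Plane}
    (hx : x ∈ (M.cell i).carrier) :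
    ‖S.nonconsTerm (fun y => u.pred n i y τ) x‖ ≤ 2 * L * C := by
  refine (h.bounded.norm_nonconsTerm_le (f := fun y => u.pred n i y τ)
    (h.step.values.pred τ hτ x hx)).trans ?_
  have := h.bounded.pos
  gcongr
  exact h.norm_fderiv_pred_le hτ hx

lemma norm_fluctuation_le (k : Fin ((M.cell i).m + 3)) {τ : ℝ}
    (hτ : τ ∈ Icc (u.t n) (u.t (n + 1))) {x : Plane} (hx : x ∈ (M.cell i).face k) :
    ‖S.fluctuation ((M.cell i).normal k) (u.pred n i x τ) (u.outer n i k x τ)‖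
      ≤ 2 * L * (Cb * (M.cell i).size) := by
  refine (h.bounded.norm_fluctuation_le ((M.cell i).norm_normal k)
    (h.step.values.pred τ hτ x ((M.cell i).face_subset k hx))
    (h.step.values.outer k τ hτ x hx)).trans ?_
  have := h.bounded.pos
  gcongr
  exact h.step.regular.jump k τ hτ x hx

/-! ### The update in one step is of the order of the time step -/

/-- The corrector bounds the tested update by its spatial terms. The fluctuations are `O(h)` on a
perimeter of at most `h / σ`, the volume term is bounded on an area of at most `36 h² / σ²`; both
give `h² Δt`. -/
lemma norm_setIntegral_smul_update_le {φ : Plane → ℝ} (hφ : IsPoly N φ) {m : ℝ}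
    (hm : ∀ x ∈ (M.cell i).carrier, |φ x| ≤ m) :
    ‖∫ x in (M.cell i).carrier, φ x • (u.v (n + 1) i x - u.v n i x)‖
      ≤ (2 * L * Cb / σ + 72 * L * C / σ ^ 2) * (M.cell i).size ^ 2 * m * u.dt n := by
  have hL := h.bounded.pos
  have hs := h.size_pos
  have hσ := h.σ_pos
  have hC := h.C_pos
  have hCb := h.Cb_pos
  have hm0 : 0 ≤ m := (abs_nonneg _).trans (hm _ (M.cell i).center_mem)
  have hcor := h.scheme.corrector n h.lt i φ hφ
  rw [add_assoc] at hcor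
  rw [eq_neg_of_add_eq_zero_left hcor, norm_neg]
  have hI : ∀ τ ∈ uIoc (u.t n) (u.t (n + 1)), τ ∈ Icc (u.t n) (u.t (n + 1)) := fun τ hτ => by
    rw [uIoc_of_le h.t_lt.le] at hτ; exact ⟨hτ.1.le, hτ.2⟩
  have hdt : |u.t (n + 1) - u.t n| = u.dt n := abs_of_pos h.dt_pos
  have h1 : ‖∫ τ in u.t n..u.t (n + 1), ∑ k, (M.cell i).faceIntegral k fun x => φ x •
      S.fluctuation ((M.cell i).normal k) (u.pred n i x τ) (u.outer n i k x τ)‖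
      ≤ ((M.cell i).perimeter * (m * (2 * L * (Cb * (M.cell i).size)))) * u.dt n := by
    rw [← hdt]
    refine intervalIntegral.norm_integral_le_of_norm_le_const fun τ hτ => ?_
    rw [Polygon.perimeter, Finset.sum_mul]
    refine (norm_sum_le _ _).trans (Finset.sum_le_sum fun k _ => ?_)
    refine (M.cell i).norm_faceIntegral_le fun x hx => ?_
    rw [norm_smul]
    exact mul_le_mul (hm x ((M.cell i).face_subset k hx)) (h.norm_fluctuation_le k (hI τ hτ) hx)
      (norm_nonneg _) hm0
  have h2 : ‖∫ τ in u.t n..u.t (n + 1), ∫ x in (M.cell i).carrier, φ x •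
      S.nonconsTerm (fun y => u.pred n i y τ) x‖
      ≤ ((M.cell i).area * (m * (2 * L * C))) * u.dt n := by
    rw [← hdt]
    refine intervalIntegral.norm_integral_le_of_norm_le_const fun τ hτ => ?_
    refine (M.cell i).norm_setIntegral_carrier_le fun x hx => ?_
    rw [norm_smul]
    exact mul_le_mul (hm x hx) (h.norm_nonconsTerm_le (hI τ hτ) hx) (norm_nonneg _) hm0
  refine (norm_add_le _ _).trans ((add_le_add h1 h2).trans ?_)
  have hd := h.dt_pos
  calc _ ≤ ((M.cell i).size / σ * (m * (2 * L * (Cb * (M.cell i).size)))) * u.dt n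
        + (36 / σ ^ 2 * (M.cell i).size ^ 2 * (m * (2 * L * C))) * u.dt n := by
        gcongr
        · exact h.step.shape.2
        · exact h.step.shape.area_le hσ
    _ = _ := by ring

/-- Each component of the update is itself an admissible test function. Testing with it bounds its
`L²` norm squared by `h² Δt` times its maximum; the inverse inequality bounds `h²` times the squared
maximum by that norm squared, and one factor cancels. -/
lemma norm_update_le {A : ℝ} (hA : 0 < A)
    (hinv : ∀ f, IsPoly N f → ∀ x ∈ (M.cell i).carrier,
      (M.cell i).size ^ 2 * f x ^ 2 ≤ A * ∫ y in (M.cell i).carrier, f y ^ 2) {x : Plane}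
    (hx : x ∈ (M.cell i).carrier) :
    ‖u.v (n + 1) i x - u.v n i x‖
      ≤ ν * (A * (2 * L * Cb / σ + 72 * L * C / σ ^ 2)) * u.dt n := by
  have hs := h.size_pos
  have hL := h.bounded.pos
  have hσ := h.σ_pos
  have hC := h.C_pos
  have hCb := h.Cb_pos
  have hd := h.dt_pos
  set D := 2 * L * Cb / σ + 72 * L * C / σ ^ 2
  have hD : 0 < D := by positivity
  have hδc : Continuous fun x => u.v (n + 1) i x - u.v n i x := h.continuous_v_succ.sub h.continuous_v
  have hcomp : ∀ j : Fin ν, |(u.v (n + 1) i x - u.v n i x) j| ≤ A * D * u.dt n := by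
    intro j
    set φ : Plane → ℝ := fun x => u.v (n + 1) i x j - u.v n i x j with hφ
    have hφp : IsPoly N φ := (h.scheme.poly_v (n + 1) h.lt i j).sub (h.scheme.poly_v n h.lt.le i j)
    have hφc : Continuous φ := (hφp.contDiff (n := 0)).continuous
    obtain ⟨y, hy, hmax⟩ := (M.cell i).isCompact_carrier.exists_isMaxOn ⟨_, (M.cell i).center_mem⟩
      hφc.abs.continuousOn
    have hmax' : ∀ z ∈ (M.cell i).carrier, |φ z| ≤ |φ y| := fun z hz => hmax hz
    have h1 := h.norm_setIntegral_smul_update_le hφp hmax'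
    have h2 : ∫ z in (M.cell i).carrier, φ z ^ 2 ≤ D * (M.cell i).size ^ 2 * |φ y| * u.dt n := by
      refine le_trans ?_ h1
      refine le_trans (le_of_eq ?_) ((le_abs_self _).trans (abs_apply_le_norm _ j))
      rw [setIntegral_apply]
      · congr 1; ext z; simp [hφ]; ring
      · exact Polygon.integrableOn_of_continuousOn (hφc.smul hδc).continuousOn
    have h3 := hinv φ hφp y hy
    have h4 : (M.cell i).size ^ 2 * |φ y| ^ 2 ≤ (M.cell i).size ^ 2 * (A * D * u.dt n * |φ y|) := by
      rw [sq_abs]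
      calc _ ≤ _ := h3
        _ ≤ A * (D * (M.cell i).size ^ 2 * |φ y| * u.dt n) := by gcongr
        _ = _ := by ring
    have h5 : |φ y| ^ 2 ≤ A * D * u.dt n * |φ y| := le_of_mul_le_mul_left h4 (by positivity)
    refine (hmax' x hx).trans ?_
    rcases (abs_nonneg (φ y)).eq_or_lt with h0 | h0
    · rw [← h0]; positivity
    · rw [pow_two] at h5
      exact le_of_mul_le_mul_right h5 h0
  refine (norm_le_sum_abs _).trans ((Finset.sum_le_sum fun j _ => hcomp j).trans (le_of_eq ?_))
  simp
  ring

/-! ### The cell mean of the predictor -/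

lemma integrableOn_pred (τ : ℝ) : IntegrableOn (fun x => u.pred n i x τ) (M.cell i).carrier :=
  Polygon.integrableOn_of_continuousOn ((h.contDiff_pred i τ (m := 0)).continuous).continuousOn

lemma continuous_setIntegral_pred :
    Continuous fun τ => ∫ x in (M.cell i).carrier, u.pred n i x τ :=
  continuous_parametric_integral_of_continuous (f := fun τ x => u.pred n i x τ)
    ((h.continuous_pred_joint i).comp continuous_swap) (M.cell i).isCompact_carrier

lemma intervalIntegrable_nonconsTerm : IntervalIntegrable
    (fun τ => ∫ x in (M.cell i).carrier, S.nonconsTerm (fun y => u.pred n i y τ) x) volume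
    (u.t n) (u.t (n + 1)) :=
  (M.cell i).intervalIntegrable_setIntegral h.t_lt.le
    (Φ := fun x τ => S.nonconsTerm (fun y => u.pred n i y τ) x) h.continuousOn_nonconsTerm

lemma norm_setIntegral_nonconsTerm_le {τ : ℝ} (hτ : τ ∈ Icc (u.t n) (u.t (n + 1))) :
    ‖∫ x in (M.cell i).carrier, S.nonconsTerm (fun y => u.pred n i y τ) x‖
      ≤ (M.cell i).area * (2 * L * C) :=
  (M.cell i).norm_setIntegral_carrier_le fun _ hx => h.norm_nonconsTerm_le hτ hx

/-- The predictor equation tested with a polynomial in time. -/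
lemma predictor_time {θ : Polynomial ℝ} (hθ : θ.natDegree ≤ N) :
    (θ.eval (u.t (n + 1)) • ∫ x in (M.cell i).carrier, u.pred n i x (u.t (n + 1)))
      - (∫ τ in u.t n..u.t (n + 1), θ.derivative.eval τ • ∫ x in (M.cell i).carrier, u.pred n i x τ)
    = (θ.eval (u.t n) • ∫ x in (M.cell i).carrier, u.v n i x)
      - ∫ τ in u.t n..u.t (n + 1), θ.eval τ • ∫ x in (M.cell i).carrier,
          S.nonconsTerm (fun y => u.pred n i y τ) x := by
  have := h.scheme.predictor n h.lt i _ (isPolyST_time hθ)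
  simpa only [Polynomial.deriv, integral_smul] using this

/-- `integral_abs_sub_le` applied to the polynomial `p` of cell integrals of the `j`-th component.
-/
lemma integral_abs_setIntegral_pred_sub_le (j : Fin ν) :
    ∫ τ in u.t n..u.t (n + 1), |(∫ x in (M.cell i).carrier, u.pred n i x τ) j
        - (∫ x in (M.cell i).carrier, u.pred n i x (u.t (n + 1))) j|
      ≤ 2 * ((M.cell i).area * (2 * L * C)) * u.dt n ^ 2 := by
  obtain ⟨p, hp, hpe⟩ := (h.scheme.poly_pred n h.lt i j).exists_polynomial_integral (M.cell i)
  have hpe' : ∀ τ, (∫ x in (M.cell i).carrier, u.pred n i x τ) j = p.eval τ := fun τ => by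
    rw [setIntegral_apply (h.integrableOn_pred τ), hpe]
  have hL := h.bounded.pos
  have hC := h.C_pos
  have harea := h.area_pos
  have hHi := h.intervalIntegrable_nonconsTerm
  simp_rw [hpe']
  set g : ℝ → ℝ := fun τ =>
    (∫ x in (M.cell i).carrier, S.nonconsTerm (fun y => u.pred n i y τ) x) j with hg
  have hgi : IntervalIntegrable g volume (u.t n) (u.t (n + 1)) :=
    ⟨(EuclideanSpace.proj j : State ν →L[ℝ] ℝ).integrable_comp hHi.1,
      (EuclideanSpace.proj j : State ν →L[ℝ] ℝ).integrable_comp hHi.2⟩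
  refine integral_abs_sub_le h.t_lt (by positivity) hgi (fun τ hτ =>
    (abs_apply_le_norm _ j).trans (h.norm_setIntegral_nonconsTerm_le hτ)) ?_
  -- The zero at `t n` removes the initial datum from the predictor equation.
  set θ : Polynomial ℝ := (Polynomial.X - Polynomial.C (u.t n)) * p.derivative with hθ
  have hpr := congrArg (fun v : State ν => v j)
    (h.predictor_time (natDegree_sub_C_mul_derivative_le hp (u.t n)))
  rw [← hθ] at hpr
  simp only [PiLp.sub_apply, PiLp.smul_apply, smul_eq_mul] at hpr
  have i1 : IntervalIntegrable (fun τ => θ.derivative.eval τ • ∫ x in (M.cell i).carrier,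
      u.pred n i x τ) volume (u.t n) (u.t (n + 1)) :=
    (θ.derivative.continuous.smul h.continuous_setIntegral_pred).intervalIntegrable _ _
  have i2 : IntervalIntegrable (fun τ => θ.eval τ • ∫ x in (M.cell i).carrier,
      S.nonconsTerm (fun y => u.pred n i y τ) x) volume (u.t n) (u.t (n + 1)) :=
    hHi.continuousOn_smul θ.continuous.continuousOn
  rw [intervalIntegral_apply i1, intervalIntegral_apply i2] at hpr
  simp only [PiLp.smul_apply, smul_eq_mul, hpe'] at hpr
  -- Undoing the integration by parts in time cancels the boundary term at `t (n + 1)` and turns the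
  -- weak equation into `∫ θ p' = -∫ θ g`.
  have hparts : ∫ τ in u.t n..u.t (n + 1), (θ.derivative.eval τ * p.eval τ
      + θ.eval τ * p.derivative.eval τ) = θ.eval (u.t (n + 1)) * p.eval (u.t (n + 1))
        - θ.eval (u.t n) * p.eval (u.t n) :=
    intervalIntegral.integral_eq_sub_of_hasDerivAt
      (fun τ _ => (θ.hasDerivAt τ).mul (p.hasDerivAt τ))
      (Continuous.intervalIntegrable ((θ.derivative.continuous.mul p.continuous).add
        (θ.continuous.mul p.derivative.continuous)) _ _)
  rw [intervalIntegral.integral_add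
    ((θ.derivative.continuous.fun_mul p.continuous).intervalIntegrable _ _)
    ((θ.continuous.fun_mul p.derivative.continuous).intervalIntegrable _ _)] at hparts
  have hθe : ∀ τ, θ.eval τ = (τ - u.t n) * p.derivative.eval τ := fun τ => by simp [hθ]
  have hθ0 : θ.eval (u.t n) = 0 := by simp [hθe]
  rw [hθ0] at hpr hparts
  simp_rw [← hθe]
  linarith

/-- The cell mean of the predictor stays close to the old state, in the mean over the time step. -/
lemma integral_norm_mean_sub_le :
    ∫ τ in u.t n..u.t (n + 1), ‖(∫ x in (M.cell i).carrier, u.pred n i x τ)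
        - (M.cell i).area • u.v n i (M.cell i).center‖
      ≤ ((4 * ν + 2) * L * C * κ + C) * (M.cell i).area * (M.cell i).size * u.dt n := by
  set Z := u.v n i (M.cell i).center
  set a : ℝ → State ν := fun τ => ∫ x in (M.cell i).carrier, u.pred n i x τ
  have hac : Continuous a := h.continuous_setIntegral_pred
  have hL := h.bounded.pos
  have hC := h.C_pos
  have harea := h.area_pos
  have hs := h.size_pos
  have hd := h.dt_pos
  -- The test function `1` links the final cell integral of the predictor to that of the old
  -- solution.
  have h1 : ‖a (u.t (n + 1)) - ∫ x in (M.cell i).carrier, u.v n i x‖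
      ≤ (M.cell i).area * (2 * L * C) * u.dt n := by
    have hpr := h.predictor_time (θ := 1) (by simp)
    simp only [Polynomial.eval_one, one_smul, Polynomial.derivative_one, Polynomial.eval_zero,
      zero_smul, intervalIntegral.integral_zero, sub_zero] at hpr
    have e : a (u.t (n + 1)) - ∫ x in (M.cell i).carrier, u.v n i x
        = -∫ τ in u.t n..u.t (n + 1), ∫ x in (M.cell i).carrier,
          S.nonconsTerm (fun y => u.pred n i y τ) x := by
      rw [show a (u.t (n + 1)) = _ from hpr]; abel
    rw [e, norm_neg]
    have hdt : |u.t (n + 1) - u.t n| = u.dt n := abs_of_pos h.dt_pos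
    rw [← hdt]
    refine intervalIntegral.norm_integral_le_of_norm_le_const fun τ hτ => ?_
    rw [uIoc_of_le h.t_lt.le] at hτ
    exact h.norm_setIntegral_nonconsTerm_le ⟨hτ.1.le, hτ.2⟩
  have h2 : ‖(∫ x in (M.cell i).carrier, u.v n i x) - (M.cell i).area • Z‖
      ≤ (M.cell i).area * (C * (M.cell i).size) := by
    have e : (∫ x in (M.cell i).carrier, u.v n i x) - (M.cell i).area • Z
        = ∫ x in (M.cell i).carrier, (u.v n i x - Z) := by
      rw [integral_sub (Polygon.integrableOn_of_continuousOn h.continuous_v.continuousOn)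
        (Polygon.integrableOn_of_continuousOn continuousOn_const), setIntegral_const]
      rfl
    rw [e]
    exact (M.cell i).norm_setIntegral_carrier_le fun x hx => h.norm_v_sub_center_le hx
  have h3 : ∀ τ ∈ Icc (u.t n) (u.t (n + 1)), ‖a τ - (M.cell i).area • Z‖
      ≤ (∑ j, |a τ j - a (u.t (n + 1)) j|) + ((M.cell i).area * (2 * L * C) * u.dt n
        + (M.cell i).area * (C * (M.cell i).size)) := fun τ _ => by
    have e : a τ - (M.cell i).area • Z = (a τ - a (u.t (n + 1)))
      + ((a (u.t (n + 1)) - ∫ x in (M.cell i).carrier, u.v n i x)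
        + ((∫ x in (M.cell i).carrier, u.v n i x) - (M.cell i).area • Z)) := by abel
    rw [e]
    exact (norm_add_le _ _).trans (add_le_add (norm_le_sum_abs _)
      ((norm_add_le _ _).trans (add_le_add h1 h2)))
  have hci : ∀ j, IntervalIntegrable (fun τ => |a τ j - a (u.t (n + 1)) j|) volume
      (u.t n) (u.t (n + 1)) := fun j => Continuous.intervalIntegrable (by fun_prop) _ _
  have hsum : Continuous fun τ => ∑ j, |a τ j - a (u.t (n + 1)) j| := by fun_prop
  have h4 := intervalIntegral.integral_mono_on h.t_lt.le
    ((hac.sub continuous_const).norm.intervalIntegrable (μ := volume) _ _)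
    ((hsum.add continuous_const).intervalIntegrable (μ := volume) _ _) h3
  refine h4.trans ?_
  simp only [Pi.add_apply]
  rw [intervalIntegral.integral_add (hsum.intervalIntegrable _ _) (by simp),
    intervalIntegral.integral_finsetSum fun j _ => hci j, intervalIntegral.integral_const,
    smul_eq_mul]
  have h5 := Finset.sum_le_sum fun j (_ : j ∈ Finset.univ) =>
    h.integral_abs_setIntegral_pred_sub_le j
  rw [Finset.sum_const, Finset.card_univ, Fintype.card_fin, nsmul_eq_mul] at h5
  refine (add_le_add h5 le_rfl).trans ?_
  have hts := h.step.timeStep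
  change _ + u.dt n * _ ≤ _
  -- The `4 ν` collects the variation in time of the `ν` components, the 2 comes from `h1`; one
  -- factor `Δt` is traded for `κ h`.
  have h6 : (M.cell i).area * L * C * u.dt n * (4 * ν + 2) * u.dt n
      ≤ (M.cell i).area * L * C * u.dt n * (4 * ν + 2) * (κ * (M.cell i).size) := by gcongr
  nlinarith

/-! ### The conservation defect -/

/-- Oscillation in space plus deviation of the cell mean. The deviation is not bounded pointwise in
time here; only its time integral is needed, since it enters the balance estimate linearly. -/
lemma norm_pred_sub_le {τ : ℝ} (hτ : τ ∈ Icc (u.t n) (u.t (n + 1))) {x : Plane}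
    (hx : x ∈ (M.cell i).carrier) :
    ‖u.pred n i x τ - u.v n i (M.cell i).center‖ ≤ 2 * C * (M.cell i).size
      + (M.cell i).area⁻¹ * ‖(∫ x in (M.cell i).carrier, u.pred n i x τ)
        - (M.cell i).area • u.v n i (M.cell i).center‖ := by
  set Z := u.v n i (M.cell i).center
  have harea := h.area_pos
  have e : (M.cell i).area • (u.pred n i x τ - Z)
      = (∫ y in (M.cell i).carrier, (u.pred n i x τ - u.pred n i y τ))
        + ((∫ y in (M.cell i).carrier, u.pred n i y τ) - (M.cell i).area • Z) := by
    rw [integral_sub (Polygon.integrableOn_of_continuousOn continuousOn_const)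
      (h.integrableOn_pred τ), setIntegral_const, smul_sub]
    change _ = (M.cell i).area • _ - _ + _
    abel
  have h1 : ‖∫ y in (M.cell i).carrier, (u.pred n i x τ - u.pred n i y τ)‖
      ≤ (M.cell i).area * (2 * C * (M.cell i).size) := by
    refine (M.cell i).norm_setIntegral_carrier_le fun y hy => ?_
    have h2 := h.norm_pred_sub_center_le hτ hx
    have h3 := h.norm_pred_sub_center_le hτ hy
    rw [norm_sub_rev] at h3
    refine (norm_sub_le_norm_sub_add_norm_sub _ (u.pred n i (M.cell i).center τ) _).trans ?_
    linarith
  have h4 := (congrArg norm e).le.trans (norm_add_le _ _)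
  rw [norm_smul, Real.norm_eq_abs, abs_of_pos harea] at h4
  refine le_of_mul_le_mul_left (h4.trans (add_le_add h1 le_rfl) |>.trans (le_of_eq ?_)) harea
  rw [mul_add, mul_inv_cancel_left₀ harea.ne']

lemma center_mem_states : u.v n i (M.cell i).center ∈ K :=
  h.step.values.v_old _ (M.cell i).center_mem

/-- The defect in terms of the linearization error of `Q` and of the flux balance error. -/
lemma defect_eq : u.defect S S.upwindFlux n i = ((M.cell i).area⁻¹ * (u.dt n)⁻¹) •
    ((∫ x in (M.cell i).carrier, (S.Q (u.v (n + 1) i x) - S.Q (u.v n i x)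
        - fderiv ℝ S.Q (u.v n i (M.cell i).center) (u.v (n + 1) i x - u.v n i x)))
      + ∫ τ in u.t n..u.t (n + 1),
        ((∑ k, (M.cell i).faceIntegral k fun x =>
            S.upwindFlux ((M.cell i).normal k) (u.pred n i x τ) (u.outer n i k x τ))
          - fderiv ℝ S.Q (u.v n i (M.cell i).center) (∑ k, (M.cell i).faceIntegral k fun x =>
            S.fluctuation ((M.cell i).normal k) (u.pred n i x τ) (u.outer n i k x τ))
          - fderiv ℝ S.Q (u.v n i (M.cell i).center) (∫ x in (M.cell i).carrier,
              S.nonconsTerm (fun y => u.pred n i y τ) x))) := by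
  set A := fderiv ℝ S.Q (u.v n i (M.cell i).center)
  have B := h.bounded
  have hQ1 : IntegrableOn (fun x => S.Q (u.v (n + 1) i x)) (M.cell i).carrier :=
    Polygon.integrableOn_of_continuousOn
      (B.continuousOn_Q.comp h.continuous_v_succ.continuousOn h.step.values.v_new)
  have hQ0 : IntegrableOn (fun x => S.Q (u.v n i x)) (M.cell i).carrier :=
    Polygon.integrableOn_of_continuousOn
      (B.continuousOn_Q.comp h.continuous_v.continuousOn h.step.values.v_old)
  have hδ : IntegrableOn (fun x => u.v (n + 1) i x - u.v n i x) (M.cell i).carrier :=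
    Polygon.integrableOn_of_continuousOn (h.continuous_v_succ.sub h.continuous_v).continuousOn
  have hpc : ∀ k, ContinuousOn (fun z : Plane × ℝ => u.pred n i z.1 z.2)
      ((M.cell i).face k ×ˢ Icc (u.t n) (u.t (n + 1))) := fun k =>
    (h.continuous_pred_joint i).continuousOn
  have hpK : ∀ k, MapsTo (fun z : Plane × ℝ => u.pred n i z.1 z.2)
      ((M.cell i).face k ×ˢ Icc (u.t n) (u.t (n + 1))) K := fun k z hz =>
    h.step.values.pred _ hz.2 _ ((M.cell i).face_subset k hz.1)
  have hoK : ∀ k, MapsTo (fun z : Plane × ℝ => u.outer n i k z.1 z.2)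
      ((M.cell i).face k ×ˢ Icc (u.t n) (u.t (n + 1))) K := fun k z hz =>
    h.step.values.outer k _ hz.2 _ hz.1
  have hF : ∀ k, IntervalIntegrable (fun τ => (M.cell i).faceIntegral k fun x =>
      S.upwindFlux ((M.cell i).normal k) (u.pred n i x τ) (u.outer n i k x τ)) volume
      (u.t n) (u.t (n + 1)) := fun k =>
    (M.cell i).intervalIntegrable_faceIntegral h.t_lt.le
      (Φ := fun x τ => S.upwindFlux ((M.cell i).normal k) (u.pred n i x τ) (u.outer n i k x τ))
      (B.continuousOn_upwindFlux ((M.cell i).norm_normal k) (hpc k) (h.continuousOn_outer k)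
        (hpK k) (hoK k))
  have hD : ∀ k, IntervalIntegrable (fun τ => (M.cell i).faceIntegral k fun x =>
      S.fluctuation ((M.cell i).normal k) (u.pred n i x τ) (u.outer n i k x τ)) volume
      (u.t n) (u.t (n + 1)) := fun k =>
    (M.cell i).intervalIntegrable_faceIntegral h.t_lt.le
      (Φ := fun x τ => S.fluctuation ((M.cell i).normal k) (u.pred n i x τ) (u.outer n i k x τ))
      (B.continuousOn_fluctuation ((M.cell i).norm_normal k) (hpc k) (h.continuousOn_outer k)
        (hpK k) (hoK k))
  have hFs : IntervalIntegrable (fun τ => ∑ k, (M.cell i).faceIntegral k fun x =>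
      S.upwindFlux ((M.cell i).normal k) (u.pred n i x τ) (u.outer n i k x τ)) volume
      (u.t n) (u.t (n + 1)) := by
    simpa only [Finset.sum_fn] using IntervalIntegrable.sum Finset.univ fun k _ => hF k
  have hDs : IntervalIntegrable (fun τ => ∑ k, (M.cell i).faceIntegral k fun x =>
      S.fluctuation ((M.cell i).normal k) (u.pred n i x τ) (u.outer n i k x τ)) volume
      (u.t n) (u.t (n + 1)) := by
    simpa only [Finset.sum_fn] using IntervalIntegrable.sum Finset.univ fun k _ => hD k
  have hH := h.intervalIntegrable_nonconsTerm
  -- The matrix `A` is constant on the space-time cell, so it commutes with all the integrals, and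
  -- the corrector replaces the linear part of the change in `Q` by fluctuations and volume terms.
  have hcor := h.scheme.corrector n h.lt i (fun _ => 1) isPoly_one
  simp only [one_smul] at hcor
  have hAi : ∀ {f : ℝ → State ν}, IntervalIntegrable f volume (u.t n) (u.t (n + 1)) →
      IntervalIntegrable (fun τ => A (f τ)) volume (u.t n) (u.t (n + 1)) := fun hf =>
    ⟨A.integrable_comp hf.1, A.integrable_comp hf.2⟩
  have hQ : Integrable (fun x => S.Q (u.v (n + 1) i x) - S.Q (u.v n i x))
      (volume.restrict (M.cell i).carrier) := hQ1.sub hQ0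
  rw [intervalIntegral.integral_sub (hFs.sub (hAi hDs)) (hAi hH),
    intervalIntegral.integral_sub hFs (hAi hDs), A.intervalIntegral_comp_comm hDs,
    A.intervalIntegral_comp_comm hH, intervalIntegral.integral_finsetSum fun k _ => hF k,
    integral_sub hQ (A.integrable_comp hδ), integral_sub hQ1 hQ0,
    A.integral_comp_comm hδ, eq_neg_of_add_eq_zero_left ((add_assoc _ _ _).symm.trans hcor),
    map_neg, map_add]
  unfold defect faceFlux
  rw [← Finset.smul_sum]
  module

/-- The first summand of the constant comes from linearizing `Q`, the second from the flux balance.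
`C1` bounds the update per unit time, `C2` the mean deviation of the predictor, and `C3 * s ^ 2` the
combined perimeter and area factor. -/
theorem norm_defect_le {A : ℝ} (hA : 0 < A)
    (hinv : ∀ f, IsPoly N f → ∀ x ∈ (M.cell i).carrier,
      (M.cell i).size ^ 2 * f x ^ 2 ≤ A * ∫ y in (M.cell i).carrier, f y ^ 2) :
    ‖u.defect S S.upwindFlux n i‖ ≤
      (L * (ν * (A * (2 * L * Cb / σ + 72 * L * C / σ ^ 2)) * κ + 2 * C)
          * (ν * (A * (2 * L * Cb / σ + 72 * L * C / σ ^ 2)))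
        + 18 * L ^ 2 * ((C + Cb) / σ + 36 * C / σ ^ 2)
          * (2 * C + Cb + ((4 * ν + 2) * L * C * κ + C)) / σ ^ 2) * (M.cell i).size := by
  have B := h.bounded
  have hL := B.pos
  have hC := h.C_pos
  have hCb := h.Cb_pos
  have hσ := h.σ_pos
  have hκ := h.κ_pos
  have harea := h.area_pos
  have hs := h.size_pos
  have hd := h.dt_pos
  have hts := h.step.timeStep
  have hZ := h.center_mem_states
  set Z := u.v n i (M.cell i).center with hZdef
  set s := (M.cell i).size with hsdef
  set a := (M.cell i).area with hadef
  set C1 := ν * (A * (2 * L * Cb / σ + 72 * L * C / σ ^ 2)) with hC1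
  have hC1' : 0 ≤ C1 := by positivity
  set C2 := (4 * ν + 2) * L * C * κ + C with hC2
  set C3 := (C + Cb) / σ + 36 * C / σ ^ 2 with hC3
  have hC3' : 0 < C3 := by positivity
  have hδ : ∀ x ∈ (M.cell i).carrier, ‖u.v (n + 1) i x - u.v n i x‖ ≤ C1 * u.dt n :=
    fun x hx => h.norm_update_le hA hinv hx
  have h1 : ‖∫ x in (M.cell i).carrier, (S.Q (u.v (n + 1) i x) - S.Q (u.v n i x)
        - fderiv ℝ S.Q Z (u.v (n + 1) i x - u.v n i x))‖
      ≤ a * (L * (C1 * κ + 2 * C) * s * (C1 * u.dt n)) := by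
    refine (M.cell i).norm_setIntegral_carrier_le fun x hx => ?_
    refine (B.linearize_Q (h.step.values.v_new x hx) (h.step.values.v_old x hx) hZ).trans ?_
    have h2 := h.norm_v_sub_center_le hx
    rw [← hZdef] at h2
    have h3 : ‖u.v (n + 1) i x - Z‖ ≤ C1 * (κ * s) + C * s :=
      (norm_sub_le_norm_sub_add_norm_sub _ (u.v n i x) _).trans
        (add_le_add ((hδ x hx).trans (by gcongr)) h2)
    have h4 : ‖u.v (n + 1) i x - Z‖ + ‖u.v n i x - Z‖ ≤ (C1 * κ + 2 * C) * s := by linarith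
    calc _ ≤ L * ((C1 * κ + 2 * C) * s) * (C1 * u.dt n) := by
          gcongr
          exact hδ x hx
      _ = _ := by ring
  set m : ℝ → ℝ := fun τ => ‖(∫ x in (M.cell i).carrier, u.pred n i x τ) - a • Z‖ with hm
  have hmc : Continuous m := (h.continuous_setIntegral_pred.sub continuous_const).norm
  have hm0 : ∀ τ, 0 ≤ m τ := fun τ => norm_nonneg _
  have hmi : ∫ τ in u.t n..u.t (n + 1), m τ ≤ C2 * a * s * u.dt n := h.integral_norm_mean_sub_le
  have hbal : ∀ τ ∈ Icc (u.t n) (u.t (n + 1)),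
      ‖(∑ k, (M.cell i).faceIntegral k fun x =>
            S.upwindFlux ((M.cell i).normal k) (u.pred n i x τ) (u.outer n i k x τ))
          - fderiv ℝ S.Q Z (∑ k, (M.cell i).faceIntegral k fun x =>
            S.fluctuation ((M.cell i).normal k) (u.pred n i x τ) (u.outer n i k x τ))
          - fderiv ℝ S.Q Z (∫ x in (M.cell i).carrier,
              S.nonconsTerm (fun y => u.pred n i y τ) x)‖
        ≤ 18 * L ^ 2 * (C3 * s ^ 2) * ((2 * C + Cb) * s + a⁻¹ * m τ) := by
    intro τ hτ
    have hp : ∀ x ∈ (M.cell i).carrier, ‖u.pred n i x τ - Z‖ ≤ 2 * C * s + a⁻¹ * m τ :=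
      fun x hx => h.norm_pred_sub_le hτ hx
    have hj : ∀ k, ∀ x ∈ (M.cell i).face k, ‖u.outer n i k x τ - u.pred n i x τ‖ ≤ Cb * s :=
      fun k x hx => h.step.regular.jump k τ hτ x hx
    have key := B.norm_balance_sub_le (P := M.cell i) (f := fun x => u.pred n i x τ)
      (g := fun k x => u.outer n i k x τ) (Z := Z) (e := (2 * C + Cb) * s + a⁻¹ * m τ)
      (J := (C + Cb) * s) (G := C) (h.contDiff_pred i τ)
      (fun k => (h.continuousOn_outer k).comp (f := fun x : Plane => (x, τ))
        (Continuous.continuousOn (by fun_prop)) fun x hx => ⟨hx, hτ⟩)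
      hZ (h.step.values.pred τ hτ)
      (fun x hx => (hp x hx).trans (by nlinarith))
      (fun x hx => (h.norm_pred_sub_center_le hτ hx).trans (by nlinarith))
      (fun x hx => h.norm_fderiv_pred_le hτ hx)
      (fun k x hx => h.step.values.outer k τ hτ x hx)
      (fun k x hx => by
        refine (norm_sub_le_norm_sub_add_norm_sub _ (u.pred n i x τ) _).trans ?_
        have := hp x ((M.cell i).face_subset k hx)
        have := hj k x hx
        linarith)
      (fun k x hx => (hj k x hx).trans (by nlinarith))
    refine key.trans ?_
    have hmτ := hm0 τ
    calc _ ≤ 18 * L ^ 2 * ((2 * C + Cb) * s + a⁻¹ * m τ)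
          * (s / σ * ((C + Cb) * s) + 36 / σ ^ 2 * s ^ 2 * C) := by
          gcongr
          · exact h.step.shape.2
          · exact h.step.shape.area_le hσ
      _ = _ := by rw [hC3]; ring
  have h2 := intervalIntegral.norm_integral_le_of_norm_le h.t_lt.le (μ := volume)
    (Eventually.of_forall fun τ hτ => hbal τ ⟨hτ.1.le, hτ.2⟩)
    (Continuous.intervalIntegrable (by fun_prop) _ _)
  rw [intervalIntegral.integral_const_mul, intervalIntegral.integral_add (by simp)
    ((hmc.const_mul _).intervalIntegrable _ _), intervalIntegral.integral_const_mul a⁻¹,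
    intervalIntegral.integral_const, smul_eq_mul] at h2
  change _ ≤ 18 * L ^ 2 * (C3 * s ^ 2) * (u.dt n * ((2 * C + Cb) * s) + _) at h2
  rw [h.defect_eq, norm_smul, Real.norm_eq_abs, abs_of_pos (by positivity)]
  -- The inscribed disc makes the area at least of order `h²`, which absorbs the factor `s ^ 2` left
  -- by the balance estimate.
  have h3 : a⁻¹ * s ^ 2 ≤ 1 / σ ^ 2 := by
    have := h.step.shape.le_area hσ
    rw [inv_mul_le_iff₀ harea, mul_one_div, le_div_iff₀ (by positivity)]
    linarith [mul_pow σ s 2]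
  calc _ ≤ (a⁻¹ * (u.dt n)⁻¹) * (a * (L * (C1 * κ + 2 * C) * s * (C1 * u.dt n))
        + 18 * L ^ 2 * (C3 * s ^ 2) * (u.dt n * ((2 * C + Cb) * s)
          + a⁻¹ * (C2 * a * s * u.dt n))) := by
        gcongr
        refine (norm_add_le _ _).trans (add_le_add h1 (h2.trans ?_))
        gcongr
    _ = L * (C1 * κ + 2 * C) * C1 * s
        + 18 * L ^ 2 * C3 * (2 * C + Cb + C2) * s * (a⁻¹ * s ^ 2) := by field_simp
    _ ≤ L * (C1 * κ + 2 * C) * C1 * s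
        + 18 * L ^ 2 * C3 * (2 * C + Cb + C2) * s * (1 / σ ^ 2) := by gcongr
    _ = _ := by ring

end BoundedStep

/-! ### Conservation at the faces -/

variable {ν : ℕ} {S : HyperbolicSystem ν} {M : Mesh} {u : DiscreteData ν M}
  {K : Set (State ν)} {L σ κ C Cb : ℝ}

lemma ValuesIn.mono {K' : Set (State ν)} (hK : K ⊆ K') {n : ℕ} {i : Fin M.numCells}
    (h : u.ValuesIn K n i) : u.ValuesIn K' n i :=
  ⟨fun x hx => hK (h.v_old x hx), fun x hx => hK (h.v_new x hx),
    fun τ hτ x hx => hK (h.pred τ hτ x hx), fun k τ hτ x hx => hK (h.outer k τ hτ x hx)⟩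

lemma outer_of_nbr {n : ℕ} {i j : Fin M.numCells} {k : Fin ((M.cell i).m + 3)}
    {l : Fin ((M.cell j).m + 3)} (h : M.nbr i k = some ⟨j, l⟩) : u.outer n i k = u.pred n j := by
  unfold outer
  rw [h]

/-- The neighbour traverses the same segment backwards with the opposite normal and exchanged
traces. Both traces on the face are already in `K` by the hypotheses at cell `i`. -/
lemma faceFlux_add_faceFlux_eq_zero {F : Plane → State ν → State ν → State ν}
    (hF : IsNumericalFlux S F) (hK : K ⊆ S.states) {n : ℕ} {i j : Fin M.numCells}
    {k : Fin ((M.cell i).m + 3)} {l : Fin ((M.cell j).m + 3)} (hkl : M.nbr i k = some ⟨j, l⟩)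
    (ht : u.t n ≤ u.t (n + 1)) (hv : u.ValuesIn K n i) :
    u.faceFlux F n i k + u.faceFlux F n j l = 0 := by
  obtain ⟨h1, h2⟩ := M.nbr_vert i k j l hkl
  have hlen : (M.cell j).faceLength l = (M.cell i).faceLength k := by
    rw [Polygon.faceLength, Polygon.faceLength, h1, h2, norm_sub_rev]
  have hnor : (M.cell j).normal l = -(M.cell i).normal k := by
    rw [Polygon.normal, Polygon.normal, hlen, h1, h2, ← smul_neg]
    congr 1
    ext c
    fin_cases c <;> simp
  unfold faceFlux
  rw [← smul_add, outer_of_nbr hkl, outer_of_nbr (M.nbr_symm i k j l hkl)]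
  have key : (∫ τ in u.t n..u.t (n + 1), (M.cell j).faceIntegral l fun x =>
      F ((M.cell j).normal l) (u.pred n j x τ) (u.pred n i x τ))
      = ∫ τ in u.t n..u.t (n + 1), -(M.cell i).faceIntegral k fun x =>
      F ((M.cell i).normal k) (u.pred n i x τ) (u.pred n j x τ) := by
    refine intervalIntegral.integral_congr fun τ hτ => ?_
    rw [uIcc_of_le ht] at hτ
    simp only [Polygon.faceIntegral_eq, hlen, h1, h2, segInt_swap _ ((M.cell i).vert k)]
    rw [← smul_neg]
    congr 1
    unfold segInt
    rw [← intervalIntegral.integral_neg]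
    refine intervalIntegral.integral_congr fun s hs => ?_
    rw [uIcc_of_le zero_le_one] at hs
    have hx := (M.cell i).add_smul_sub_mem_face k hs
    have ho := hv.outer k τ hτ _ hx
    rw [outer_of_nbr hkl] at ho
    simp only [hnor]
    exact hF.conservative _ ((M.cell i).norm_normal k) _
      (hK (hv.pred τ hτ _ ((M.cell i).face_subset k hx))) _ (hK ho)
  rw [key, intervalIntegral.integral_neg, add_neg_cancel, smul_zero]

lemma balance_eq {F : Plane → State ν → State ν → State ν} {n : ℕ} {i : Fin M.numCells}
    (ha : (M.cell i).area ≠ 0) :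
    (M.cell i).area • ((u.dt n)⁻¹ • (u.consAverage S (n + 1) i - u.consAverage S n i))
        + ∑ k, u.faceFlux F n i k
      = (M.cell i).area • u.defect S F n i := by
  unfold consAverage defect
  rw [smul_add, smul_smul (M.cell i).area (M.cell i).area⁻¹, mul_inv_cancel₀ ha, one_smul,
    ← smul_sub, smul_smul, smul_smul, smul_smul]
  congr 2
  ring

end DiscreteData

/-! ### Uniformity of the constant, and conclusion. -/

/-- The defect is of first order, with a constant that depends only on the system and on the
regularity constants. -/
theorem exists_norm_defect_le {ν : ℕ} (S : HyperbolicSystem ν) (N : ℕ) {K : Set (State ν)}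
    {σ κ C Cb : ℝ} (hK : K ⊆ S.states) (hc : IsCompact K) (hσ : 0 < σ) (hκ : 0 < κ) (hC : 0 < C)
    (hCb : 0 < Cb) : ∃ C' : ℝ, ∀ (M : Mesh) (u : DiscreteData ν M), u.IsADERDG S N →
      ∀ n < u.numSteps, ∀ i, u.RegularStep K σ κ C Cb n i →
        ‖u.defect S S.upwindFlux n i‖ ≤ C' * (M.cell i).size := by
  obtain ⟨K', L, hKK, B⟩ := HyperbolicSystem.exists_boundedOn_superset hK hc
  obtain ⟨A, hA, hinv⟩ := exists_inverse_inequality N hσ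
  -- `K'`, `L` and the inverse constant `A` are fixed before the mesh and the solution, so the
  -- constant of `norm_defect_le` is uniform.
  exact ⟨_, fun M u hu n hn i hR => DiscreteData.BoundedStep.norm_defect_le
    ⟨B, hu, hn, ⟨hR.shape, hR.timeStep, hR.values.mono hKK, hR.regular⟩, hσ, hκ, hC, hCb⟩ hA
    (hinv _ hR.shape)⟩

lemma Mesh.cell_size_le (M : Mesh) (i : Fin M.numCells) : (M.cell i).size ≤ M.size :=
  le_ciSup (f := fun i => (M.cell i).size) (Set.finite_range _).bddAbove i

end QuasiCons

theorem proposition2 {ν : ℕ} (S : QuasiCons.HyperbolicSystem ν) :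
    ∃ F : QuasiCons.Plane → QuasiCons.State ν → QuasiCons.State ν → QuasiCons.State ν,
      QuasiCons.IsNumericalFlux S F ∧
      ∀ (N : ℕ) (K : Set (QuasiCons.State ν)) (σ κ C Cb : ℝ),
        K ⊆ S.states → IsCompact K → 0 < σ → 0 < κ → 0 < C → 0 < Cb →
        (∃ C' : ℝ, ∀ (M : QuasiCons.Mesh) (u : QuasiCons.DiscreteData ν M), u.IsADERDG S N →
          ∀ n < u.numSteps, ∀ i, u.RegularStep K σ κ C Cb n i →
            ‖u.defect S F n i‖ ≤ C' * (M.cell i).size) ∧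
        (∀ (M : ℕ → QuasiCons.Mesh) (u : ∀ r, QuasiCons.DiscreteData ν (M r)),
          Filter.Tendsto (fun r => (M r).size) Filter.atTop (nhds 0) →
          (∀ r, (u r).IsADERDG S N) →
          (∀ r, ∀ n < (u r).numSteps, ∀ i, (u r).RegularStep K σ κ C Cb n i) →
          QuasiCons.IsQuasiConservative S F M u) := by
  refine ⟨S.upwindFlux, S.isNumericalFlux_upwindFlux, fun N K σ κ C Cb hK hc hσ hκ hC hCb => ?_⟩
  obtain ⟨C', h⟩ := QuasiCons.exists_norm_defect_le S N hK hc hσ hκ hC hCb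
  refine ⟨⟨C', h⟩, fun M u hM hu hR => ⟨S.isNumericalFlux_upwindFlux, fun r n hn i =>
    QuasiCons.DiscreteData.balance_eq ((hR r n hn i).shape.area_pos hσ).ne',
    fun r n hn i k j l hkl => QuasiCons.DiscreteData.faceFlux_add_faceFlux_eq_zero
      S.isNumericalFlux_upwindFlux hK hkl ((hu r).t_lt n hn).le (hR r n hn i).values,
    fun ε hε => ?_⟩⟩
  -- The sign of `C'` is not known, so the absolute value allows the size of a cell to be replaced
  -- by the mesh size, which makes the bound uniform in cells and steps.
  have hlim : Tendsto (fun r => |C'| * (M r).size) atTop (𝓝 0) := by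
    simpa using hM.const_mul |C'|
  filter_upwards [hlim.eventually (gt_mem_nhds hε)] with r hr n hn i
  refine (h (M r) (u r) (hu r) n hn i (hR r n hn i)).trans (le_trans ?_ hr.le)
  have hs := ((hR r n hn i).shape.size_pos hσ).le
  exact mul_le_mul (le_abs_self C') ((M r).cell_size_le i) hs (abs_nonneg _)
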